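/- Let $N\ge 1$, $K\ge 2$, $B\ge 0$ be integers, $M=KN$ and $P>0$. Let ${\mathbf H}_1,\dots,{\mathbf H}_K\in\mathbb C^{M\times N}$ be random channel matrices, all of whose entries (over all users) are i.i.d. circularly symmetric complex Gaussian of mean zero and unit variance. Independently of the channels, each user $i$ has a random codebook $\mathcal C_i=({\mathbf W}_{i,1},\dots,{\mathbf W}_{i,2^B})$ of $M\times N$ matrices with orthonormal columns; the ${\mathbf W}_{i,k}$ are independent over all $i$ and $k$, and the column space of each is uniformly distributed on the Grassmannian of $N$-dimensional subspaces of $\mathbb C^M$. For ${\mathbf A},{\mathbf W}\in\mathbb C^{M\times N}$ let $d({\mathbf A},{\mathbf W})=\big(\sum_{k=1}^N\sin^2\theta_k\big)^{1/2}$ be the chordal distance, where $\theta_1,\dots,\theta_N$ are the principal angles between the column spaces of ${\mathbf A}$ and ${\mathbf W}$. Let $\hat{\mathbf H}_i\in\arg\min_{{\mathbf W}\in\mathcal C_i}d^2({\mathbf H}_i,{\mathbf W})$ be the quantization of ${\mathbf H}_i$, and let $$D=E\big[d^2({\mathbf H}_i,\hat{\mathbf H}_i)\big]=E\Big[\min_{{\mathbf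 W}\in\mathcal C_i}d^2({\mathbf H}_i,{\mathbf W})\Big].$$ Block diagonalization with perfect channel knowledge at the transmitter uses precoders ${\mathbf V}_{BD,i}\in\mathbb C^{M\times N}$ with ${\mathbf V}_{BD,i}^H{\mathbf V}_{BD,i}={\mathbf I}_N$ and ${\mathbf H}_j^H{\mathbf V}_{BD,i}={\mathbf 0}$ for all $j\ne i$; with finite rate feedback it uses precoders ${\mathbf V}_i\in\mathbb C^{M\times N}$ with ${\mathbf V}_i^H{\mathbf V}_i={\mathbf I}_N$ and $\hat{\mathbf H}_j^H{\mathbf V}_i={\mathbf 0}$ for all $j\ne i$. For any user $i$ let $$R_{BD}(P)=E\Big[\log_2\Big|{\mathbf I}_N+\tfrac PK{\mathbf H}_i^H{\mathbf V}_{BD,i}{\mathbf V}_{BD,i}^H{\mathbf H}_i\Big|\Big],$$ $$R_{FB}(P)=E\Big[\log_2\Big|{\mathbf I}_N+\tfrac PK\sum_{j=1}^K{\mathbf H}_i^H{\mathbf V}_j{\mathbf V}_j^H{\mathbf H}_i\Big|\Big]-E\Big[\log_2\Big|{\mathbf I}_N+\tfrac PK\sum_{j\ne i}{\mathbf H}_i^H{\mathbf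 V}_j{\mathbf V}_j^H{\mathbf H}_i\Big|\Big],$$ where $|\cdot|$ is the determinant and the expectations are over all channels and codebooks. Then all these expectations are finite, and the rate loss per user satisfies $$R_{BD}(P)-R_{FB}(P)\le N\log_2(1+PD).$$ -/

import Mathlib

open MeasureTheory ProbabilityTheory
open scoped Matrix

noncomputable section

namespace BlockDiag

/-- Matrices carry the product sigma-algebra of their entries. -/
instance matrixMeasurableSpace {m n : ℕ} : MeasurableSpace (Matrix (Fin m) (Fin n) ℂ) :=
  inferInstanceAs (MeasurableSpace (Fin m → Fin n → ℂ))

/-- The circularly symmetric complex Gaussian law of mean zero and unit variance: the real and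
imaginary parts are independent real Gaussians of mean `0` and variance `1/2`. -/
def complexGaussian : Measure ℂ :=
  ((gaussianReal 0 (1 / 2)).prod (gaussianReal 0 (1 / 2))).map
    (fun p : ℝ × ℝ => (p.1 : ℂ) + (p.2 : ℂ) * Complex.I)

/-- The subspace of `ℂ^M` spanned by the columns of `A`, with the Euclidean inner product. -/
def columnSpan {M N : ℕ} (A : Matrix (Fin M) (Fin N) ℂ) :
    Submodule ℂ (EuclideanSpace ℂ (Fin M)) :=
  Submodule.span ℂ (Set.range fun j : Fin N => WithLp.toLp 2 (fun i : Fin M => A i j))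

/-- The `k`-th principal angle (indexed from `0`) between the subspaces `S` and `T`: its cosine is
the `k`-th singular value of the orthogonal projection onto `S`, restricted to `T`
(in orthonormal bases, of the matrix of inner products of basis vectors of `S` and `T`). -/
def principalAngle {E : Type*} [NormedAddCommGroup E] [InnerProductSpace ℂ E]
    [FiniteDimensional ℂ E] (S T : Submodule ℂ E) (k : ℕ) : ℝ :=
  Real.arccos (LinearMap.singularValues (𝕜 := ℂ) (E := T) (F := S)
    ((S.orthogonalProjectionOnto : E →ₗ[ℂ] S) ∘ₗ T.subtype) k)

/-- The chordal distance between the column spaces of two `M × N` matrices. -/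
def chordalDist {M N : ℕ} (A W : Matrix (Fin M) (Fin N) ℂ) : ℝ :=
  Real.sqrt (∑ k ∈ Finset.range N,
    Real.sin (principalAngle (columnSpan A) (columnSpan W) k) ^ 2)

/-- `Q` is a quantization of `A` with the codebook `C`: a codeword that minimizes the squared
chordal distance to `A`. -/
def IsQuantization {M N n : ℕ} (C : Fin n → Matrix (Fin M) (Fin N) ℂ)
    (A Q : Matrix (Fin M) (Fin N) ℂ) : Prop :=
  ∃ k, Q = C k ∧ ∀ l, chordalDist A (C k) ^ 2 ≤ chordalDist A (C l) ^ 2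

/-- `V` is a family of block diagonalization precoders for the channel family `G`: every `V i` has
orthonormal columns, and `(G j)ᴴ V i = 0` for all `j ≠ i`. -/
def IsBDPrecoder {M N K : ℕ} (G V : Fin K → Matrix (Fin M) (Fin N) ℂ) : Prop :=
  ∀ i, (V i)ᴴ * V i = 1 ∧ ∀ j, j ≠ i → (G j)ᴴ * V i = 0

variable {Ω : Type*} [MeasurableSpace Ω]

/-- The random matrix `W` has orthonormal columns and its column space is uniformly distributed on
the Grassmannian of `N`-dimensional subspaces of `ℂ^M`. A subspace is represented by the orthogonal
projection `W Wᴴ` onto it, and uniform means that its law is invariant under the action of the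
unitary group. -/
def IsUniformGrassmannian (μ : Measure Ω) {M N : ℕ} (W : Ω → Matrix (Fin M) (Fin N) ℂ) : Prop :=
  Measurable W ∧ (∀ᵐ ω ∂μ, (W ω)ᴴ * W ω = 1) ∧
    ∀ U ∈ Matrix.unitaryGroup (Fin M) ℂ,
      μ.map (fun ω => U * (W ω * (W ω)ᴴ) * Uᴴ) = μ.map (fun ω => W ω * (W ω)ᴴ)

/-- The channel matrices `H i` have independent entries (over all users and all positions), each of
them complex Gaussian of unit variance. -/
def IsGaussianChannel (μ : Measure Ω) {M N K : ℕ}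
    (H : Fin K → Ω → Matrix (Fin M) (Fin N) ℂ) : Prop :=
  (∀ i, Measurable (H i)) ∧
  (∀ i a b, μ.map (fun ω => H i ω a b) = complexGaussian) ∧
  iIndepFun (fun (p : Fin K × Fin M × Fin N) (ω : Ω) => H p.1 ω p.2.1 p.2.2) μ

/-- Random codebooks of size `n`, one per user: the codewords `W i k` are independent over all
users `i` and all indices `k`, and each is uniformly distributed on the Grassmannian. -/
def IsRandomCodebook (μ : Measure Ω) {M N K n : ℕ}
    (W : Fin K → Fin n → Ω → Matrix (Fin M) (Fin N) ℂ) : Prop :=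
  (∀ i k, IsUniformGrassmannian μ (W i k)) ∧
  iIndepFun (fun (p : Fin K × Fin n) (ω : Ω) => W p.1 p.2 ω) μ

/-- `log₂ det A`, for matrices whose determinant is real. It is used below for matrices `I + X` with
`X` positive semidefinite. -/
def log2Det {N : ℕ} (A : Matrix (Fin N) (Fin N) ℂ) : ℝ := Real.logb 2 A.det.re

/-- `log₂ |I + (P/K) ∑_{j ∈ s} Aᴴ V_j V_jᴴ A|`. -/
def rateTerm {M N K : ℕ} (P : ℝ) (A : Matrix (Fin M) (Fin N) ℂ)
    (V : Fin K → Matrix (Fin M) (Fin N) ℂ) (s : Finset (Fin K)) : ℝ :=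
  log2Det (1 + (P / (K : ℝ)) • ∑ j ∈ s, Aᴴ * V j * (V j)ᴴ * A)

/-- Ergodic rate of user `i` with perfect channel knowledge at the transmitter and
precoders `V`. -/
def rateBD (μ : Measure Ω) {M N K : ℕ} (P : ℝ) (H V : Fin K → Ω → Matrix (Fin M) (Fin N) ℂ)
    (i : Fin K) : ℝ :=
  ∫ ω, rateTerm P (H i ω) (fun j => V j ω) {i} ∂μ

/-- Ergodic rate of user `i` with finite rate feedback and precoders `V`, the interference of the
other users being treated as noise. -/
def rateFB (μ : Measure Ω) {M N K : ℕ} (P : ℝ) (H V : Fin K → Ω → Matrix (Fin M) (Fin N) ℂ)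
    (i : Fin K) : ℝ :=
  (∫ ω, rateTerm P (H i ω) (fun j => V j ω) Finset.univ ∂μ) -
    ∫ ω, rateTerm P (H i ω) (fun j => V j ω) (Finset.univ.erase i) ∂μ

/-- The expected distortion `E[min_{W ∈ C} d²(H, W)]` of the channel `H` quantized with the random
codebook `C`. -/
def distortion (μ : Measure Ω) {M N n : ℕ} (H : Ω → Matrix (Fin M) (Fin N) ℂ)
    (C : Fin n → Ω → Matrix (Fin M) (Fin N) ℂ) : ℝ :=
  ∫ ω, ⨅ k, chordalDist (H ω) (C k ω) ^ 2 ∂μ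

end BlockDiag

end

open BlockDiag

/-!
Only the column spaces of the codewords and of the precoders matter, so everything is expressed
through the projections onto them. Almost surely the Gaussian channels and the codewords are in
general position (`IsCodebookLaw.ae_isGeneric`): nonzero analytic functions of the channels do not
vanish, and a uniformly distributed codeword can be replaced by the column space of a Gaussian
matrix. Hence the quantized subspace and the precoding subspaces are determined by the channels and
the codewords, whatever minimizers and orthonormal bases are chosen, and the precoding projections
are the measurable functions `feedbackProj` and `perfectProj` (built on `kerProj`) of the
realization. All expectations become integrals over the product of the Gaussian law and the law of
the codeword projections, a measure that is invariant under unitary rotations of the channel of a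
user, with or without its codebook.

The rate loss is then bounded as follows.

* The precoding subspace of user `i` is independent of its channel `H_i`, under perfect as well as
  under finite rate feedback, and the law of `H_i` is unitarily invariant. So the signal term
  `log₂ |I + (P/K) H_iᴴ V_i V_iᴴ H_i|` has the same mean in both cases
  (`IsCodebookLaw.integral_signal_eq`), and adding the interference only increases the first term
  of `R_FB`. The rate loss is at most the mean of the interference term.
* By concavity, `log det` lies below its tangent at `(1 + P D) I` (`log_det_le`), which reduces the
  mean of the interference term to the mean power `E tr (H_iᴴ V_j V_jᴴ H_i)`, `j ≠ i`.
* The precoder `V_j` is orthogonal to the quantized subspace of user `i`, so only the component of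
  `H_i` outside this subspace interferes. Rotating `H_i` and its codebook together makes this
  component isotropic in the orthogonal complement, of dimension `M - N`, and `V_j` meets it with
  power at most `N / (M - N)` times its mean power (`IsCodebookLaw.lintegral_interference_le`).
  The column space of `H_i` is independent of its Gram matrix, whence this mean power is `M D`
  (`IsCodebookLaw.lintegral_error_eq`). With `M = K N` the `K - 1` interferers contribute
  `(P/K) M D = N P D` in total, and the tangent bound becomes `N log₂ (1 + P D)`.

Averages over the unitary group are taken as integrals of nonnegative functions in `ENNReal`, which
avoids integrability side conditions until the end.
-/

noncomputable section

namespace BlockDiag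

/-! ### Zero sets of analytic functions -/

/-- A measure is *analytically diffuse* if a real-analytic function that is nonzero at some
point is nonzero almost everywhere. -/
def AnalyticallyDiffuse {E : Type*} [NormedAddCommGroup E] [NormedSpace ℝ E] [MeasurableSpace E]
    (m : Measure E) : Prop :=
  ∀ f : E → ℂ, AnalyticOnNhd ℝ f Set.univ → (∃ x, f x ≠ 0) → ∀ᵐ x ∂m, f x ≠ 0

lemma analyticallyDiffuse_real (m : Measure ℝ) [NullSingletonClass m] : AnalyticallyDiffuse m := by
  rintro f hf ⟨x, hx⟩
  have h := hf.preimage_zero_mem_codiscrete hx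
  have h2 := ae_restrict_le_codiscreteWithin (μ := m) (U := Set.univ) MeasurableSet.univ
  rw [Measure.restrict_univ] at h2
  exact h2 h

section
variable {E F : Type*} [NormedAddCommGroup E] [NormedSpace ℝ E] [MeasurableSpace E]
  [NormedAddCommGroup F] [NormedSpace ℝ F] [MeasurableSpace F]

/-- Almost every slice through a point where the function does not vanish is a nonzero analytic
function, so Fubini applies. -/
lemma AnalyticallyDiffuse.prod [BorelSpace E] [BorelSpace F]
    [SecondCountableTopology E] [SecondCountableTopology F] {m : Measure E} {m' : Measure F}
    [SFinite m] [SFinite m'] (h : AnalyticallyDiffuse m) (h' : AnalyticallyDiffuse m') :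
    AnalyticallyDiffuse (m.prod m') := by
  rintro f hf ⟨⟨x₀, y₀⟩, hxy⟩
  have hcont : Continuous f := continuous_iff_continuousAt.2 fun x => (hf x trivial).continuousAt
  have hmeas : MeasurableSet {z | f z ≠ 0} :=
    (isOpen_ne_fun hcont continuous_const).measurableSet
  rw [Measure.ae_prod_iff_ae_ae hmeas]
  have h1 : ∀ᵐ x ∂m, f (x, y₀) ≠ 0 := by
    refine h (fun x => f (x, y₀)) ?_ ⟨x₀, hxy⟩
    intro x _
    exact (hf (x, y₀) trivial).comp₂ analyticAt_id analyticAt_const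
  filter_upwards [h1] with x hx
  refine h' (fun y => f (x, y)) ?_ ⟨y₀, hx⟩
  intro y _
  exact (hf (x, y) trivial).comp₂ analyticAt_const analyticAt_id

lemma AnalyticallyDiffuse.map [BorelSpace E] [BorelSpace F] {m : Measure E}
    (h : AnalyticallyDiffuse m) (e : E ≃L[ℝ] F) : AnalyticallyDiffuse (m.map e) := by
  rintro f hf ⟨y, hy⟩
  have he : MeasurableEmbedding (e : E → F) := e.toHomeomorph.measurableEmbedding
  rw [he.ae_map_iff]
  refine h (fun x => f (e x)) ?_ ⟨e.symm y, by simpa using hy⟩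
  intro x _
  exact (hf (e x) trivial).comp ((e : E →L[ℝ] F).analyticAt x)

end

lemma AnalyticallyDiffuse.pi_fin {E : Type*} [NormedAddCommGroup E] [NormedSpace ℝ E]
    [MeasurableSpace E] [BorelSpace E] [SecondCountableTopology E] {m : Measure E} [SigmaFinite m]
    (h : AnalyticallyDiffuse m) (n : ℕ) :
    AnalyticallyDiffuse (Measure.pi fun _ : Fin n => m) := by
  induction n with
  | zero =>
    rintro f - ⟨x, hx⟩
    refine Filter.Eventually.of_forall fun y => ?_
    rwa [Subsingleton.elim y x]
  | succ n ih =>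
    have h2 := (h.prod ih).map (Fin.consEquivL ℝ (fun _ : Fin (n+1) => E))
    have h3 := (measurePreserving_piFinSuccAbove (fun _ : Fin (n+1) => m) 0).symm
    have h4 := h3.map_eq
    rw [← h4]
    convert h2 using 2
    ext x i
    refine Fin.cases ?_ (fun j => ?_) i <;> rfl

lemma AnalyticallyDiffuse.pi {E ι : Type*} [Fintype ι] [NormedAddCommGroup E] [NormedSpace ℝ E]
    [MeasurableSpace E] [BorelSpace E] [SecondCountableTopology E] {m : Measure E} [SigmaFinite m]
    (h : AnalyticallyDiffuse m) :
    AnalyticallyDiffuse (Measure.pi fun _ : ι => m) := by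
  have e := (Fintype.equivFin ι).symm
  have h2 := (h.pi_fin (Fintype.card ι)).map
    (ContinuousLinearEquiv.piCongrLeft ℝ (fun _ : ι => E) e)
  have h3 := measurePreserving_piCongrLeft (fun _ : ι => m) e
  have h4 := h3.map_eq
  rw [← h4]
  convert h2 using 2
  rfl

/-! ### Complex Gaussian matrices -/

instance isProbabilityMeasure_complexGaussian : IsProbabilityMeasure complexGaussian := by
  unfold complexGaussian
  exact Measure.isProbabilityMeasure_map (by fun_prop)

lemma complexGaussian_eq_map : complexGaussian =
    ((gaussianReal 0 (1 / 2)).prod (gaussianReal 0 (1 / 2))).map Complex.equivRealProdCLM.symm := by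
  unfold complexGaussian
  congr 1
  ext p
  exact (Complex.equivRealProd_symm_apply p).symm

lemma analyticallyDiffuse_complexGaussian : AnalyticallyDiffuse complexGaussian := by
  rw [complexGaussian_eq_map]
  have : NullSingletonClass (gaussianReal 0 (1 / 2)) :=
    nullSingletonClass_gaussianReal (by norm_num)
  exact ((analyticallyDiffuse_real _).prod (analyticallyDiffuse_real _)).map _

lemma charFun_complexGaussian (t : ℂ) :
    charFun complexGaussian t = Complex.exp (-(‖t‖ : ℂ) ^ 2 / 4) := by
  have h1 : charFun complexGaussian t
      = charFun (gaussianReal 0 (1 / 2)) t.re * charFun (gaussianReal 0 (1 / 2)) t.im := by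
    rw [charFun_apply, complexGaussian, integral_map (by fun_prop) (by fun_prop),
      charFun_apply, charFun_apply, ← integral_prod_mul]
    congr 1
    ext p
    rw [← Complex.exp_add]
    congr 1
    simp [Complex.inner, add_mul]
  rw [h1, charFun_gaussianReal, charFun_gaussianReal, ← Complex.exp_add]
  congr 1
  have : (‖t‖ : ℂ) ^ 2 = (t.re : ℂ) ^ 2 + (t.im : ℂ) ^ 2 := by
    rw [← Complex.ofReal_pow, Complex.sq_norm, Complex.normSq_apply]
    push_cast; ring
  rw [this]
  push_cast
  ring

lemma lintegral_normSq_complexGaussian :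
    ∫⁻ z, ENNReal.ofReal (‖z‖ ^ 2) ∂complexGaussian = 1 := by
  have hv : ∫⁻ x, ENNReal.ofReal (x ^ 2) ∂(gaussianReal 0 (1 / 2)) = ENNReal.ofReal (1 / 2) := by
    have hm : MemLp id 2 (gaussianReal 0 (1 / 2)) := memLp_id_gaussianReal 2
    have hi : Integrable (fun x : ℝ => x ^ 2) (gaussianReal 0 (1 / 2)) := hm.integrable_sq
    rw [← ofReal_integral_eq_lintegral_ofReal hi (Filter.Eventually.of_forall fun x => sq_nonneg _)]
    have := variance_of_integral_eq_zero (μ := gaussianReal 0 (1 / 2)) (X := id) (by fun_prop)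
      (by simp)
    rw [variance_id_gaussianReal] at this
    simp only [id] at this ⊢
    rw [← this]
    norm_num
  rw [complexGaussian, lintegral_map (by fun_prop) (by fun_prop)]
  have : ∀ p : ℝ × ℝ, ENNReal.ofReal (‖(p.1 : ℂ) + (p.2 : ℂ) * Complex.I‖ ^ 2)
      = ENNReal.ofReal (p.1 ^ 2) + ENNReal.ofReal (p.2 ^ 2) := by
    intro p
    rw [← ENNReal.ofReal_add (sq_nonneg _) (sq_nonneg _), Complex.sq_norm,
      Complex.normSq_add_mul_I]
  simp_rw [this]
  rw [lintegral_add_left (by fun_prop), lintegral_prod _ (by fun_prop), lintegral_prod _ (by fun_prop)]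
  simp only [lintegral_const, measure_univ, mul_one, hv]
  rw [← ENNReal.ofReal_add (by norm_num) (by norm_num)]
  norm_num

section
variable {K M N : ℕ}

/-- The law of `K` independent `M × N` matrices with independent standard complex Gaussian
entries. -/
def gaussianFamily (K M N : ℕ) : Measure (Fin K → Matrix (Fin M) (Fin N) ℂ) :=
  (Measure.pi fun _ : Fin K × Fin M × Fin N => complexGaussian).map
    fun x l => Matrix.of fun a b => x (l, a, b)

lemma measurable_matrix_of_entries {α : Type*} [MeasurableSpace α] {f : α → Matrix (Fin M) (Fin N) ℂ}
    (h : ∀ a b, Measurable fun x => f x a b) : Measurable f :=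
  measurable_pi_lambda (X := fun _ => Fin N → ℂ) _ fun a => measurable_pi_lambda _ fun b => h a b

lemma measurable_entry (a : Fin M) (b : Fin N) :
    Measurable fun A : Matrix (Fin M) (Fin N) ℂ => A a b :=
  (measurable_pi_apply b).comp (measurable_pi_apply (X := fun _ => Fin N → ℂ) a)

lemma measurable_family_of_entries :
    Measurable fun (x : Fin K × Fin M × Fin N → ℂ) (l : Fin K) =>
      (Matrix.of fun a b => x (l, a, b) : Matrix (Fin M) (Fin N) ℂ) :=
  measurable_pi_lambda _ fun _ => measurable_matrix_of_entries fun _ _ => measurable_pi_apply _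

instance isProbabilityMeasure_gaussianFamily : IsProbabilityMeasure (gaussianFamily K M N) :=
  Measure.isProbabilityMeasure_map measurable_family_of_entries.aemeasurable

lemma IsGaussianChannel.map_eq {Ω : Type*} [MeasurableSpace Ω] {μ : Measure Ω}
    [IsProbabilityMeasure μ] {H : Fin K → Ω → Matrix (Fin M) (Fin N) ℂ}
    (hH : IsGaussianChannel μ H) :
    μ.map (fun ω i => H i ω) = gaussianFamily K M N := by
  obtain ⟨h1, h2, h3⟩ := hH
  have hm : ∀ p : Fin K × Fin M × Fin N, Measurable fun ω => H p.1 ω p.2.1 p.2.2 :=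
    fun p => (measurable_entry _ _).comp (h1 p.1)
  rw [iIndepFun_iff_map_fun_eq_pi_map fun p => (hm p).aemeasurable] at h3
  simp_rw [h2] at h3
  rw [gaussianFamily, ← h3, Measure.map_map measurable_family_of_entries
    (measurable_pi_lambda _ hm)]
  rfl

lemma sum_norm_sq_unitary_mulVec {U : Matrix (Fin M) (Fin M) ℂ}
    (hU : U ∈ Matrix.unitaryGroup (Fin M) ℂ) (v : Fin M → ℂ) :
    ∑ a, ‖∑ c, U a c * v c‖ ^ 2 = ∑ a, ‖v a‖ ^ 2 := by
  have key : ∀ w : Fin M → ℂ, ((∑ a, ‖w a‖ ^ 2 : ℝ) : ℂ) = star w ⬝ᵥ w := by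
    intro w
    simp [dotProduct, Complex.conj_mul']
  have h : star (U *ᵥ v) ⬝ᵥ (U *ᵥ v) = star v ⬝ᵥ v := by
    rw [Matrix.star_mulVec, ← Matrix.dotProduct_mulVec, Matrix.mulVec_mulVec,
      ← Matrix.star_eq_conjTranspose, Matrix.mem_unitaryGroup_iff'.1 hU, Matrix.one_mulVec]
  have h' : ((∑ a, ‖(U *ᵥ v) a‖ ^ 2 : ℝ) : ℂ) = ((∑ a, ‖v a‖ ^ 2 : ℝ) : ℂ) := by
    rw [key, key, h]
  exact_mod_cast h'

/-- Left multiplication of each matrix of a family by a unitary matrix, as a real linear isometry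
of the space of all entries. -/
def unitaryFamilyIsometry {U : Fin K → Matrix (Fin M) (Fin M) ℂ}
    (hU : ∀ l, U l ∈ Matrix.unitaryGroup (Fin M) ℂ) :
    EuclideanSpace ℂ (Fin K × Fin M × Fin N) →ₗᵢ[ℝ] EuclideanSpace ℂ (Fin K × Fin M × Fin N) where
  toFun x := WithLp.toLp 2 fun p => ∑ c, U p.1 p.2.1 c * x (p.1, c, p.2.2)
  map_add' x y := by
    ext p
    simp [mul_add, Finset.sum_add_distrib]
  map_smul' r x := by
    ext p
    simp [Finset.mul_sum, mul_left_comm]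
  norm_map' x := by
    rw [← sq_eq_sq₀ (norm_nonneg _) (norm_nonneg _), EuclideanSpace.norm_sq_eq,
      EuclideanSpace.norm_sq_eq, Fintype.sum_prod_type, Fintype.sum_prod_type]
    refine Finset.sum_congr rfl fun l _ => ?_
    rw [Fintype.sum_prod_type_right, Fintype.sum_prod_type_right]
    refine Finset.sum_congr rfl fun b _ => ?_
    exact sum_norm_sq_unitary_mulVec (hU l) fun a => x (l, a, b)

lemma charFun_pi_complexGaussian {ι : Type*} [Fintype ι] (t : EuclideanSpace ℂ ι) :
    charFun ((Measure.pi fun _ : ι => complexGaussian).map (WithLp.toLp 2)) t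
      = Complex.exp (-(‖t‖ : ℂ) ^ 2 / 4) := by
  have h := charFun_pi (μ := fun _ : ι => complexGaussian) t
  rw [h]
  simp_rw [charFun_complexGaussian]
  rw [← Complex.exp_sum]
  congr 1
  rw [← Complex.ofReal_pow, EuclideanSpace.norm_sq_eq]
  push_cast
  rw [← Finset.sum_div, Finset.sum_neg_distrib]

/-- The characteristic function of the Gaussian law depends on the norm alone. -/
lemma map_pi_complexGaussian_isometry {ι : Type*} [Fintype ι]
    (f : EuclideanSpace ℂ ι →ₗᵢ[ℝ] EuclideanSpace ℂ ι) :
    ((Measure.pi fun _ : ι => complexGaussian).map (WithLp.toLp 2)).map f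
      = (Measure.pi fun _ : ι => complexGaussian).map (WithLp.toLp 2) := by
  have hp : IsProbabilityMeasure
      ((Measure.pi fun _ : ι => complexGaussian).map (WithLp.toLp 2)) :=
    Measure.isProbabilityMeasure_map (by fun_prop)
  have : IsProbabilityMeasure
      (((Measure.pi fun _ : ι => complexGaussian).map (WithLp.toLp 2)).map f) :=
    Measure.isProbabilityMeasure_map f.continuous.measurable.aemeasurable
  refine Measure.ext_of_charFun ?_
  ext t
  let e := f.toLinearIsometryEquiv rfl
  have he : ∀ x, f x = e x := fun x => rfl
  have h1 : charFun (((Measure.pi fun _ : ι => complexGaussian).map (WithLp.toLp 2)).map f) t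
      = charFun ((Measure.pi fun _ : ι => complexGaussian).map (WithLp.toLp 2)) (e.symm t) := by
    rw [charFun_apply, integral_map f.continuous.measurable.aemeasurable (by fun_prop),
      charFun_apply]
    simp_rw [he, LinearIsometryEquiv.inner_map_eq_flip]
  rw [h1, charFun_pi_complexGaussian, charFun_pi_complexGaussian, e.symm.norm_map]

/-- The Gaussian law is invariant under multiplication on the left by unitary matrices, one for
each member of the family. -/
lemma gaussianFamily_map_unitary {U : Fin K → Matrix (Fin M) (Fin M) ℂ}
    (hU : ∀ l, U l ∈ Matrix.unitaryGroup (Fin M) ℂ) :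
    (gaussianFamily K M N).map (fun H l => U l * H l) = gaussianFamily K M N := by
  have hmul : Measurable fun (H : Fin K → Matrix (Fin M) (Fin N) ℂ) (l : Fin K) => U l * H l := by
    refine measurable_pi_lambda _ fun l => measurable_matrix_of_entries fun a b => ?_
    simp only [Matrix.mul_apply]
    exact Finset.measurable_fun_sum _ fun c _ =>
      ((measurable_entry c b).comp (measurable_pi_apply l)).const_mul _
  have h := map_pi_complexGaussian_isometry (unitaryFamilyIsometry (N := N) hU)
  have h2 := congrArg (fun m => m.map fun (x : EuclideanSpace ℂ (Fin K × Fin M × Fin N))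
    (l : Fin K) => (Matrix.of fun a b => x (l, a, b) : Matrix (Fin M) (Fin N) ℂ)) h
  have hm : Measurable fun (x : EuclideanSpace ℂ (Fin K × Fin M × Fin N))
    (l : Fin K) => (Matrix.of fun a b => x (l, a, b) : Matrix (Fin M) (Fin N) ℂ) :=
    measurable_family_of_entries.comp (WithLp.measurable_ofLp 2 _)
  have hi : Measurable (unitaryFamilyIsometry (N := N) hU) :=
    (unitaryFamilyIsometry (N := N) hU).continuous.measurable
  simp only at h2
  rw [Measure.map_map hm hi, Measure.map_map (hm.comp hi) (by fun_prop),
    Measure.map_map hm (by fun_prop)] at h2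
  rw [gaussianFamily, Measure.map_map hmul measurable_family_of_entries]
  exact h2

/-- A function of a Gaussian family that is analytic in the real and imaginary parts of the entries
and nonzero at one point is almost surely nonzero. -/
lemma gaussianFamily_ae_ne_zero (f : (Fin K → Matrix (Fin M) (Fin N) ℂ) → ℂ)
    (hf : AnalyticOnNhd ℝ
      (fun x : Fin K × Fin M × Fin N → ℂ => f fun l => Matrix.of fun a b => x (l, a, b)) Set.univ)
    (hm : Measurable f) (h : ∃ H, f H ≠ 0) : ∀ᵐ H ∂gaussianFamily K M N, f H ≠ 0 := by
  have hs : MeasurableSet {H | f H ≠ 0} := (measurableSet_eq_fun hm measurable_const).compl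
  rw [gaussianFamily, ae_map_iff measurable_family_of_entries.aemeasurable hs]
  obtain ⟨H, hH⟩ := h
  exact analyticallyDiffuse_complexGaussian.pi _ hf ⟨fun p => H p.1 p.2.1 p.2.2, hH⟩

lemma lintegral_normSq_gaussianFamily (l : Fin K) (a : Fin M) (b : Fin N) :
    ∫⁻ H, ENNReal.ofReal (‖H l a b‖ ^ 2) ∂gaussianFamily K M N = 1 := by
  rw [gaussianFamily, lintegral_map _ measurable_family_of_entries]
  · rw [← lintegral_normSq_complexGaussian]
    have h := measurePreserving_eval (fun _ : Fin K × Fin M × Fin N => complexGaussian) (l, a, b)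
    rw [← h.lintegral_comp (f := fun z => ENNReal.ofReal (‖z‖ ^ 2)) (by fun_prop)]
    rfl
  · have := (measurable_entry a b).comp (measurable_pi_apply (X := fun _ => Matrix (Fin M) (Fin N) ℂ) l)
    exact (this.norm.pow_const 2).ennreal_ofReal

end

/-! ### Orthogonal projections of given rank -/

section projection
variable {M N r : ℕ}

/-- `p` is an orthogonal projection of rank `r`, given through an orthonormal basis of its range. -/
def IsRankProj (r : ℕ) (p : Matrix (Fin M) (Fin M) ℂ) : Prop :=
  ∃ W : Matrix (Fin M) (Fin r) ℂ, Wᴴ * W = 1 ∧ p = W * Wᴴ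

/-- The orthogonal projection onto the column space of a matrix of full column rank. If `A` does not
have full column rank, then the inverse is `0` by convention, and so is `colProj A`. -/
def colProj (A : Matrix (Fin M) (Fin N) ℂ) : Matrix (Fin M) (Fin M) ℂ := A * (Aᴴ * A)⁻¹ * Aᴴ

lemma IsRankProj.conjTranspose_eq {p : Matrix (Fin M) (Fin M) ℂ} (h : IsRankProj r p) :
    pᴴ = p := by
  obtain ⟨W, -, rfl⟩ := h
  simp

lemma IsRankProj.mul_self {p : Matrix (Fin M) (Fin M) ℂ} (h : IsRankProj r p) : p * p = p := by
  obtain ⟨W, hW, rfl⟩ := h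
  rw [Matrix.mul_assoc, ← Matrix.mul_assoc Wᴴ, hW, Matrix.one_mul]

lemma IsRankProj.trace_eq {p : Matrix (Fin M) (Fin M) ℂ} (h : IsRankProj r p) :
    p.trace = r := by
  obtain ⟨W, hW, rfl⟩ := h
  rw [Matrix.trace_mul_comm, hW, Matrix.trace_one, Fintype.card_fin]

lemma IsRankProj.unitary_conj {p U : Matrix (Fin M) (Fin M) ℂ} (h : IsRankProj r p)
    (hU : U ∈ Matrix.unitaryGroup (Fin M) ℂ) : IsRankProj r (U * p * Uᴴ) := by
  obtain ⟨W, hW, rfl⟩ := h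
  refine ⟨U * W, ?_, by simp only [Matrix.conjTranspose_mul, Matrix.mul_assoc]⟩
  rw [Matrix.conjTranspose_mul, Matrix.mul_assoc, ← Matrix.mul_assoc Uᴴ,
    ← Matrix.star_eq_conjTranspose U, Matrix.mem_unitaryGroup_iff'.1 hU, Matrix.one_mul, hW]

/-- The columns of a matrix with `Wᴴ W = 1` can be completed to an orthonormal basis. -/
lemma exists_unitary_extension (hr : r ≤ M) (W : Matrix (Fin M) (Fin r) ℂ) (hW : Wᴴ * W = 1) :
    ∃ U ∈ Matrix.unitaryGroup (Fin M) ℂ, ∀ a (b : Fin r), U a (Fin.castLE hr b) = W a b := by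
  classical
  let w : Fin M → EuclideanSpace ℂ (Fin M) := fun b =>
    if h : (b : ℕ) < r then WithLp.toLp 2 fun a => W a ⟨b, h⟩ else 0
  let s : Set (Fin M) := {b | (b : ℕ) < r}
  have ho : Orthonormal ℂ (s.domRestrict w) := by
    rw [orthonormal_iff_ite]
    rintro ⟨b, hb⟩ ⟨c, hc⟩
    have hb' : (b : ℕ) < r := hb
    have hc' : (c : ℕ) < r := hc
    have h := congrFun (congrFun hW ⟨b, hb'⟩) ⟨c, hc'⟩
    simp only [Set.domRestrict_apply, w, dif_pos hb', dif_pos hc']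
    rw [EuclideanSpace.inner_eq_star_dotProduct, dotProduct_comm]
    rw [Matrix.mul_apply, Matrix.one_apply] at h
    simpa [dotProduct, Fin.ext_iff] using h
  obtain ⟨b, hb⟩ := ho.exists_orthonormalBasis_extension_of_card_eq (by simp)
  refine ⟨Matrix.of fun i j => b j i, ?_, ?_⟩
  · rw [Matrix.mem_unitaryGroup_iff']
    ext i j
    have h := orthonormal_iff_ite.1 b.orthonormal i j
    rw [EuclideanSpace.inner_eq_star_dotProduct, dotProduct_comm] at h
    rw [Matrix.mul_apply, Matrix.one_apply, ← h]
    simp [dotProduct, Matrix.star_apply]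
  · intro a c
    have h := hb (Fin.castLE hr c) c.2
    simp [Matrix.of_apply, h, w]

/-- The unitary group acts transitively on orthonormal `r`-frames. -/
lemma exists_unitary_mul_eq (hr : r ≤ M) {W W' : Matrix (Fin M) (Fin r) ℂ} (hW : Wᴴ * W = 1)
    (hW' : W'ᴴ * W' = 1) : ∃ U ∈ Matrix.unitaryGroup (Fin M) ℂ, U * W = W' := by
  obtain ⟨A, hA, hAW⟩ := exists_unitary_extension hr W hW
  obtain ⟨B, hB, hBW⟩ := exists_unitary_extension hr W' hW'
  let E : Matrix (Fin M) (Fin r) ℂ := Matrix.of fun a b => if a = Fin.castLE hr b then 1 else 0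
  have h1 : A * E = W := by
    ext a b
    simp [Matrix.mul_apply, E, hAW]
  have h2 : B * E = W' := by
    ext a b
    simp [Matrix.mul_apply, E, hBW]
  refine ⟨B * star A, mul_mem hB (Unitary.star_mem hA), ?_⟩
  rw [← h1, ← h2, Matrix.mul_assoc, ← Matrix.mul_assoc (star A),
    Matrix.mem_unitaryGroup_iff'.1 hA, Matrix.one_mul]

lemma IsRankProj.exists_unitary_conj_eq (hr : r ≤ M) {p q : Matrix (Fin M) (Fin M) ℂ}
    (hp : IsRankProj r p) (hq : IsRankProj r q) :
    ∃ U ∈ Matrix.unitaryGroup (Fin M) ℂ, U * p * Uᴴ = q := by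
  obtain ⟨W, hW, rfl⟩ := hp
  obtain ⟨W', hW', rfl⟩ := hq
  obtain ⟨U, hU, rfl⟩ := exists_unitary_mul_eq hr hW hW'
  exact ⟨U, hU, by simp only [Matrix.conjTranspose_mul, Matrix.mul_assoc]⟩

/-- Unitary matrices that commute with a projection act transitively on the unit vectors of its
range. -/
lemma IsRankProj.exists_unitary_fixing {p : Matrix (Fin M) (Fin M) ℂ} (hp : IsRankProj r p)
    {x y : Fin M → ℂ} (hx : p *ᵥ x = x) (hy : p *ᵥ y = y) (hx1 : star x ⬝ᵥ x = 1)
    (hy1 : star y ⬝ᵥ y = 1) :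
    ∃ U ∈ Matrix.unitaryGroup (Fin M) ℂ, U * p * Uᴴ = p ∧ U *ᵥ x = y := by
  obtain ⟨W, hW, rfl⟩ := hp
  have hr : 1 ≤ r := by
    rcases Nat.eq_zero_or_pos r with rfl | h
    · have : W * Wᴴ = 0 := by
        ext a b
        simp [Matrix.mul_apply]
      rw [this, Matrix.zero_mulVec] at hx
      rw [← hx] at hx1
      simp at hx1
    · exact h
  -- The coordinates of a unit vector of the range form an orthonormal `1`-frame.
  have key : ∀ z : Fin M → ℂ, (W * Wᴴ) *ᵥ z = z → star z ⬝ᵥ z = 1 →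
      (Matrix.of fun (a : Fin r) (_ : Fin 1) => (Wᴴ *ᵥ z) a)ᴴ *
        (Matrix.of fun (a : Fin r) (_ : Fin 1) => (Wᴴ *ᵥ z) a) = 1 := by
    intro z hz hz1
    have h : star (Wᴴ *ᵥ z) ⬝ᵥ (Wᴴ *ᵥ z) = 1 := by
      rw [Matrix.star_mulVec, Matrix.conjTranspose_conjTranspose, ← Matrix.dotProduct_mulVec,
        Matrix.mulVec_mulVec, hz, hz1]
    ext i j
    rw [Subsingleton.elim i j, Matrix.one_apply_eq, ← h]
    simp [Matrix.mul_apply, dotProduct]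
  obtain ⟨S, hS, hSx⟩ := exists_unitary_mul_eq hr (key x hx hx1) (key y hy hy1)
  have hS1 : Sᴴ * S = 1 := Matrix.mem_unitaryGroup_iff'.1 hS
  have hS2 : S * Sᴴ = 1 := Matrix.mem_unitaryGroup_iff.1 hS
  have hSv : S *ᵥ (Wᴴ *ᵥ x) = Wᴴ *ᵥ y := by
    ext a
    have := congrFun (congrFun hSx a) 0
    simpa [Matrix.mul_apply, Matrix.mulVec, dotProduct] using this
  have e1 : ∀ (Y : Matrix (Fin r) (Fin M) ℂ), Wᴴ * (W * Y) = Y := fun Y => by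
    rw [← Matrix.mul_assoc, hW, Matrix.one_mul]
  have e2 : ∀ (Y : Matrix (Fin r) (Fin M) ℂ), Sᴴ * (S * Y) = Y := fun Y => by
    rw [← Matrix.mul_assoc, hS1, Matrix.one_mul]
  have e3 : ∀ (Y : Matrix (Fin r) (Fin M) ℂ), S * (Sᴴ * Y) = Y := fun Y => by
    rw [← Matrix.mul_assoc, hS2, Matrix.one_mul]
  refine ⟨W * S * Wᴴ + (1 - W * Wᴴ), ?_, ?_, ?_⟩
  · rw [Matrix.mem_unitaryGroup_iff', Matrix.star_eq_conjTranspose]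
    simp only [Matrix.conjTranspose_add, Matrix.conjTranspose_mul, Matrix.conjTranspose_sub,
      Matrix.conjTranspose_one, Matrix.conjTranspose_conjTranspose, Matrix.mul_add, Matrix.add_mul,
      Matrix.mul_sub, Matrix.sub_mul, Matrix.mul_one, Matrix.one_mul, Matrix.mul_assoc, e1, e2]
    abel
  · simp only [Matrix.conjTranspose_add, Matrix.conjTranspose_mul, Matrix.conjTranspose_sub,
      Matrix.conjTranspose_one, Matrix.conjTranspose_conjTranspose, Matrix.mul_add, Matrix.add_mul,
      Matrix.mul_sub, Matrix.sub_mul, Matrix.mul_one, Matrix.one_mul, Matrix.mul_assoc, e1, e3]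
    abel
  · rw [Matrix.add_mulVec, Matrix.sub_mulVec, Matrix.one_mulVec, hx, sub_self, add_zero,
      ← Matrix.mulVec_mulVec, ← Matrix.mulVec_mulVec, hSv, Matrix.mulVec_mulVec, hy]

/-- The complement of a projection of rank `r` is a projection of rank `M - r`. -/
lemma IsRankProj.one_sub (hr : r ≤ M) {p : Matrix (Fin M) (Fin M) ℂ} (hp : IsRankProj r p) :
    IsRankProj (M - r) (1 - p) := by
  obtain ⟨W, hW, rfl⟩ := hp
  obtain ⟨U, hU, hUW⟩ := exists_unitary_extension hr W hW
  have hM : r + (M - r) = M := by omega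
  have h1 : Uᴴ * U = 1 := Matrix.mem_unitaryGroup_iff'.1 hU
  have h2 : U * Uᴴ = 1 := Matrix.mem_unitaryGroup_iff.1 hU
  refine ⟨Matrix.of fun a (b : Fin (M - r)) => U a (Fin.cast hM (Fin.natAdd r b)), ?_, ?_⟩
  · ext i j
    have := congrFun (congrFun h1 (Fin.cast hM (Fin.natAdd r i))) (Fin.cast hM (Fin.natAdd r j))
    rw [Matrix.mul_apply] at this ⊢
    rw [Matrix.one_apply] at this ⊢
    simpa [Fin.ext_iff] using this
  · rw [sub_eq_iff_eq_add, ← h2]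
    ext i j
    rw [Matrix.add_apply, Matrix.mul_apply, Matrix.mul_apply, Matrix.mul_apply,
      ← (finCongr hM).sum_comp, Fin.sum_univ_add, add_comm]
    congr 1
    refine Finset.sum_congr rfl fun b _ => ?_
    have : (finCongr hM) (Fin.castAdd (M - r) b) = Fin.castLE hr b := by ext; simp
    rw [this]
    simp [hUW]

open scoped ComplexOrder in
lemma IsRankProj.posSemidef {p : Matrix (Fin M) (Fin M) ℂ} (hp : IsRankProj r p) :
    p.PosSemidef := by
  obtain ⟨W, hW, rfl⟩ := hp
  exact Matrix.posSemidef_self_mul_conjTranspose W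

open scoped ComplexOrder MatrixOrder Matrix.Norms.L2Operator in
lemma isRankProj_colProj {A : Matrix (Fin M) (Fin N) ℂ} (hA : (Aᴴ * A).det ≠ 0) :
    IsRankProj N (colProj A) := by
  have hp : (Aᴴ * A)⁻¹.PosSemidef := (Matrix.posSemidef_conjTranspose_mul_self A).inv
  obtain ⟨B, hB⟩ := CStarAlgebra.nonneg_iff_eq_star_mul_self.mp hp.nonneg
  rw [Matrix.star_eq_conjTranspose] at hB
  have hu : IsUnit (Aᴴ * A).det := isUnit_iff_ne_zero.2 hA
  have h1 : Bᴴ * B * (Aᴴ * A) = 1 := by rw [← hB, Matrix.nonsing_inv_mul _ hu]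
  have h2 : B * (Aᴴ * A) * Bᴴ = 1 := by
    rw [mul_eq_one_comm, ← Matrix.mul_assoc]
    exact h1
  refine ⟨A * Bᴴ, ?_, ?_⟩
  · rw [← h2]
    simp [Matrix.mul_assoc]
  · rw [colProj, hB]
    simp [Matrix.mul_assoc]

lemma colProj_eq_zero {A : Matrix (Fin M) (Fin N) ℂ} (hA : (Aᴴ * A).det = 0) :
    colProj A = 0 := by
  rw [colProj, Matrix.nonsing_inv_apply_not_isUnit _ (by simp [hA])]
  simp

lemma colProj_mul_self {A : Matrix (Fin M) (Fin N) ℂ} (hA : (Aᴴ * A).det ≠ 0) :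
    colProj A * A = A := by
  rw [colProj, Matrix.mul_assoc, Matrix.mul_assoc,
    Matrix.nonsing_inv_mul _ (isUnit_iff_ne_zero.2 hA), Matrix.mul_one]

lemma conjTranspose_mul_colProj {A : Matrix (Fin M) (Fin N) ℂ} (hA : (Aᴴ * A).det ≠ 0) :
    Aᴴ * colProj A = Aᴴ := by
  have := congrArg Matrix.conjTranspose (colProj_mul_self hA)
  rwa [Matrix.conjTranspose_mul, (isRankProj_colProj hA).conjTranspose_eq] at this

lemma colProj_unitary_mul {U : Matrix (Fin M) (Fin M) ℂ} (hU : U ∈ Matrix.unitaryGroup (Fin M) ℂ)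
    (A : Matrix (Fin M) (Fin N) ℂ) : colProj (U * A) = U * colProj A * Uᴴ := by
  have h1 : Uᴴ * U = 1 := Matrix.mem_unitaryGroup_iff'.1 hU
  have : (U * A)ᴴ * (U * A) = Aᴴ * A := by
    rw [Matrix.conjTranspose_mul, Matrix.mul_assoc, ← Matrix.mul_assoc Uᴴ, h1, Matrix.one_mul]
  rw [colProj, this, colProj, Matrix.conjTranspose_mul]
  simp only [Matrix.mul_assoc]

/-- An orthonormal basis `V` of the column space of `X` gives the projection onto it. -/
lemma colProj_eq_of_eq_mul {X V : Matrix (Fin M) (Fin N) ℂ} {A : Matrix (Fin N) (Fin N) ℂ}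
    (hV : Vᴴ * V = 1) (h : V = X * A) : colProj X = V * Vᴴ := by
  have h1 : Aᴴ * (Xᴴ * X * A) = 1 := by
    rw [← hV, h, Matrix.conjTranspose_mul]
    simp only [Matrix.mul_assoc]
  have h2 : Xᴴ * X * (A * Aᴴ) = 1 := by
    rw [← Matrix.mul_assoc, mul_eq_one_comm]
    exact h1
  rw [colProj, Matrix.inv_eq_right_inv h2, h, Matrix.conjTranspose_mul]
  simp only [Matrix.mul_assoc]

end projection

/-! ### Determinant inequalities -/

section logdet
open scoped ComplexOrder
variable {N : ℕ}

lemma one_le_det_one_add {n : Type*} [Fintype n] [DecidableEq n] {X : Matrix n n ℂ}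
    (hX : X.PosSemidef) : 1 ≤ (1 + X).det := by
  have hp : (1 + X).PosDef := Matrix.PosDef.one.add_posSemidef hX
  have h1 : ∀ i, 1 ≤ hp.1.eigenvalues i := by
    intro i
    have h := hp.1.mulVec_eigenvectorBasis i
    rw [Matrix.add_mulVec, Matrix.one_mulVec] at h
    have hv := hX.re_dotProduct_nonneg (hp.1.eigenvectorBasis i)
    have h2 : X *ᵥ (hp.1.eigenvectorBasis i).ofLp =
        (hp.1.eigenvalues i - 1) • (hp.1.eigenvectorBasis i).ofLp := by
      rw [sub_smul, one_smul, ← h]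
      simp
    have h3 : star (hp.1.eigenvectorBasis i).ofLp ⬝ᵥ (hp.1.eigenvectorBasis i).ofLp = 1 := by
      have := orthonormal_iff_ite.1 hp.1.eigenvectorBasis.orthonormal i i
      rw [EuclideanSpace.inner_eq_star_dotProduct, dotProduct_comm] at this
      simpa using this
    rw [h2, dotProduct_smul, h3] at hv
    simpa using hv
  rw [hp.1.det_eq_prod_eigenvalues]
  have h2 : (1 : ℝ) ≤ ∏ i, hp.1.eigenvalues i := by
    simpa using Finset.prod_le_prod (s := Finset.univ) (fun _ _ => zero_le_one) fun i _ => h1 i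
  have h3 := Complex.real_le_real.2 h2
  simpa using h3

/-- The determinant is monotone on positive definite matrices. -/
lemma det_re_le_det_re_add {n m : Type*} [Fintype n] [DecidableEq n] [Fintype m] [DecidableEq m]
    {A : Matrix n n ℂ} (hA : A.PosDef) (G : Matrix n m ℂ) :
    A.det.re ≤ (A + G * Gᴴ).det.re := by
  have hdet := hA.det_pos
  rw [Matrix.det_add_mul _ _ (isUnit_iff_ne_zero.2 hdet.ne')]
  have h1 := one_le_det_one_add (hA.inv.posSemidef.conjTranspose_mul_mul_same G)
  have h2 := mul_le_mul_of_nonneg_left h1 hdet.le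
  rw [mul_one] at h2
  exact (Complex.le_def.1 h2).1

/-- The graph of the concave function `log det` lies below its tangent at `c • 1`. -/
lemma log_det_le {n : Type*} [Fintype n] [DecidableEq n] {A : Matrix n n ℂ} (hA : A.PosDef)
    {c : ℝ} (hc : 0 < c) :
    Real.log A.det.re ≤ Fintype.card n * Real.log c + (A.trace.re - Fintype.card n * c) / c := by
  have h1 : A.det.re = ∏ i, hA.1.eigenvalues i := by
    rw [hA.1.det_eq_prod_eigenvalues]
    norm_cast
  have h2 : A.trace.re = ∑ i, hA.1.eigenvalues i := by
    rw [hA.1.trace_eq_sum_eigenvalues]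
    norm_cast
  rw [h1, h2, Real.log_prod fun i _ => (hA.eigenvalues_pos i).ne']
  have h3 : ∀ i, Real.log (hA.1.eigenvalues i) ≤ Real.log c + (hA.1.eigenvalues i - c) / c := by
    intro i
    have hp := hA.eigenvalues_pos i
    have := Real.log_le_sub_one_of_pos (div_pos hp hc)
    rw [Real.log_div hp.ne' hc.ne'] at this
    rw [sub_div, div_self hc.ne']
    linarith
  refine (Finset.sum_le_sum fun i _ => h3 i).trans (le_of_eq ?_)
  rw [Finset.sum_add_distrib, ← Finset.sum_div, Finset.sum_sub_distrib]
  simp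

end logdet

/-! ### Projections onto kernels -/

section kernel
open scoped ComplexOrder
variable {M N K : ℕ}

lemma mulVec_sum_eq_zero {ι : Type*} {s : Finset ι} {A : ι → Matrix (Fin M) (Fin N) ℂ}
    {E : Matrix (Fin M) (Fin N) ℂ} {x : Fin M → ℂ}
    (h : (∑ l ∈ s, A l * (A l)ᴴ + E * Eᴴ) *ᵥ x = 0) :
    (∀ l ∈ s, (A l)ᴴ *ᵥ x = 0) ∧ Eᴴ *ᵥ x = 0 := by
  have key : ∀ B : Matrix (Fin M) (Fin N) ℂ,
      star x ⬝ᵥ ((B * Bᴴ) *ᵥ x) = star (Bᴴ *ᵥ x) ⬝ᵥ (Bᴴ *ᵥ x) := by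
    intro B
    rw [Matrix.star_mulVec, Matrix.conjTranspose_conjTranspose, ← Matrix.dotProduct_mulVec,
      Matrix.mulVec_mulVec]
  have h2 := congrArg (fun v => star x ⬝ᵥ v) h
  simp only [Matrix.add_mulVec, Matrix.sum_mulVec, dotProduct_add, dotProduct_sum, key,
    dotProduct_zero] at h2
  rw [add_eq_zero_iff_of_nonneg (Finset.sum_nonneg fun _ _ => dotProduct_star_self_nonneg _)
    (dotProduct_star_self_nonneg _),
    Finset.sum_eq_zero_iff_of_nonneg fun _ _ => dotProduct_star_self_nonneg _] at h2
  exact ⟨fun l hl => dotProduct_star_self_eq_zero.1 (h2.1 l hl),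
    dotProduct_star_self_eq_zero.1 h2.2⟩

/-- Replacing matrices of full column rank by the projections onto their column spaces preserves
invertibility. -/
lemma det_sum_colProj_ne_zero {ι : Type*} {s : Finset ι} {A : ι → Matrix (Fin M) (Fin N) ℂ}
    {E : Matrix (Fin M) (Fin N) ℂ} (hA : ∀ l ∈ s, ((A l)ᴴ * A l).det ≠ 0)
    (h : (∑ l ∈ s, A l * (A l)ᴴ + E * Eᴴ).det ≠ 0) :
    (∑ l ∈ s, colProj (A l) + E * Eᴴ).det ≠ 0 := by
  intro h0
  obtain ⟨x, hx, hx0⟩ := Matrix.exists_mulVec_eq_zero_iff.2 h0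
  have hW : ∀ l, ∃ W : Matrix (Fin M) (Fin N) ℂ, l ∈ s → Wᴴ * W = 1 ∧ colProj (A l) = W * Wᴴ := by
    intro l
    by_cases hl : l ∈ s
    · obtain ⟨W, hW⟩ := isRankProj_colProj (hA l hl)
      exact ⟨W, fun _ => hW⟩
    · exact ⟨0, fun h => absurd h hl⟩
  choose W hW using hW
  rw [Finset.sum_congr rfl fun l hl => (hW l hl).2] at hx0
  obtain ⟨h1, h2⟩ := mulVec_sum_eq_zero hx0
  refine h (Matrix.exists_mulVec_eq_zero_iff.1 ⟨x, hx, ?_⟩)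
  rw [Matrix.add_mulVec, Matrix.sum_mulVec, ← Matrix.mulVec_mulVec, h2, Matrix.mulVec_zero,
    add_zero]
  refine Finset.sum_eq_zero fun l hl => ?_
  rw [← Matrix.mulVec_mulVec, ← conjTranspose_mul_colProj (hA l hl), ← Matrix.mulVec_mulVec,
    (hW l hl).2, ← Matrix.mulVec_mulVec, h1 l hl]
  simp

/-- The projection onto the kernel of a positive semidefinite matrix `T` for which `T + E Eᴴ` is
invertible and whose kernel has dimension `N`, the number of columns of `E`. The kernel is then the
column space of `(T + E Eᴴ)⁻¹ E`, which depends measurably on `T`. If `T + E Eᴴ` is singular, its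
inverse is `0` by convention, and so is `kerProj E T`. -/
def kerProj (E : Matrix (Fin M) (Fin N) ℂ) (T : Matrix (Fin M) (Fin M) ℂ) :
    Matrix (Fin M) (Fin M) ℂ :=
  colProj ((T + E * Eᴴ)⁻¹ * E)

/-- An orthonormal `N`-frame in the kernel of `T` determines `kerProj E T`. -/
lemma kerProj_eq {E V : Matrix (Fin M) (Fin N) ℂ} {T : Matrix (Fin M) (Fin M) ℂ}
    (hT : (T + E * Eᴴ).det ≠ 0) (hTV : T * V = 0) (hV : Vᴴ * V = 1) :
    kerProj E T = V * Vᴴ := by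
  refine colProj_eq_of_eq_mul (A := Eᴴ * V) hV ?_
  have h : (T + E * Eᴴ) * V = E * (Eᴴ * V) := by
    rw [Matrix.add_mul, hTV, zero_add, Matrix.mul_assoc]
  rw [Matrix.mul_assoc, ← h, ← Matrix.mul_assoc,
    Matrix.nonsing_inv_mul _ (isUnit_iff_ne_zero.2 hT), Matrix.one_mul]

lemma kerProj_eq_zero_or (E : Matrix (Fin M) (Fin N) ℂ) (T : Matrix (Fin M) (Fin M) ℂ) :
    kerProj E T = 0 ∨ IsRankProj N (kerProj E T) := by
  by_cases h : (((T + E * Eᴴ)⁻¹ * E)ᴴ * ((T + E * Eᴴ)⁻¹ * E)).det = 0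
  · exact Or.inl (colProj_eq_zero h)
  · exact Or.inr (isRankProj_colProj h)

/-- The kernel of a sum of `#s` projections of rank `N` has dimension at least `M - #s N ≥ N`.
If `T + E Eᴴ` is invertible, the kernel is contained in the range of `(T + E Eᴴ)⁻¹ E`, which has
dimension at most `N`, so that the two spaces agree. -/
lemma mul_kerProj_eq_zero {ι : Type*} {s : Finset ι} {E : Matrix (Fin M) (Fin N) ℂ}
    {p : ι → Matrix (Fin M) (Fin M) ℂ} (hp : ∀ l ∈ s, IsRankProj N (p l))
    (hs : s.card * N + N ≤ M) {l : ι} (hl : l ∈ s) :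
    p l * kerProj E (∑ k ∈ s, p k) = 0 := by
  classical
  set T := ∑ k ∈ s, p k with hTdef
  by_cases hT : (T + E * Eᴴ).det = 0
  · have : (T + E * Eᴴ)⁻¹ = 0 := Matrix.nonsing_inv_apply_not_isUnit _ (by simp [hT])
    simp [kerProj, colProj, this]
  have hW : ∀ l, ∃ W : Matrix (Fin M) (Fin N) ℂ, l ∈ s → Wᴴ * W = 1 ∧ p l = W * Wᴴ := by
    intro l
    by_cases hl : l ∈ s
    · obtain ⟨W, hW⟩ := hp l hl
      exact ⟨W, fun _ => hW⟩
    · exact ⟨0, fun h => absurd h hl⟩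
  choose W hW using hW
  set X := (T + E * Eᴴ)⁻¹ * E with hX
  let f : (Fin M → ℂ) →ₗ[ℂ] (s → Fin N → ℂ) := LinearMap.pi fun k => (W k)ᴴ.mulVecLin
  have hker : ∀ x, x ∈ f.ker → T *ᵥ x = 0 ∧ ∀ k ∈ s, p k *ᵥ x = 0 := by
    intro x hx
    have h1 : ∀ k ∈ s, p k *ᵥ x = 0 := by
      intro k hk
      have := congrFun (LinearMap.mem_ker.1 hx) ⟨k, hk⟩
      have h2 : (W k)ᴴ *ᵥ x = 0 := this
      rw [(hW k hk).2, ← Matrix.mulVec_mulVec, h2, Matrix.mulVec_zero]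
    refine ⟨?_, h1⟩
    rw [hTdef, Matrix.sum_mulVec]
    exact Finset.sum_eq_zero h1
  have hle : f.ker ≤ X.mulVecLin.range := by
    intro x hx
    refine ⟨Eᴴ *ᵥ x, ?_⟩
    have h1 : (T + E * Eᴴ) *ᵥ x = E *ᵥ (Eᴴ *ᵥ x) := by
      rw [Matrix.add_mulVec, (hker x hx).1, zero_add, Matrix.mulVec_mulVec]
    rw [Matrix.mulVecLin_apply, hX, ← Matrix.mulVec_mulVec, ← h1, Matrix.mulVec_mulVec,
      Matrix.nonsing_inv_mul _ (isUnit_iff_ne_zero.2 hT), Matrix.one_mulVec]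
  have hdim : Module.finrank ℂ X.mulVecLin.range ≤ Module.finrank ℂ f.ker := by
    have h1 : Module.finrank ℂ X.mulVecLin.range ≤ N := by
      simpa using X.mulVecLin.finrank_range_le
    have h2 := f.finrank_range_add_finrank_ker
    have h3 : Module.finrank ℂ f.range ≤ s.card * N := by
      refine (Submodule.finrank_le _).trans (le_of_eq ?_)
      rw [Module.finrank_pi_fintype]
      simp
    rw [Module.finrank_fin_fun] at h2
    omega
  have heq := Submodule.eq_of_le_of_finrank_le hle hdim
  have hpX : p l * X = 0 := by
    ext a b
    have hx : X *ᵥ Pi.single b 1 ∈ f.ker := by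
      rw [heq]
      exact ⟨_, rfl⟩
    have := congrFun ((hker _ hx).2 l hl) a
    rw [Matrix.mulVec_mulVec] at this
    simpa using this
  rw [kerProj, colProj, ← Matrix.mul_assoc, ← Matrix.mul_assoc, hpX]
  simp

end kernel

/-! ### The chordal distance as a trace -/

section chordal
variable {M N : ℕ}

lemma toLp_mulVec_mem_columnSpan (A : Matrix (Fin M) (Fin N) ℂ) (v : Fin N → ℂ) :
    WithLp.toLp 2 (A *ᵥ v) ∈ columnSpan A := by
  have h : WithLp.toLp 2 (A *ᵥ v) = ∑ j, v j • WithLp.toLp 2 (fun i => A i j) := by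
    ext i
    simp [Matrix.mulVec, dotProduct, mul_comm]
  rw [h]
  exact Submodule.sum_mem _ fun j _ => Submodule.smul_mem _ _ (Submodule.subset_span ⟨j, rfl⟩)

/-- For a matrix of full column rank, `colProj` is the orthogonal projection onto `columnSpan`. -/
lemma starProjection_columnSpan {A : Matrix (Fin M) (Fin N) ℂ} (hA : (Aᴴ * A).det ≠ 0)
    (x : Fin M → ℂ) :
    (columnSpan A).starProjection (WithLp.toLp 2 x) = WithLp.toLp 2 (colProj A *ᵥ x) := by
  refine Submodule.eq_starProjection_of_mem_orthogonal ?_ ?_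
  · rw [colProj, Matrix.mul_assoc, ← Matrix.mulVec_mulVec]
    exact toLp_mulVec_mem_columnSpan A _
  · have h : Aᴴ *ᵥ (x - colProj A *ᵥ x) = 0 := by
      rw [Matrix.mulVec_sub, Matrix.mulVec_mulVec, conjTranspose_mul_colProj hA, sub_self]
    rw [columnSpan, Submodule.mem_orthogonal]
    intro u hu
    induction hu using Submodule.span_induction with
    | mem u hu =>
      obtain ⟨j, rfl⟩ := hu
      have := congrFun h j
      rw [EuclideanSpace.inner_eq_star_dotProduct, dotProduct_comm]
      simpa [Matrix.mulVec, dotProduct] using this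
    | zero => simp
    | add u v _ _ hu hv => rw [inner_add_left, hu, hv, add_zero]
    | smul c u _ hu => rw [inner_smul_left, hu, mul_zero]

lemma orthonormal_columns {W : Matrix (Fin M) (Fin N) ℂ} (hW : Wᴴ * W = 1) :
    Orthonormal ℂ fun j : Fin N => (WithLp.toLp 2 fun i => W i j : EuclideanSpace ℂ (Fin M)) := by
  rw [orthonormal_iff_ite]
  intro i j
  have h := congrFun (congrFun hW i) j
  rw [Matrix.mul_apply, Matrix.one_apply] at h
  rw [← h, EuclideanSpace.inner_eq_star_dotProduct, dotProduct_comm]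
  simp [dotProduct]

/-- The squared singular values of the projection from one column space to another add up to the
trace of the product of the two orthogonal projections. -/
lemma chordalDist_sq {A W : Matrix (Fin M) (Fin N) ℂ} (hA : (Aᴴ * A).det ≠ 0)
    (hW : Wᴴ * W = 1) :
    chordalDist A W ^ 2 = N - (colProj A * (W * Wᴴ)).trace.re := by
  set S := columnSpan A with hS
  set T := columnSpan W with hT
  let f : T →ₗ[ℂ] S := (S.orthogonalProjectionOnto : EuclideanSpace ℂ (Fin M) →ₗ[ℂ] S) ∘ₗ T.subtype
  have hfn : ∀ v : T, ‖f v‖ ≤ ‖v‖ := fun v => S.norm_orthogonalProjectionOnto_apply_le v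
  have how := orthonormal_columns hW
  let w : Fin N → T := fun j => ⟨WithLp.toLp 2 fun i => W i j, Submodule.subset_span ⟨j, rfl⟩⟩
  have how' : Orthonormal ℂ w := by
    rw [orthonormal_iff_ite] at how ⊢
    exact how
  have hspan : ⊤ ≤ Submodule.span ℂ (Set.range w) := by
    have h : (Submodule.span ℂ (Set.range w)).map T.subtype = T := by
      rw [Submodule.map_span, ← Set.range_comp]
      rfl
    rintro x -
    obtain ⟨y, hy, hyx⟩ := h.ge x.2
    rwa [← Subtype.ext (a1 := y) (a2 := x) hyx]
  let b : OrthonormalBasis (Fin N) ℂ T := OrthonormalBasis.mk how' hspan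
  have hb : ∀ j, b j = w j := fun j => by simp [b]
  have hdim : Module.finrank ℂ T = N := by
    rw [Module.finrank_eq_card_basis b.toBasis, Fintype.card_fin]
  have hsym := LinearMap.isSymmetric_adjoint_comp_self (𝕜 := ℂ) (E := T) (F := S) f
  have hle : ∀ i : Fin N, hsym.eigenvalues hdim i ≤ 1 := by
    intro i
    have h1 := hsym.apply_eigenvectorBasis hdim i
    set v := hsym.eigenvectorBasis hdim i with hv
    have hv1 : ‖v‖ = 1 := (hsym.eigenvectorBasis hdim).orthonormal.1 i
    have h2 : inner ℂ ((LinearMap.adjoint (𝕜 := ℂ) (E := T) (F := S) f ∘ₗ f) v) v = inner ℂ (f v) (f v) := by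
      rw [LinearMap.comp_apply, LinearMap.adjoint_inner_left]
    rw [h1, inner_smul_left, inner_self_eq_norm_sq_to_K, inner_self_eq_norm_sq_to_K (𝕜 := ℂ) (f v),
      hv1] at h2
    have h3 : hsym.eigenvalues hdim i = ‖f v‖ ^ 2 := by
      have := congrArg Complex.re h2
      simpa [← Complex.ofReal_pow] using this
    rw [h3]
    have := hfn v
    rw [hv1] at this
    exact pow_le_one₀ (norm_nonneg _) this
  have hterm : ∀ i : Fin N, Real.sin (principalAngle S T i) ^ 2
      = 1 - hsym.eigenvalues hdim i := by
    intro i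
    have hs := LinearMap.sq_singularValues_fin (𝕜 := ℂ) (E := T) (F := S) f hdim i
    have : principalAngle S T i = Real.arccos (LinearMap.singularValues (𝕜 := ℂ) (E := T) (F := S) f i) := rfl
    rw [this, Real.sin_arccos, hs, Real.sq_sqrt (by linarith [hle i])]
  have htr : (∑ i, hsym.eigenvalues hdim i) = (colProj A * (W * Wᴴ)).trace.re := by
    have h1 := hsym.trace_eq_sum_eigenvalues hdim
    rw [LinearMap.trace_eq_sum_inner _ b] at h1
    have h2 : ∀ j, inner ℂ (b j) ((LinearMap.adjoint (𝕜 := ℂ) (E := T) (F := S) f ∘ₗ f) (b j)) = (Wᴴ * (colProj A * W)) j j := by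
      intro j
      rw [LinearMap.comp_apply, LinearMap.adjoint_inner_right, hb]
      have h3 : inner ℂ (f (w j)) (f (w j)) = inner ℂ (w j : EuclideanSpace ℂ (Fin M))
          (S.starProjection (w j : EuclideanSpace ℂ (Fin M))) := by
        rw [← S.starProjection_eq_self_iff.2 (S.starProjection_apply_mem _),
          ← Submodule.inner_starProjection_left_eq_right]
        rfl
      rw [h3, hS, starProjection_columnSpan hA, EuclideanSpace.inner_eq_star_dotProduct,
        dotProduct_comm]
      simp [Matrix.mul_apply, dotProduct, Matrix.mulVec, w]
    simp_rw [h2] at h1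
    have h4 : (colProj A * (W * Wᴴ)).trace = ∑ j, (Wᴴ * (colProj A * W)) j j := by
      rw [← Matrix.mul_assoc, Matrix.trace_mul_comm]
      rfl
    rw [h4, h1]
    exact (Complex.ofReal_re _).symm
  rw [chordalDist, Real.sq_sqrt (Finset.sum_nonneg fun _ _ => sq_nonneg _), Finset.sum_range,
    ← htr]
  simp_rw [← hS, ← hT, hterm]
  simp

end chordal

/-! ### Measurability of matrix operations -/

section measurability
variable {α : Type*} [MeasurableSpace α] {l m n : ℕ}

instance borelSpace_matrix : BorelSpace (Matrix (Fin m) (Fin n) ℂ) :=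
  inferInstanceAs (BorelSpace (Fin m → Fin n → ℂ))

instance secondCountableTopology_matrix :
    SecondCountableTopology (Matrix (Fin m) (Fin n) ℂ) :=
  inferInstanceAs (SecondCountableTopology (Fin m → Fin n → ℂ))

lemma measurable_matrix_mul {f : α → Matrix (Fin l) (Fin m) ℂ} {g : α → Matrix (Fin m) (Fin n) ℂ}
    (hf : Measurable f) (hg : Measurable g) : Measurable fun x => f x * g x := by
  have h : Continuous fun p : Matrix (Fin l) (Fin m) ℂ × Matrix (Fin m) (Fin n) ℂ => p.1 * p.2 :=
    continuous_fst.matrix_mul continuous_snd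
  exact h.measurable.comp (hf.prodMk hg)

lemma measurable_matrix_conjTranspose {f : α → Matrix (Fin m) (Fin n) ℂ} (hf : Measurable f) :
    Measurable fun x => (f x)ᴴ := by
  have h : Continuous fun A : Matrix (Fin m) (Fin n) ℂ => Aᴴ := continuous_id.matrix_conjTranspose
  exact h.measurable.comp hf

lemma measurable_matrix_trace {f : α → Matrix (Fin n) (Fin n) ℂ} (hf : Measurable f) :
    Measurable fun x => (f x).trace := by
  have h : Continuous fun A : Matrix (Fin n) (Fin n) ℂ => A.trace := continuous_id.matrix_trace
  exact h.measurable.comp hf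

lemma measurable_matrix_det {f : α → Matrix (Fin n) (Fin n) ℂ} (hf : Measurable f) :
    Measurable fun x => (f x).det := by
  have h : Continuous fun A : Matrix (Fin n) (Fin n) ℂ => A.det := continuous_id.matrix_det
  exact h.measurable.comp hf

lemma measurable_matrix_add {f g : α → Matrix (Fin m) (Fin n) ℂ}
    (hf : Measurable f) (hg : Measurable g) : Measurable fun x => f x + g x := by
  have h : Continuous fun p : Matrix (Fin m) (Fin n) ℂ × Matrix (Fin m) (Fin n) ℂ => p.1 + p.2 :=
    continuous_fst.add continuous_snd
  exact h.measurable.comp (hf.prodMk hg)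

lemma measurable_matrix_sub {f g : α → Matrix (Fin m) (Fin n) ℂ}
    (hf : Measurable f) (hg : Measurable g) : Measurable fun x => f x - g x := by
  have h : Continuous fun p : Matrix (Fin m) (Fin n) ℂ × Matrix (Fin m) (Fin n) ℂ => p.1 - p.2 :=
    continuous_fst.sub continuous_snd
  exact h.measurable.comp (hf.prodMk hg)

lemma measurable_matrix_sum {ι : Type*} (s : Finset ι) {f : ι → α → Matrix (Fin m) (Fin n) ℂ}
    (hf : ∀ i ∈ s, Measurable (f i)) : Measurable fun x => ∑ i ∈ s, f i x := by
  refine measurable_matrix_of_entries fun a b => ?_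
  simp only [Matrix.sum_apply]
  exact Finset.measurable_fun_sum _ fun i hi => (measurable_entry a b).comp (hf i hi)

lemma measurable_matrix_smul {f : α → Matrix (Fin m) (Fin n) ℂ} (c : ℝ) (hf : Measurable f) :
    Measurable fun x => c • f x := by
  have h : Continuous fun A : Matrix (Fin m) (Fin n) ℂ => c • A := continuous_id.const_smul c
  exact h.measurable.comp hf

lemma measurable_matrix_inv {f : α → Matrix (Fin n) (Fin n) ℂ} (hf : Measurable f) :
    Measurable fun x => (f x)⁻¹ := by
  refine measurable_matrix_of_entries fun a b => ?_
  simp only [Matrix.inv_def, Matrix.smul_apply, Ring.inverse_eq_inv', smul_eq_mul]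
  have h : Continuous fun A : Matrix (Fin n) (Fin n) ℂ => A.adjugate :=
    continuous_id.matrix_adjugate
  exact (measurable_matrix_det hf).inv.mul ((measurable_entry a b).comp (h.measurable.comp hf))

lemma measurable_colProj {f : α → Matrix (Fin m) (Fin n) ℂ} (hf : Measurable f) :
    Measurable fun x => colProj (f x) :=
  have h := measurable_matrix_conjTranspose hf
  measurable_matrix_mul (measurable_matrix_mul hf
    (measurable_matrix_inv (measurable_matrix_mul h hf))) h

lemma measurable_kerProj (E : Matrix (Fin m) (Fin n) ℂ) {f : α → Matrix (Fin m) (Fin m) ℂ}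
    (hf : Measurable f) : Measurable fun x => kerProj E (f x) :=
  measurable_colProj (measurable_matrix_mul
    (measurable_matrix_inv (measurable_matrix_add hf measurable_const)) measurable_const)

end measurability

/-! ### Averages over the unitary group -/

section haar
variable {M N r n : ℕ}

instance compactSpace_unitaryGroup : CompactSpace (Matrix.unitaryGroup (Fin M) ℂ) := by
  refine isCompact_iff_compactSpace.1 ?_
  have hK : IsCompact (Set.univ.pi fun _ : Fin M => Set.univ.pi fun _ : Fin M =>
      Metric.closedBall (0 : ℂ) 1) :=
    isCompact_univ_pi fun _ => isCompact_univ_pi fun _ => isCompact_closedBall 0 1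
  refine hK.of_isClosed_subset ?_ ?_
  · have h : Continuous fun A : Matrix (Fin M) (Fin M) ℂ => star A * A :=
      continuous_star.mul continuous_id
    have h2 := isClosed_singleton (x := (1 : Matrix (Fin M) (Fin M) ℂ)).preimage h
    have h3 : (Matrix.unitaryGroup (Fin M) ℂ : Set (Matrix (Fin M) (Fin M) ℂ))
        = (fun A => star A * A) ⁻¹' {1} := Set.ext fun A => Matrix.mem_unitaryGroup_iff'
    rw [← h3] at h2
    exact h2
  · intro A hA a _ b _
    have := entry_norm_bound_of_unitary hA a b
    simpa using this

/-- A Haar probability measure on the unitary group. Right invariance is the only invariance that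
the averaging arguments need. -/
lemma exists_rightInvariant_unitaryGroup (M : ℕ) :
    ∃ ν : Measure (Matrix.unitaryGroup (Fin M) ℂ), IsProbabilityMeasure ν ∧
      ν.IsMulRightInvariant := by
  let K₀ : TopologicalSpace.PositiveCompacts (Matrix.unitaryGroup (Fin M) ℂ) := ⊤
  have h1 : Measure.haarMeasure K₀ Set.univ = 1 := Measure.haarMeasure_self
  refine ⟨(Measure.haarMeasure K₀).inv, ⟨?_⟩, inferInstance⟩
  rw [Measure.inv_apply, Set.inv_univ, h1]

/-- A right-invariant probability measure on the unitary group. -/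
def unitaryHaar (M : ℕ) : Measure (Matrix.unitaryGroup (Fin M) ℂ) :=
  (exists_rightInvariant_unitaryGroup M).choose

instance : IsProbabilityMeasure (unitaryHaar M) :=
  (exists_rightInvariant_unitaryGroup M).choose_spec.1

instance : (unitaryHaar M).IsMulRightInvariant :=
  (exists_rightInvariant_unitaryGroup M).choose_spec.2

/-- The integral of a function against an invariant measure is that of its averages over the
orbits. -/
lemma lintegral_eq_lintegral_average {α : Type*} [MeasurableSpace α] {m : Measure α} [SFinite m]
    {act : Matrix.unitaryGroup (Fin M) ℂ → α → α}
    (hact : Measurable fun z : α × Matrix.unitaryGroup (Fin M) ℂ => act z.2 z.1)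
    (hinv : ∀ U, m.map (act U) = m) {F : α → ENNReal} (hF : Measurable F) :
    ∫⁻ x, F x ∂m = ∫⁻ x, ∫⁻ U, F (act U x) ∂unitaryHaar M ∂m := by
  have hU : ∀ U, Measurable (act U) := fun U => hact.comp (measurable_id.prodMk measurable_const)
  rw [lintegral_lintegral_swap (f := fun x U => F (act U x)) (hF.comp hact).aemeasurable]
  have : ∀ U, ∫⁻ x, F (act U x) ∂m = ∫⁻ x, F x ∂m := fun U => by
    rw [← lintegral_map hF (hU U), hinv U]
  simp [this]

/-- Conjugation by a random unitary matrix forgets everything about a projection but its rank. -/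
lemma lintegral_conj_eq (hr : r ≤ M) {p q : Matrix (Fin M) (Fin M) ℂ} (hp : IsRankProj r p)
    (hq : IsRankProj r q) (F : Matrix (Fin M) (Fin M) ℂ → ENNReal) :
    ∫⁻ U, F (U.1 * p * U.1ᴴ) ∂unitaryHaar M
      = ∫⁻ U, F (U.1 * q * U.1ᴴ) ∂unitaryHaar M := by
  obtain ⟨R, hR, rfl⟩ := hp.exists_unitary_conj_eq hr hq
  rw [← lintegral_mul_right_eq_self (μ := unitaryHaar M) _ (⟨R, hR⟩ : Matrix.unitaryGroup (Fin M) ℂ)]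
  simp only [Submonoid.coe_mul, Matrix.conjTranspose_mul, Matrix.mul_assoc]

/-- The average of the quadratic form `Φ (U p Uᴴ)` at the vector `U x`. -/
def averageForm (Φ : Matrix (Fin M) (Fin M) ℂ → Matrix (Fin M) (Fin M) ℂ)
    (p : Matrix (Fin M) (Fin M) ℂ) (x : Fin M → ℂ) : ENNReal :=
  ∫⁻ U, ENNReal.ofReal (star (U.1 *ᵥ x) ⬝ᵥ
    (Φ (U.1 * p * U.1ᴴ) *ᵥ (U.1 *ᵥ x))).re ∂unitaryHaar M

lemma averageForm_eq_of_unit (Φ : Matrix (Fin M) (Fin M) ℂ → Matrix (Fin M) (Fin M) ℂ)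
    {p : Matrix (Fin M) (Fin M) ℂ} (hp : IsRankProj r p) {x y : Fin M → ℂ} (hx : p *ᵥ x = x)
    (hy : p *ᵥ y = y) (hx1 : star x ⬝ᵥ x = 1) (hy1 : star y ⬝ᵥ y = 1) :
    averageForm Φ p x = averageForm Φ p y := by
  obtain ⟨R, hR, hRp, rfl⟩ := hp.exists_unitary_fixing hx hy hx1 hy1
  rw [averageForm,
    ← lintegral_mul_right_eq_self (μ := unitaryHaar M) _ (⟨R, hR⟩ : Matrix.unitaryGroup (Fin M) ℂ)]
  rw [averageForm]
  refine lintegral_congr fun U => ?_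
  have : U.1 * R * p * (U.1 * R)ᴴ = U.1 * p * U.1ᴴ := by
    rw [Matrix.conjTranspose_mul, Matrix.mul_assoc, Matrix.mul_assoc, ← Matrix.mul_assoc p,
      ← Matrix.mul_assoc R, ← Matrix.mul_assoc R, hRp, Matrix.mul_assoc]
  simp only [Submonoid.coe_mul, this, Matrix.mulVec_mulVec]

lemma averageForm_smul (Φ : Matrix (Fin M) (Fin M) ℂ → Matrix (Fin M) (Fin M) ℂ)
    (p : Matrix (Fin M) (Fin M) ℂ) (c : ℝ) (x : Fin M → ℂ) :
    averageForm Φ p ((c : ℂ) • x) = ENNReal.ofReal (c ^ 2) * averageForm Φ p x := by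
  rw [averageForm, averageForm, ← lintegral_const_mul' _ _ ENNReal.ofReal_ne_top]
  refine lintegral_congr fun U => ?_
  rw [← ENNReal.ofReal_mul (sq_nonneg c)]
  congr 1
  simp only [Matrix.mulVec_smul, star_smul, smul_dotProduct, dotProduct_smul, smul_eq_mul]
  rw [← mul_assoc, show (c : ℂ) * star (c : ℂ) = ((c ^ 2 : ℝ) : ℂ) by
    simp [sq], Complex.re_ofReal_mul]

/-- On the range of `p`, the average form is a multiple of the squared norm. -/
lemma averageForm_eq (Φ : Matrix (Fin M) (Fin M) ℂ → Matrix (Fin M) (Fin M) ℂ)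
    {p : Matrix (Fin M) (Fin M) ℂ} (hp : IsRankProj r p) {x e : Fin M → ℂ} (hx : p *ᵥ x = x)
    (he : p *ᵥ e = e) (he1 : star e ⬝ᵥ e = 1) :
    averageForm Φ p x = ENNReal.ofReal (star x ⬝ᵥ x).re * averageForm Φ p e := by
  have hn : star x ⬝ᵥ x = ((∑ a, ‖x a‖ ^ 2 : ℝ) : ℂ) := by
    simp [dotProduct, Complex.conj_mul']
  set s : ℝ := ∑ a, ‖x a‖ ^ 2 with hs
  have hs0 : 0 ≤ s := Finset.sum_nonneg fun _ _ => sq_nonneg _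
  by_cases h0 : x = 0
  · have h1 := averageForm_smul Φ p 0 e
    simp only [Complex.ofReal_zero, zero_smul] at h1
    rw [h0, h1]
    simp
  have hspos : s ≠ 0 := by
    intro h
    rw [h, Complex.ofReal_zero] at hn
    open scoped ComplexOrder in exact h0 (dotProduct_star_self_eq_zero.1 hn)
  have hsq : Real.sqrt s ≠ 0 := (Real.sqrt_ne_zero hs0).2 hspos
  have hxu : x = ((Real.sqrt s : ℝ) : ℂ) • (((Real.sqrt s)⁻¹ : ℝ) : ℂ) • x := by
    rw [smul_smul, ← Complex.ofReal_mul, mul_inv_cancel₀ hsq, Complex.ofReal_one, one_smul]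
  have hu1 : star ((((Real.sqrt s)⁻¹ : ℝ) : ℂ) • x) ⬝ᵥ ((((Real.sqrt s)⁻¹ : ℝ) : ℂ) • x) = 1 := by
    simp only [star_smul, smul_dotProduct, dotProduct_smul, smul_eq_mul, hn]
    rw [Complex.star_def, Complex.conj_ofReal]
    norm_cast
    rw [← mul_assoc, ← mul_inv, Real.mul_self_sqrt hs0, inv_mul_cancel₀ hspos]
  have hup : p *ᵥ ((((Real.sqrt s)⁻¹ : ℝ) : ℂ) • x) = (((Real.sqrt s)⁻¹ : ℝ) : ℂ) • x := by
    rw [Matrix.mulVec_smul, hx]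
  rw [hn, Complex.ofReal_re]
  conv_lhs => rw [hxu]
  rw [averageForm_smul, Real.sq_sqrt hs0, averageForm_eq_of_unit Φ hp hup he hu1 he1]

open scoped ComplexOrder in
lemma ofReal_trace_mul_mul_conjTranspose {Q : Matrix (Fin M) (Fin M) ℂ} (hQ : Q.PosSemidef)
    (C : Matrix (Fin M) (Fin n) ℂ) :
    ENNReal.ofReal (Q * (C * Cᴴ)).trace.re
      = ∑ k, ENNReal.ofReal (star (C.col k) ⬝ᵥ (Q *ᵥ C.col k)).re := by
  have h : ∀ k, 0 ≤ (star (C.col k) ⬝ᵥ (Q *ᵥ C.col k)).re := fun k => hQ.re_dotProduct_nonneg _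
  rw [← ENNReal.ofReal_sum_of_nonneg fun k _ => h k, ← Complex.re_sum]
  congr 2
  rw [← Matrix.mul_assoc, Matrix.trace_mul_comm, Matrix.trace]
  refine Finset.sum_congr rfl fun k _ => ?_
  simp [Matrix.mul_apply, dotProduct, Matrix.mulVec]

open scoped ComplexOrder in
lemma lintegral_trace_eq_sum_averageForm
    {Φ : Matrix (Fin M) (Fin M) ℂ → Matrix (Fin M) (Fin M) ℂ} (hΦm : Measurable Φ)
    (hΦ : ∀ Q, IsRankProj r Q → (Φ Q).PosSemidef) {p : Matrix (Fin M) (Fin M) ℂ}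
    (hp : IsRankProj r p) (C : Matrix (Fin M) (Fin n) ℂ) :
    ∫⁻ U, ENNReal.ofReal (Φ (U.1 * p * U.1ᴴ) *
        ((U.1 * C) * (U.1 * C)ᴴ)).trace.re ∂unitaryHaar M
      = ∑ k, averageForm Φ p (C.col k) := by
  have h : ∀ U : Matrix.unitaryGroup (Fin M) ℂ, _ := fun U =>
    ofReal_trace_mul_mul_conjTranspose (hΦ _ (hp.unitary_conj U.2)) (U.1 * C)
  simp_rw [h]
  rw [lintegral_finsetSum]
  · rfl
  · intro k _
    have hU : Measurable fun U : Matrix.unitaryGroup (Fin M) ℂ => U.1 := measurable_subtype_coe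
    have h1 : Measurable fun U : Matrix.unitaryGroup (Fin M) ℂ => Φ (U.1 * p * U.1ᴴ) :=
      hΦm.comp (measurable_matrix_mul (measurable_matrix_mul hU measurable_const)
        (measurable_matrix_conjTranspose hU))
    have h2 := measurable_matrix_mul hU (measurable_const (a := C))
    have h3 := (measurable_entry k k).comp
      (measurable_matrix_mul (measurable_matrix_conjTranspose h2) (measurable_matrix_mul h1 h2))
    refine (Complex.measurable_re.comp ?_).ennreal_ofReal
    convert h3 using 2
    simp [Matrix.mul_apply, dotProduct, Matrix.mulVec, mul_comm]

/-- Averaging over the unitary matrices that commute with `p` replaces `C Cᴴ`, which lives on the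
range of `p`, by the multiple of `p` with the same trace. -/
lemma lintegral_trace_average (hr : 0 < r)
    {Φ : Matrix (Fin M) (Fin M) ℂ → Matrix (Fin M) (Fin M) ℂ} (hΦm : Measurable Φ)
    (hΦ : open scoped ComplexOrder in ∀ Q, IsRankProj r Q → (Φ Q).PosSemidef)
    {p : Matrix (Fin M) (Fin M) ℂ}
    (hp : IsRankProj r p) {C : Matrix (Fin M) (Fin n) ℂ} (hC : p * C = C) :
    r * ∫⁻ U, ENNReal.ofReal (Φ (U.1 * p * U.1ᴴ) *
        ((U.1 * C) * (U.1 * C)ᴴ)).trace.re ∂unitaryHaar M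
      = ENNReal.ofReal (C * Cᴴ).trace.re *
        ∫⁻ U, ENNReal.ofReal (Φ (U.1 * p * U.1ᴴ) *
        (U.1 * p * U.1ᴴ)).trace.re ∂unitaryHaar M := by
  obtain ⟨W, hW, hpW⟩ := hp
  have hpW' : p * W = W := by rw [hpW, Matrix.mul_assoc, hW, Matrix.mul_one]
  have hcol : ∀ {n : ℕ} {A : Matrix (Fin M) (Fin n) ℂ}, p * A = A → ∀ k, p *ᵥ A.col k = A.col k := by
    intro n A hA k
    ext a
    have := congrFun (congrFun hA a) k
    simpa [Matrix.mul_apply, Matrix.mulVec, dotProduct] using this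
  have hW1 : ∀ k, star (W.col k) ⬝ᵥ W.col k = 1 := by
    intro k
    have := congrFun (congrFun hW k) k
    rw [Matrix.one_apply_eq, Matrix.mul_apply] at this
    simpa [dotProduct] using this
  have e1 : ∀ U : Matrix.unitaryGroup (Fin M) ℂ, (U.1 * p * U.1ᴴ)
      = (U.1 * W) * (U.1 * W)ᴴ := fun U => by
    rw [hpW, Matrix.conjTranspose_mul]
    simp only [Matrix.mul_assoc]
  -- The integrand on the right is a sum over an orthonormal basis of the range of `p`.
  have e2 : ∫⁻ U, ENNReal.ofReal (Φ (U.1 * p * U.1ᴴ) *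
        (U.1 * p * U.1ᴴ)).trace.re ∂unitaryHaar M
      = r * averageForm Φ p (W.col ⟨0, hr⟩) := by
    rw [show (fun U : Matrix.unitaryGroup (Fin M) ℂ =>
        ENNReal.ofReal (Φ (U.1 * p * U.1ᴴ) *
        (U.1 * p * U.1ᴴ)).trace.re) = fun U =>
        ENNReal.ofReal (Φ (U.1 * p * U.1ᴴ) *
        ((U.1 * W) * (U.1 * W)ᴴ)).trace.re by
      ext U; rw [← e1], lintegral_trace_eq_sum_averageForm hΦm hΦ ⟨W, hW, hpW⟩]
    rw [Finset.sum_congr rfl fun k _ => averageForm_eq_of_unit Φ ⟨W, hW, hpW⟩ (hcol hpW' k)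
      (hcol hpW' ⟨0, hr⟩) (hW1 k) (hW1 _)]
    simp
  rw [e2, lintegral_trace_eq_sum_averageForm hΦm hΦ ⟨W, hW, hpW⟩,
    Finset.sum_congr rfl fun k _ => averageForm_eq Φ ⟨W, hW, hpW⟩ (hcol hC k)
      (hcol hpW' ⟨0, hr⟩) (hW1 _), ← Finset.sum_mul]
  have e3 : ENNReal.ofReal (C * Cᴴ).trace.re
      = ∑ k, ENNReal.ofReal (star (C.col k) ⬝ᵥ C.col k).re := by
    have := open scoped ComplexOrder in ofReal_trace_mul_mul_conjTranspose
      (Matrix.PosSemidef.one (n := Fin M) (R := ℂ)) C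
    simpa using this
  rw [e3]
  ring

end haar

/-! ### The quantizer -/

section quantizer
variable {M N n : ℕ}

/-- The first index at which a finite family of reals is maximal. Breaking ties in this way gives a
measurable choice. -/
def firstArgmax [NeZero n] (t : Fin n → ℝ) : Fin n :=
  (Finset.univ.filter fun k => ∀ l, t l ≤ t k).min' <| by
    obtain ⟨k, -, hk⟩ := Finset.exists_max_image Finset.univ t ⟨0, Finset.mem_univ _⟩
    exact ⟨k, by simpa using hk⟩

lemma le_firstArgmax [NeZero n] (t : Fin n → ℝ) (l : Fin n) : t l ≤ t (firstArgmax t) := by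
  have h := Finset.min'_mem (Finset.univ.filter fun k => ∀ l, t l ≤ t k) (by
    obtain ⟨k, -, hk⟩ := Finset.exists_max_image Finset.univ t ⟨0, Finset.mem_univ _⟩
    exact ⟨k, by simpa using hk⟩)
  exact (Finset.mem_filter.1 h).2 l

lemma measurable_firstArgmax [NeZero n] :
    Measurable (firstArgmax : (Fin n → ℝ) → Fin n) := by
  refine measurable_to_countable' fun k => ?_
  have h : (firstArgmax : (Fin n → ℝ) → Fin n) ⁻¹' {k}
      = (⋂ l, {t | t l ≤ t k}) ∩ ⋂ m : Fin n, {t | m < k → ∃ l, t m < t l} := by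
    ext t
    simp only [Set.mem_preimage, Set.mem_singleton_iff, Set.mem_inter_iff, Set.mem_iInter,
      Set.mem_ofPred_eq]
    constructor
    · rintro rfl
      refine ⟨le_firstArgmax t, fun m hm => ?_⟩
      by_contra! h
      exact absurd (Finset.min'_le _ m (by simpa using h)) (not_le.2 hm)
    · rintro ⟨h1, h2⟩
      refine le_antisymm (Finset.min'_le _ k (by simpa using h1)) ?_
      by_contra! h
      obtain ⟨l, hl⟩ := h2 _ h
      exact absurd (le_firstArgmax t l) (not_le.2 hl)
  rw [h]
  refine (MeasurableSet.iInter fun l => measurableSet_le (measurable_pi_apply l)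
    (measurable_pi_apply k)).inter (MeasurableSet.iInter fun m => ?_)
  by_cases hm : m < k
  · simp only [hm, true_imp_iff, Set.ofPred_exists]
    exact MeasurableSet.iUnion fun l => measurableSet_lt (measurable_pi_apply m)
      (measurable_pi_apply l)
  · simp [hm]

/-- The first of the projections `P k` that is closest in chordal distance to the projection `p`,
that is, for which `tr (p P k)` is maximal. -/
def quantProj [NeZero n] (p : Matrix (Fin M) (Fin M) ℂ) (P : Fin n → Matrix (Fin M) (Fin M) ℂ) :
    Matrix (Fin M) (Fin M) ℂ :=
  P (firstArgmax fun k => (p * P k).trace.re)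

lemma measurable_quantProj [NeZero n] {α : Type*} [MeasurableSpace α]
    {p : α → Matrix (Fin M) (Fin M) ℂ} {P : α → Fin n → Matrix (Fin M) (Fin M) ℂ}
    (hp : Measurable p) (hP : ∀ k, Measurable fun x => P x k) :
    Measurable fun x => quantProj (p x) (P x) := by
  have h1 : Measurable fun x => firstArgmax fun k => (p x * P x k).trace.re :=
    measurable_firstArgmax.comp (measurable_pi_lambda _ fun k =>
      Complex.measurable_re.comp (measurable_matrix_trace (measurable_matrix_mul hp (hP k))))
  have h2 : Measurable fun z : Fin n × α => P z.2 z.1 :=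
    measurable_from_prod_countable_right fun k => hP k
  exact h2.comp (h1.prodMk measurable_id)

lemma quantProj_unitary_conj [NeZero n] {U : Matrix (Fin M) (Fin M) ℂ}
    (hU : U ∈ Matrix.unitaryGroup (Fin M) ℂ) (p : Matrix (Fin M) (Fin M) ℂ)
    (P : Fin n → Matrix (Fin M) (Fin M) ℂ) :
    quantProj (U * p * Uᴴ) (fun k => U * P k * Uᴴ) = U * quantProj p P * Uᴴ := by
  have h1 : Uᴴ * U = 1 := Matrix.mem_unitaryGroup_iff'.1 hU
  have h : ∀ k, (U * p * Uᴴ * (U * P k * Uᴴ)).trace = (p * P k).trace := by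
    intro k
    rw [show U * p * Uᴴ * (U * P k * Uᴴ) = U * (p * (Uᴴ * U) * P k * Uᴴ) by
      simp only [Matrix.mul_assoc], h1, Matrix.mul_one, Matrix.trace_mul_comm, Matrix.mul_assoc,
      h1, Matrix.mul_one]
  simp only [quantProj, h]

lemma isRankProj_quantProj [NeZero n] {P : Fin n → Matrix (Fin M) (Fin M) ℂ}
    (hP : ∀ k, IsRankProj N (P k)) (p : Matrix (Fin M) (Fin M) ℂ) :
    IsRankProj N (quantProj p P) := hP _

end quantizer

/-! ### Analytic matrix functions -/

section analytic
variable {E : Type*} [NormedAddCommGroup E] [NormedSpace ℝ E] {l m n : ℕ}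

/-- A matrix-valued function with real-analytic entries. -/
def EntrywiseAnalytic (F : E → Matrix (Fin m) (Fin n) ℂ) : Prop :=
  ∀ a b, AnalyticOnNhd ℝ (fun x => F x a b) Set.univ

lemma EntrywiseAnalytic.mul {F : E → Matrix (Fin l) (Fin m) ℂ} {G : E → Matrix (Fin m) (Fin n) ℂ}
    (hF : EntrywiseAnalytic F) (hG : EntrywiseAnalytic G) :
    EntrywiseAnalytic fun x => F x * G x := by
  intro a b
  simp only [Matrix.mul_apply]
  exact Finset.analyticOnNhd_fun_sum _ fun c _ => (hF a c).mul (hG c b)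

lemma EntrywiseAnalytic.conjTranspose {F : E → Matrix (Fin m) (Fin n) ℂ}
    (hF : EntrywiseAnalytic F) : EntrywiseAnalytic fun x => (F x)ᴴ := by
  intro a b x hx
  exact ((Complex.conjCLE : ℂ →L[ℝ] ℂ).analyticAt _).comp (hF b a x hx)

lemma EntrywiseAnalytic.add {F G : E → Matrix (Fin m) (Fin n) ℂ}
    (hF : EntrywiseAnalytic F) (hG : EntrywiseAnalytic G) : EntrywiseAnalytic fun x => F x + G x :=
  fun a b => (hF a b).add (hG a b)

lemma EntrywiseAnalytic.const (A : Matrix (Fin m) (Fin n) ℂ) :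
    EntrywiseAnalytic fun _ : E => A :=
  fun _ _ => analyticOnNhd_const

lemma EntrywiseAnalytic.sum {ι : Type*} (s : Finset ι) {F : ι → E → Matrix (Fin m) (Fin n) ℂ}
    (hF : ∀ i, EntrywiseAnalytic (F i)) : EntrywiseAnalytic fun x => ∑ i ∈ s, F i x := by
  intro a b
  simp only [Matrix.sum_apply]
  exact Finset.analyticOnNhd_fun_sum _ fun i _ => hF i a b

lemma EntrywiseAnalytic.det {F : E → Matrix (Fin n) (Fin n) ℂ} (hF : EntrywiseAnalytic F) :
    AnalyticOnNhd ℝ (fun x => (F x).det) Set.univ := by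
  simp only [Matrix.det_apply']
  exact Finset.analyticOnNhd_fun_sum _ fun s _ => analyticOnNhd_const.mul
    (Finset.analyticOnNhd_fun_prod _ fun i _ => hF _ _)

lemma EntrywiseAnalytic.adjugate {F : E → Matrix (Fin n) (Fin n) ℂ} (hF : EntrywiseAnalytic F) :
    EntrywiseAnalytic fun x => (F x).adjugate := by
  intro a b
  simp only [Matrix.adjugate_apply]
  refine EntrywiseAnalytic.det fun c d => ?_
  by_cases h : c = b
  · subst h
    simp only [Matrix.updateRow_self]
    exact analyticOnNhd_const
  · simp only [Matrix.updateRow_ne h]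
    exact hF c d

lemma EntrywiseAnalytic.trace {F : E → Matrix (Fin n) (Fin n) ℂ} (hF : EntrywiseAnalytic F) :
    AnalyticOnNhd ℝ (fun x => (F x).trace) Set.univ :=
  Finset.analyticOnNhd_fun_sum _ fun i _ => hF i i

end analytic

/-! ### Gaussian matrices in general position -/

section genericGaussian
variable {K M N n : ℕ}

lemma entrywiseAnalytic_member (l : Fin K) :
    EntrywiseAnalytic fun x : Fin K × Fin M × Fin N → ℂ =>
      (Matrix.of fun a b => x (l, a, b) : Matrix (Fin M) (Fin N) ℂ) := fun a b x _ =>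
  (ContinuousLinearMap.proj (R := ℝ) (φ := fun _ : Fin K × Fin M × Fin N => ℂ) (l, a, b)).analyticAt x

/-- The `j`-th block of `N` columns of the identity matrix of size `K N`. -/
def blockColumns (hM : M = K * N) (j : Fin K) : Matrix (Fin M) (Fin N) ℂ :=
  Matrix.of fun a b => if a = Fin.cast hM.symm (finProdFinEquiv (j, b)) then 1 else 0

lemma blockColumns_conjTranspose_mul_self (hM : M = K * N) (j : Fin K) :
    (blockColumns hM j)ᴴ * blockColumns hM j = 1 := by
  ext b c
  simp [blockColumns, Matrix.mul_apply, Matrix.one_apply, apply_ite, eq_comm]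

lemma sum_blockColumns (hM : M = K * N) :
    ∑ j, blockColumns hM j * (blockColumns hM j)ᴴ = 1 := by
  ext a c
  simp only [Matrix.sum_apply, Matrix.mul_apply, Matrix.conjTranspose_apply]
  rw [← Fintype.sum_prod_type'
    (fun j b => blockColumns hM j a b * star (blockColumns hM j c b))]
  have h := (finProdFinEquiv.trans (finCongr hM.symm)).sum_comp
    (fun y => (if a = y then 1 else 0) * star (if c = y then (1 : ℂ) else 0))
  refine Eq.trans ?_ (h.trans ?_)
  · rfl
  · simp [Matrix.one_apply, apply_ite, eq_comm]

lemma blockColumns_sum_erase (hM : M = K * N) (j : Fin K) :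
    ∑ l ∈ Finset.univ.erase j, blockColumns hM l * (blockColumns hM l)ᴴ
      + blockColumns hM j * (blockColumns hM j)ᴴ = 1 := by
  rw [Finset.sum_erase_add _ _ (Finset.mem_univ j), sum_blockColumns]

lemma measurable_member (l : Fin K) :
    Measurable fun H : Fin K → Matrix (Fin M) (Fin N) ℂ => H l := measurable_pi_apply l

lemma gaussianFamily_ae_fullRank (hM : M = K * N) :
    ∀ᵐ H ∂gaussianFamily K M N, ∀ l, ((H l)ᴴ * H l).det ≠ 0 := by
  rw [ae_all_iff]
  intro l
  refine gaussianFamily_ae_ne_zero (fun H => ((H l)ᴴ * H l).det)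
    ((entrywiseAnalytic_member l).conjTranspose.mul (entrywiseAnalytic_member l)).det ?_
    ⟨blockColumns hM, ?_⟩
  · exact measurable_matrix_det (measurable_matrix_mul
      (measurable_matrix_conjTranspose (measurable_member l)) (measurable_member l))
  · simp [blockColumns_conjTranspose_mul_self]

lemma gaussianFamily_ae_det_ne_zero (hM : M = K * N) (j : Fin K) :
    ∀ᵐ H ∂gaussianFamily K M N, (∑ l ∈ Finset.univ.erase j, colProj (H l)
      + blockColumns hM j * (blockColumns hM j)ᴴ).det ≠ 0 := by
  have h : ∀ᵐ H ∂gaussianFamily K M N, (∑ l ∈ Finset.univ.erase j, H l * (H l)ᴴ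
      + blockColumns hM j * (blockColumns hM j)ᴴ).det ≠ 0 := by
    -- If the channels are the blocks of the identity matrix, the sum is the identity.
    refine gaussianFamily_ae_ne_zero (fun H => (∑ l ∈ Finset.univ.erase j, H l * (H l)ᴴ
      + blockColumns hM j * (blockColumns hM j)ᴴ).det) ?_ ?_ ⟨blockColumns hM, ?_⟩
    · exact ((EntrywiseAnalytic.sum _ fun l => (entrywiseAnalytic_member l).mul
        (entrywiseAnalytic_member l).conjTranspose).add (EntrywiseAnalytic.const _)).det
    · exact measurable_matrix_det (measurable_matrix_add (measurable_matrix_sum _ fun l _ =>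
        measurable_matrix_mul (measurable_member l)
          (measurable_matrix_conjTranspose (measurable_member l))) measurable_const)
    · rw [blockColumns_sum_erase, Matrix.det_one]
      exact one_ne_zero
  filter_upwards [h, gaussianFamily_ae_fullRank hM] with H h1 h2
  exact det_sum_colProj_ne_zero (fun l _ => h2 l) h1

/-- The trace form separates different projections of the same rank. -/
lemma trace_mul_sub_ne_zero {W W' : Matrix (Fin M) (Fin N) ℂ} (hW : Wᴴ * W = 1)
    (hW' : W'ᴴ * W' = 1) (h : W * Wᴴ ≠ W' * W'ᴴ) :
    (Wᴴ * (W * Wᴴ - W' * W'ᴴ) * W).trace.re ≠ 0 := by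
  intro h0
  apply h
  set p := W * Wᴴ with hp
  set q := W' * W'ᴴ with hq
  have hpp : IsRankProj N p := ⟨W, hW, rfl⟩
  have hqq : IsRankProj N q := ⟨W', hW', rfl⟩
  have h1 : (Wᴴ * (p - q) * W).trace = N - (p * q).trace := by
    rw [Matrix.trace_mul_comm, ← Matrix.mul_assoc, ← hp, Matrix.mul_sub, hpp.mul_self,
      Matrix.trace_sub, hpp.trace_eq]
  have h2 : ((p - q)ᴴ * (p - q)).trace = 2 * (Wᴴ * (p - q) * W).trace := by
    rw [h1, Matrix.conjTranspose_sub, hpp.conjTranspose_eq, hqq.conjTranspose_eq, Matrix.mul_sub,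
      Matrix.sub_mul, Matrix.sub_mul, hpp.mul_self, hqq.mul_self, Matrix.trace_sub,
      Matrix.trace_sub, Matrix.trace_sub, hpp.trace_eq, hqq.trace_eq, Matrix.trace_mul_comm q p]
    ring
  open scoped ComplexOrder in
  have h3 : 0 ≤ ((p - q)ᴴ * (p - q)).trace :=
    (Matrix.posSemidef_conjTranspose_mul_self (p - q)).trace_nonneg
  have h4 : ((p - q)ᴴ * (p - q)).trace = 0 := by
    open scoped ComplexOrder in
    have h5 := (Complex.le_def.1 h3).2
    apply Complex.ext
    · rw [h2]
      simp [Complex.mul_re, h0]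
    · simpa using h5.symm
  open scoped ComplexOrder in
  exact sub_eq_zero.1 (Matrix.trace_conjTranspose_mul_self_eq_zero_iff.1 h4)

/-- A Gaussian matrix is almost surely not at the same chordal distance from two different
subspaces. -/
lemma gaussianFamily_ae_no_tie (hM : M = K * N) (i : Fin K) {p q : Matrix (Fin M) (Fin M) ℂ}
    (hp : IsRankProj N p) (hq : IsRankProj N q) (hpq : p ≠ q) :
    ∀ᵐ H ∂gaussianFamily K M N,
      (colProj (H i) * p).trace.re ≠ (colProj (H i) * q).trace.re := by
  obtain ⟨W, hW, rfl⟩ := hp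
  obtain ⟨W', hW', rfl⟩ := hq
  set D := W * Wᴴ - W' * W'ᴴ with hD
  -- The difference of the two sides, cleared of the denominator `det (Hᴴ H)`.
  have h : ∀ᵐ H ∂gaussianFamily K M N,
      (((((H i)ᴴ * H i).adjugate * ((H i)ᴴ * D * H i)).trace.re : ℝ) : ℂ) ≠ 0 := by
    refine gaussianFamily_ae_ne_zero (fun H =>
      (((((H i)ᴴ * H i).adjugate * ((H i)ᴴ * D * H i)).trace.re : ℝ) : ℂ)) ?_ ?_ ⟨fun _ => W, ?_⟩
    · intro x hx
      have hm := entrywiseAnalytic_member (M := M) (N := N) i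
      have h1 := ((hm.conjTranspose.mul hm).adjugate.mul
        ((hm.conjTranspose.mul (EntrywiseAnalytic.const D)).mul hm)).trace x hx
      exact ((Complex.ofRealCLM.comp Complex.reCLM).analyticAt _).comp h1
    · have hm := measurable_member (K := K) (M := M) (N := N) i
      have hadj : Continuous fun A : Matrix (Fin N) (Fin N) ℂ => A.adjugate :=
        continuous_id.matrix_adjugate
      exact Complex.measurable_ofReal.comp (Complex.measurable_re.comp (measurable_matrix_trace
        (measurable_matrix_mul (hadj.measurable.comp
          (measurable_matrix_mul (measurable_matrix_conjTranspose hm) hm))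
          (measurable_matrix_mul (measurable_matrix_mul (measurable_matrix_conjTranspose hm)
            measurable_const) hm))))
    · simp only [hW, Matrix.adjugate_one, Matrix.one_mul, ne_eq, Complex.ofReal_eq_zero]
      exact trace_mul_sub_ne_zero hW hW' hpq
  filter_upwards [h, gaussianFamily_ae_fullRank hM] with H h1 h2 h3
  apply h1
  set A := H i
  have hinv : ((Aᴴ * A).adjugate : Matrix (Fin N) (Fin N) ℂ) = (Aᴴ * A).det • (Aᴴ * A)⁻¹ := by
    rw [Matrix.inv_def, smul_smul, Ring.inverse_eq_inv', mul_inv_cancel₀ (h2 i), one_smul]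
  have h4 : ((Aᴴ * A).adjugate * (Aᴴ * D * A)).trace
      = (Aᴴ * A).det * (colProj A * D).trace := by
    rw [hinv, Matrix.smul_mul, Matrix.trace_smul, smul_eq_mul, colProj]
    congr 1
    rw [← Matrix.mul_assoc, Matrix.trace_mul_comm]
    simp only [Matrix.mul_assoc]
  have h5 : (colProj A * D).trace.re = 0 := by
    rw [hD, Matrix.mul_sub, Matrix.trace_sub, Complex.sub_re, h3, sub_self]
  open scoped ComplexOrder in
  have h6 : (Aᴴ * A).det.im = 0 :=
    ((Complex.le_def.1 (Matrix.posSemidef_conjTranspose_mul_self A).det_nonneg).2).symm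
  rw [h4, Complex.mul_re, h5, h6]
  simp

end genericGaussian

/-! ### Exchanging projections of the same rank -/

section averaging
variable {M N r : ℕ}

/-- Suppose that the random projections `p` and `q` rotate with the action while `R` is fixed by
it. Then `(R, p)` and `(R, q)` have the same law. -/
lemma lintegral_replace_projection {α β : Type*} [MeasurableSpace α] [MeasurableSpace β]
    {m : Measure α} [SFinite m] {act : Matrix.unitaryGroup (Fin M) ℂ → α → α}
    (hact : Measurable fun z : α × Matrix.unitaryGroup (Fin M) ℂ => act z.2 z.1)
    (hinv : ∀ U, m.map (act U) = m) (hr : r ≤ M) {R : α → β} (hRm : Measurable R)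
    (hR : ∀ U x, R (act U x) = R x) {p q : α → Matrix (Fin M) (Fin M) ℂ} (hpm : Measurable p)
    (hqm : Measurable q) (hp : ∀ᵐ x ∂m, IsRankProj r (p x)) (hq : ∀ᵐ x ∂m, IsRankProj r (q x))
    (hpact : ∀ U x, p (act U x) = U.1 * p x * U.1ᴴ) (hqact : ∀ U x, q (act U x) = U.1 * q x * U.1ᴴ)
    {F : β × Matrix (Fin M) (Fin M) ℂ → ENNReal} (hF : Measurable F) :
    ∫⁻ x, F (R x, p x) ∂m = ∫⁻ x, F (R x, q x) ∂m := by
  rw [lintegral_eq_lintegral_average hact hinv (F := fun x => F (R x, p x))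
      (hF.comp (hRm.prodMk hpm)),
    lintegral_eq_lintegral_average hact hinv (F := fun x => F (R x, q x))
      (hF.comp (hRm.prodMk hqm))]
  refine lintegral_congr_ae ?_
  filter_upwards [hp, hq] with x hpx hqx
  simp only [hR, hpact, hqact]
  exact lintegral_conj_eq hr hpx hqx fun A => F (R x, A)

/-- The projections of rank `r` form an orbit of the compact unitary group. -/
lemma measurableSet_isRankProj (hr : r ≤ M) :
    MeasurableSet {p : Matrix (Fin M) (Fin M) ℂ | IsRankProj r p} := by
  by_cases h : ∃ p : Matrix (Fin M) (Fin M) ℂ, IsRankProj r p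
  · obtain ⟨p, hp⟩ := h
    have heq : {q : Matrix (Fin M) (Fin M) ℂ | IsRankProj r q}
        = Set.range fun U : Matrix.unitaryGroup (Fin M) ℂ => U.1 * p * U.1ᴴ := by
      refine Set.ext fun q => ⟨fun hq => ?_, ?_⟩
      · obtain ⟨U, hU, h⟩ := hp.exists_unitary_conj_eq hr hq
        exact ⟨⟨U, hU⟩, h⟩
      · rintro ⟨U, rfl⟩
        exact hp.unitary_conj U.2
    rw [heq]
    have hc : Continuous fun U : Matrix.unitaryGroup (Fin M) ℂ => U.1 * p * U.1ᴴ :=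
      (continuous_subtype_val.matrix_mul continuous_const).matrix_mul
        continuous_subtype_val.matrix_conjTranspose
    exact (isCompact_range hc).isClosed.measurableSet
  · have heq : {p : Matrix (Fin M) (Fin M) ℂ | IsRankProj r p} = ∅ :=
      Set.eq_empty_of_forall_notMem fun p hp => h ⟨p, hp⟩
    rw [heq]
    exact MeasurableSet.empty

end averaging

/-! ### The law of channels and codebooks -/

section law
variable {K M N n : ℕ}

/-- The law of the projections `P i k` onto the codeword subspaces: they are of rank `N`, and the
codebook of each user may be rotated by a unitary matrix of its own. -/
structure IsCodebookLaw (N : ℕ) (ρ : Measure (Fin K → Fin n → Matrix (Fin M) (Fin M) ℂ)) :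
    Prop where
  isProbabilityMeasure : IsProbabilityMeasure ρ
  map_conj : ∀ U : Fin K → Matrix (Fin M) (Fin M) ℂ,
    (∀ l, U l ∈ Matrix.unitaryGroup (Fin M) ℂ) →
      ρ.map (fun P l k => U l * P l k * (U l)ᴴ) = ρ
  isRankProj : ∀ᵐ P ∂ρ, ∀ l k, IsRankProj N (P l k)

lemma measurable_codeword (l : Fin K) (k : Fin n) :
    Measurable fun P : Fin K → Fin n → Matrix (Fin M) (Fin M) ℂ => P l k :=
  (measurable_pi_apply k).comp (measurable_pi_apply l)

lemma measurable_curry_codebook :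
    Measurable fun (x : Fin K × Fin n → Matrix (Fin M) (Fin M) ℂ) (l : Fin K) (k : Fin n) =>
      x (l, k) :=
  measurable_pi_lambda _ fun _ => measurable_pi_lambda _ fun _ => measurable_pi_apply _

lemma measurable_conj (U : Matrix (Fin M) (Fin M) ℂ) :
    Measurable fun A : Matrix (Fin M) (Fin M) ℂ => U * A * Uᴴ :=
  measurable_matrix_mul (measurable_matrix_mul measurable_const measurable_id) measurable_const

lemma map_curry_pi_conj {m : Fin K × Fin n → Measure (Matrix (Fin M) (Fin M) ℂ)}
    [∀ p, SigmaFinite (m p)] {U : Fin K → Matrix (Fin M) (Fin M) ℂ}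
    (h : ∀ p, (m p).map (fun A => U p.1 * A * (U p.1)ᴴ) = m p) :
    (((Measure.pi m).map fun x (l : Fin K) (k : Fin n) => x (l, k)).map
      fun P l k => U l * P l k * (U l)ᴴ) = (Measure.pi m).map fun x l k => x (l, k) := by
  have hmp := measurePreserving_pi m m (f := fun p A => U p.1 * A * (U p.1)ᴴ)
    fun p => ⟨measurable_conj _, h p⟩
  have hU2 : Measurable fun (P : Fin K → Fin n → Matrix (Fin M) (Fin M) ℂ) (l : Fin K)
      (k : Fin n) => U l * P l k * (U l)ᴴ :=
    measurable_pi_lambda _ fun l => measurable_pi_lambda _ fun k =>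
      (measurable_conj (U l)).comp (measurable_codeword l k)
  rw [Measure.map_map hU2 measurable_curry_codebook]
  conv_rhs => rw [← hmp.map_eq, Measure.map_map measurable_curry_codebook hmp.measurable]
  rfl

section
variable {Ω : Type*} [MeasurableSpace Ω] {μ : Measure Ω}
  {W : Fin K → Fin n → Ω → Matrix (Fin M) (Fin N) ℂ}

lemma IsRandomCodebook.measurable_proj (hW : IsRandomCodebook μ W) (l : Fin K) (k : Fin n) :
    Measurable fun ω => W l k ω * (W l k ω)ᴴ :=
  measurable_matrix_mul (hW.1 l k).1 (measurable_matrix_conjTranspose (hW.1 l k).1)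

lemma IsRandomCodebook.measurable_projs (hW : IsRandomCodebook μ W) :
    Measurable fun ω l k => W l k ω * (W l k ω)ᴴ :=
  measurable_pi_lambda _ fun l => measurable_pi_lambda _ fun k => hW.measurable_proj l k

lemma IsRandomCodebook.ae_isRankProj (hW : IsRandomCodebook μ W) :
    ∀ᵐ ω ∂μ, ∀ l k, IsRankProj N (W l k ω * (W l k ω)ᴴ) := by
  have hae : ∀ᵐ ω ∂μ, ∀ l k, (W l k ω)ᴴ * W l k ω = 1 :=
    ae_all_iff.2 fun l => ae_all_iff.2 fun k => (hW.1 l k).2.1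
  filter_upwards [hae] with ω hω l k
  exact ⟨W l k ω, hω l k, rfl⟩

lemma IsRandomCodebook.iIndepFun_proj (hW : IsRandomCodebook μ W) :
    iIndepFun (fun (p : Fin K × Fin n) ω => W p.1 p.2 ω * (W p.1 p.2 ω)ᴴ) μ := by
  have hg : Measurable fun A : Matrix (Fin M) (Fin N) ℂ => A * Aᴴ :=
    measurable_matrix_mul measurable_id (measurable_matrix_conjTranspose measurable_id)
  have h := hW.2
  exact iIndepFun.comp (g := fun (_ : Fin K × Fin n) (A : Matrix (Fin M) (Fin N) ℂ) => A * Aᴴ)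
    h fun _ => hg

lemma IsRandomCodebook.map_conj [IsProbabilityMeasure μ] (hW : IsRandomCodebook μ W)
    {U : Fin K → Matrix (Fin M) (Fin M) ℂ} (hU : ∀ l, U l ∈ Matrix.unitaryGroup (Fin M) ℂ) :
    (μ.map fun ω l k => W l k ω * (W l k ω)ᴴ).map
        (fun (P : Fin K → Fin n → Matrix (Fin M) (Fin M) ℂ) (l : Fin K) (k : Fin n) =>
          U l * P l k * (U l)ᴴ)
      = μ.map fun ω l k => W l k ω * (W l k ω)ᴴ := by
  have hm := hW.measurable_proj
  have hind := (iIndepFun_iff_map_fun_eq_pi_map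
    (f := fun (p : Fin K × Fin n) ω => W p.1 p.2 ω * (W p.1 p.2 ω)ᴴ)
    fun p => (hm p.1 p.2).aemeasurable).1 hW.iIndepFun_proj
  have hpi : ∀ p : Fin K × Fin n, IsProbabilityMeasure
      (μ.map fun ω => W p.1 p.2 ω * (W p.1 p.2 ω)ᴴ) := fun p =>
    Measure.isProbabilityMeasure_map (hm p.1 p.2).aemeasurable
  have hm2 : Measurable fun ω (p : Fin K × Fin n) => W p.1 p.2 ω * (W p.1 p.2 ω)ᴴ :=
    measurable_pi_lambda _ fun p => hm p.1 p.2
  have heq : μ.map (fun ω l k => W l k ω * (W l k ω)ᴴ) =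
      (μ.map fun ω (p : Fin K × Fin n) => W p.1 p.2 ω * (W p.1 p.2 ω)ᴴ).map
        fun x l k => x (l, k) := by
    rw [Measure.map_map measurable_curry_codebook hm2]
    rfl
  rw [heq, hind]
  refine map_curry_pi_conj fun p => ?_
  rw [Measure.map_map (measurable_conj _) (hm p.1 p.2)]
  exact (hW.1 p.1 p.2).2.2 (U p.1) (hU p.1)

lemma IsRandomCodebook.isCodebookLaw [IsProbabilityMeasure μ] (hW : IsRandomCodebook μ W)
    (hr : N ≤ M) : IsCodebookLaw N (μ.map fun ω l k => W l k ω * (W l k ω)ᴴ) := by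
  have hm := hW.measurable_projs
  refine ⟨Measure.isProbabilityMeasure_map hm.aemeasurable, fun U hU => hW.map_conj hU, ?_⟩
  have hset : MeasurableSet {P : Fin K → Fin n → Matrix (Fin M) (Fin M) ℂ |
      ∀ l k, IsRankProj N (P l k)} := by
    simp only [Set.ofPred_forall]
    exact MeasurableSet.iInter fun l => MeasurableSet.iInter fun k =>
      measurable_codeword l k (measurableSet_isRankProj hr)
  rw [ae_map_iff hm.aemeasurable hset]
  exact hW.ae_isRankProj

end

/-- The family of matrices that acts as `U` on user `i` and trivially on the others. -/
def unitaryAt (i : Fin K) (U : Matrix (Fin M) (Fin M) ℂ) (l : Fin K) : Matrix (Fin M) (Fin M) ℂ :=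
  if l = i then U else 1

lemma unitaryAt_mem (i : Fin K) (U : Matrix.unitaryGroup (Fin M) ℂ) (l : Fin K) :
    unitaryAt i U.1 l ∈ Matrix.unitaryGroup (Fin M) ℂ := by
  unfold unitaryAt
  split_ifs
  · exact U.2
  · exact one_mem _

/-- The channels of all users, and the projections onto the subspaces of their codewords. -/
abbrev Realization (K M N n : ℕ) :=
  (Fin K → Matrix (Fin M) (Fin N) ℂ) × (Fin K → Fin n → Matrix (Fin M) (Fin M) ℂ)

/-- Rotation of the channel and of the codebook of user `i`. -/
def rotate (i : Fin K) (U : Matrix.unitaryGroup (Fin M) ℂ) (x : Realization K M N n) :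
    Realization K M N n :=
  (fun l => unitaryAt i U.1 l * x.1 l,
    fun l k => unitaryAt i U.1 l * x.2 l k * (unitaryAt i U.1 l)ᴴ)

/-- Rotation of the channel of user `i`. -/
def rotateChannel (i : Fin K) (U : Matrix.unitaryGroup (Fin M) ℂ)
    (H : Fin K → Matrix (Fin M) (Fin N) ℂ) : Fin K → Matrix (Fin M) (Fin N) ℂ :=
  fun l => unitaryAt i U.1 l * H l

section
variable (i : Fin K) (U : Matrix.unitaryGroup (Fin M) ℂ) (x : Realization K M N n)

lemma rotate_fst_self : (rotate i U x).1 i = U.1 * x.1 i := by simp [rotate, unitaryAt]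

lemma rotate_fst_of_ne {l : Fin K} (h : l ≠ i) : (rotate i U x).1 l = x.1 l := by
  simp [rotate, unitaryAt, h]

lemma rotate_snd_self : (rotate i U x).2 i = fun k => U.1 * x.2 i k * U.1ᴴ := by
  simp [rotate, unitaryAt]

lemma rotate_snd_of_ne {l : Fin K} (h : l ≠ i) : (rotate i U x).2 l = x.2 l := by
  simp [rotate, unitaryAt, h]

lemma rotateChannel_self (H : Fin K → Matrix (Fin M) (Fin N) ℂ) :
    rotateChannel i U H i = U.1 * H i := by simp [rotateChannel, unitaryAt]

lemma rotateChannel_of_ne (H : Fin K → Matrix (Fin M) (Fin N) ℂ) {l : Fin K} (h : l ≠ i) :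
    rotateChannel i U H l = H l := by
  simp [rotateChannel, unitaryAt, h]

end

lemma measurable_unitaryAt (i l : Fin K) :
    Measurable fun U : Matrix.unitaryGroup (Fin M) ℂ => unitaryAt i U.1 l := by
  unfold unitaryAt
  split_ifs
  · exact measurable_subtype_coe
  · exact measurable_const

lemma measurable_rotateChannel (i : Fin K) :
    Measurable fun z : (Fin K → Matrix (Fin M) (Fin N) ℂ) × Matrix.unitaryGroup (Fin M) ℂ =>
      rotateChannel i z.2 z.1 :=
  measurable_pi_lambda _ fun l => measurable_matrix_mul
    ((measurable_unitaryAt i l).comp measurable_snd) ((measurable_member l).comp measurable_fst)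

lemma measurable_channel (l : Fin K) : Measurable fun x : Realization K M N n => x.1 l :=
  (measurable_member l).comp measurable_fst

lemma measurable_codebook (l : Fin K) (k : Fin n) :
    Measurable fun x : Realization K M N n => x.2 l k :=
  (measurable_codeword l k).comp measurable_snd

lemma measurable_rotate (i : Fin K) :
    Measurable fun z : Realization K M N n × Matrix.unitaryGroup (Fin M) ℂ =>
      rotate i z.2 z.1 := by
  have hu : ∀ l, Measurable fun z : Realization K M N n × Matrix.unitaryGroup (Fin M) ℂ =>
      unitaryAt i z.2.1 l := fun l => (measurable_unitaryAt i l).comp measurable_snd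
  refine Measurable.prodMk (measurable_pi_lambda _ fun l => ?_)
    (measurable_pi_lambda _ fun l => measurable_pi_lambda _ fun k => ?_)
  · exact measurable_matrix_mul (hu l) ((measurable_channel l).comp measurable_fst)
  · exact measurable_matrix_mul (measurable_matrix_mul (hu l) ((measurable_codebook l k).comp
      measurable_fst)) (measurable_matrix_conjTranspose (hu l))

lemma gaussianFamily_map_rotateChannel (i : Fin K) (U : Matrix.unitaryGroup (Fin M) ℂ) :
    (gaussianFamily K M N).map (rotateChannel i U) = gaussianFamily K M N :=
  gaussianFamily_map_unitary (unitaryAt_mem i U)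

variable {ρ : Measure (Fin K → Fin n → Matrix (Fin M) (Fin M) ℂ)}

lemma IsCodebookLaw.map_rotate (hρ : IsCodebookLaw N ρ) (i : Fin K)
    (U : Matrix.unitaryGroup (Fin M) ℂ) :
    ((gaussianFamily K M N).prod ρ).map (rotate i U) = (gaussianFamily K M N).prod ρ := by
  have := hρ.isProbabilityMeasure
  have hu := unitaryAt_mem i U
  have h1 : Measurable fun (H : Fin K → Matrix (Fin M) (Fin N) ℂ) (l : Fin K) =>
      unitaryAt i U.1 l * H l :=
    measurable_pi_lambda _ fun l => measurable_matrix_mul measurable_const (measurable_member l)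
  have h2 : Measurable fun (P : Fin K → Fin n → Matrix (Fin M) (Fin M) ℂ) (l : Fin K)
      (k : Fin n) => unitaryAt i U.1 l * P l k * (unitaryAt i U.1 l)ᴴ :=
    measurable_pi_lambda _ fun l => measurable_pi_lambda _ fun k => measurable_matrix_mul
      (measurable_matrix_mul measurable_const (measurable_codeword l k)) measurable_const
  conv_rhs => rw [← gaussianFamily_map_unitary hu, ← hρ.map_conj _ hu,
    Measure.map_prod_map _ _ h1 h2]
  rfl

lemma ae_prod_of_ae_fst {α β : Type*} [MeasurableSpace α] [MeasurableSpace β] {m : Measure α}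
    {m' : Measure β} [SFinite m] [SFinite m'] {p : α → Prop} (h : ∀ᵐ a ∂m, p a) :
    ∀ᵐ x ∂m.prod m', p x.1 := Measure.quasiMeasurePreserving_fst.ae h

lemma ae_prod_of_ae_snd {α β : Type*} [MeasurableSpace α] [MeasurableSpace β] {m : Measure α}
    {m' : Measure β} [SFinite m] [SFinite m'] {p : β → Prop} (h : ∀ᵐ b ∂m', p b) :
    ∀ᵐ x ∂m.prod m', p x.2 := Measure.quasiMeasurePreserving_snd.ae h

/-- Codewords of different users are in general position. The uniform distribution on the
Grassmannian is the law of the column space of a Gaussian matrix, so that the codewords can be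
replaced by channels, one user at a time. -/
lemma IsCodebookLaw.ae_det_ne_zero (hρ : IsCodebookLaw N ρ) (hM : M = K * N) (hK : 0 < K)
    (j : Fin K) (k : Fin K → Fin n) :
    ∀ᵐ P ∂ρ, (∑ l ∈ Finset.univ.erase j, P l (k l)
      + blockColumns hM j * (blockColumns hM j)ᴴ).det ≠ 0 := by
  have hprob := hρ.isProbabilityMeasure
  have hr : N ≤ M := by
    rw [hM]
    exact Nat.le_mul_of_pos_left N hK
  let Λ : Measure (Realization K M N n) := (gaussianFamily K M N).prod ρ
  -- The channel subspaces of the users in `s`, and the codewords of the others.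
  let mixed : Finset (Fin K) → Realization K M N n → Fin K → Matrix (Fin M) (Fin M) ℂ := fun s x l =>
    if l ∈ s then colProj (x.1 l) else x.2 l (k l)
  have hcm : ∀ l, Measurable fun x : Realization K M N n => colProj (x.1 l) := fun l =>
    measurable_colProj (measurable_channel l)
  have hPm : ∀ l, Measurable fun x : Realization K M N n => x.2 l (k l) := fun l =>
    measurable_codebook l (k l)
  have hmix : ∀ s l, Measurable fun x => mixed s x l := by
    intro s l
    by_cases h : l ∈ s
    · simpa only [mixed, if_pos h] using hcm l
    · simpa only [mixed, if_neg h] using hPm l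
  have hstep : ∀ (s : Finset (Fin K)) (i : Fin K), i ∉ s →
      (∀ᵐ x ∂Λ, (∑ l ∈ Finset.univ.erase j, mixed (insert i s) x l
        + blockColumns hM j * (blockColumns hM j)ᴴ).det ≠ 0) →
      ∀ᵐ x ∂Λ, (∑ l ∈ Finset.univ.erase j, mixed s x l
        + blockColumns hM j * (blockColumns hM j)ᴴ).det ≠ 0 := by
    intro s i hi hins
    have hother : ∀ x l, l ≠ i → mixed (insert i s) x l = mixed s x l := by
      intro x l hl
      simp [mixed, hl]
    by_cases hij : i = j
    · filter_upwards [hins] with x hx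
      rwa [Finset.sum_congr rfl fun l hl =>
        hother x l (by rw [hij]; exact Finset.ne_of_mem_erase hl)] at hx
    have hmem : i ∈ Finset.univ.erase j := Finset.mem_erase.2 ⟨hij, Finset.mem_univ i⟩
    let R : Realization K M N n → Matrix (Fin M) (Fin M) ℂ := fun x =>
      ∑ l ∈ (Finset.univ.erase j).erase i, mixed s x l
        + blockColumns hM j * (blockColumns hM j)ᴴ
    have hRm : Measurable R :=
      measurable_matrix_add (measurable_matrix_sum _ fun l _ => hmix s l) measurable_const
    have e1 : ∀ x, ∑ l ∈ Finset.univ.erase j, mixed s x l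
        + blockColumns hM j * (blockColumns hM j)ᴴ = R x + x.2 i (k i) := by
      intro x
      rw [← Finset.sum_erase_add _ _ hmem]
      simp only [R, mixed, if_neg hi]
      abel
    have e2 : ∀ x, ∑ l ∈ Finset.univ.erase j, mixed (insert i s) x l
        + blockColumns hM j * (blockColumns hM j)ᴴ = R x + colProj (x.1 i) := by
      intro x
      rw [← Finset.sum_erase_add _ _ hmem, Finset.sum_congr rfl fun l hl =>
        hother x l (Finset.ne_of_mem_erase hl)]
      simp only [R, mixed, if_pos (Finset.mem_insert_self i s)]
      abel
    have hset : MeasurableSet {z : Matrix (Fin M) (Fin M) ℂ × Matrix (Fin M) (Fin M) ℂ |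
        (z.1 + z.2).det = 0} :=
      measurableSet_eq_fun (measurable_matrix_det (measurable_matrix_add measurable_fst
        measurable_snd)) measurable_const
    let ind : Matrix (Fin M) (Fin M) ℂ × Matrix (Fin M) (Fin M) ℂ → ENNReal :=
      Set.indicator {z | (z.1 + z.2).det = 0} fun _ => 1
    have hind : Measurable ind := measurable_const.indicator hset
    -- Only the term of user `i` rotates with its channel and codebook.
    have hrepl := lintegral_replace_projection (m := Λ) (measurable_rotate i) (hρ.map_rotate i) hr
      (R := R) hRm (fun U x => by
        simp only [R]
        congr 1
        refine Finset.sum_congr rfl fun l hl => ?_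
        have hl := Finset.ne_of_mem_erase hl
        simp only [mixed, rotate_fst_of_ne i U x hl, rotate_snd_of_ne i U x hl])
      (hPm i) (hcm i)
      (by filter_upwards [ae_prod_of_ae_snd hρ.isRankProj] with x hx using hx i (k i))
      (by filter_upwards [ae_prod_of_ae_fst (gaussianFamily_ae_fullRank hM)] with x hx
            using isRankProj_colProj (hx i))
      (fun U x => by simp only [rotate_snd_self])
      (fun U x => by simp only [rotate_fst_self, colProj_unitary_mul U.2])
      hind
    have hz : ∫⁻ x, ind (R x, colProj (x.1 i)) ∂Λ = 0 := by
      rw [lintegral_eq_zero_iff (f := fun x => ind (R x, colProj (x.1 i)))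
        (hind.comp (hRm.prodMk (hcm i)))]
      filter_upwards [hins] with x hx
      rw [e2] at hx
      simp [ind, hx]
    rw [hz, lintegral_eq_zero_iff (f := fun x => ind (R x, x.2 i (k i)))
      (hind.comp (hRm.prodMk (hPm i)))] at hrepl
    filter_upwards [hrepl] with x hx h0
    rw [e1] at h0
    simp [ind, h0] at hx
  have hall : ∀ t : Finset (Fin K), ∀ᵐ x ∂Λ, (∑ l ∈ Finset.univ.erase j, mixed tᶜ x l
        + blockColumns hM j * (blockColumns hM j)ᴴ).det ≠ 0 := by
    intro t
    induction t using Finset.induction_on with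
    | empty =>
      filter_upwards [ae_prod_of_ae_fst (gaussianFamily_ae_det_ne_zero hM j)] with x hx
      simp only [mixed, Finset.compl_empty, Finset.mem_univ, if_true]
      exact hx
    | insert i t hi ih =>
      refine hstep _ i (by simp) ?_
      have : insert i (insert i t)ᶜ = tᶜ := by
        ext l
        by_cases hl : l = i <;> simp [hl, hi]
      rwa [this]
  have hfin := hall Finset.univ
  simp only [mixed, Finset.compl_univ, Finset.notMem_empty, if_false] at hfin
  have hset : MeasurableSet {P : Fin K → Fin n → Matrix (Fin M) (Fin M) ℂ |
      (∑ l ∈ Finset.univ.erase j, P l (k l)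
      + blockColumns hM j * (blockColumns hM j)ᴴ).det ≠ 0} :=
    (measurableSet_eq_fun (measurable_matrix_det (measurable_matrix_add
      (measurable_matrix_sum _ fun l _ => measurable_codeword l (k l)) measurable_const))
      measurable_const).compl
  have hsnd := (measurePreserving_snd (μ := gaussianFamily K M N) (ν := ρ)).map_eq
  rw [← hsnd, ae_map_iff measurable_snd.aemeasurable hset]
  exact hfin

end law

/-! ### Mean interference power -/

section expectation
variable {K M N n : ℕ}

lemma trace_mul_mul_conjTranspose_congr {Q : Matrix (Fin M) (Fin M) ℂ} (hQ : Qᴴ = Q)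
    {X Y : Matrix (Fin M) (Fin N) ℂ} (h : Q * X = Q * Y) :
    (Q * (X * Xᴴ)).trace = (Q * (Y * Yᴴ)).trace := by
  have h' : Xᴴ * Q = Yᴴ * Q := by
    have := congrArg Matrix.conjTranspose h
    rwa [Matrix.conjTranspose_mul, Matrix.conjTranspose_mul, hQ] at this
  rw [← Matrix.mul_assoc, h, Matrix.mul_assoc, Matrix.trace_mul_comm, Matrix.mul_assoc, h',
    ← Matrix.mul_assoc, Matrix.trace_mul_comm]

open scoped ComplexOrder in
lemma posSemidef_kerProj (E : Matrix (Fin M) (Fin N) ℂ) (T : Matrix (Fin M) (Fin M) ℂ) :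
    (kerProj E T).PosSemidef := by
  rcases kerProj_eq_zero_or E T with h | h
  · rw [h]
    exact Matrix.PosSemidef.zero
  · exact h.posSemidef

lemma trace_kerProj_le (E : Matrix (Fin M) (Fin N) ℂ) (T : Matrix (Fin M) (Fin M) ℂ) :
    (kerProj E T).trace.re ≤ N := by
  rcases kerProj_eq_zero_or E T with h | h
  · simp [h]
  · simp [h.trace_eq]

/-- The projection onto the kernel of `U q Uᴴ + T` is orthogonal to `U q Uᴴ`. Averaged over `U`, it
is equally distributed over the directions of the range of `1 - q`, a space of dimension
`M - N`. -/
lemma lintegral_trace_kerProj_le {ι : Type*} {s : Finset ι} {p : ι → Matrix (Fin M) (Fin M) ℂ}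
    (hp : ∀ l ∈ s, IsRankProj N (p l)) (hN : 0 < N) (hs : s.card * N + 2 * N ≤ M)
    {q : Matrix (Fin M) (Fin M) ℂ} (hq : IsRankProj N q) (E H : Matrix (Fin M) (Fin N) ℂ) :
    ((M - N : ℕ) : ENNReal) * ∫⁻ U, ENNReal.ofReal
        (kerProj E (U.1 * q * U.1ᴴ + ∑ l ∈ s, p l) * ((U.1 * H) * (U.1 * H)ᴴ)).trace.re
          ∂unitaryHaar M
      ≤ N * ENNReal.ofReal ((1 - q) * (H * Hᴴ)).trace.re := by
  classical
  have hNM : N ≤ M := by omega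
  have hMN : 0 < M - N := by omega
  set T := ∑ l ∈ s, p l with hT
  have hq' : IsRankProj (M - N) (1 - q) := hq.one_sub hNM
  let Φ : Matrix (Fin M) (Fin M) ℂ → Matrix (Fin M) (Fin M) ℂ := fun Q => kerProj E (1 - Q + T)
  have hΦm : Measurable Φ := measurable_kerProj E (measurable_matrix_add
    (measurable_matrix_sub measurable_const measurable_id) measurable_const)
  have hconj : ∀ U : Matrix.unitaryGroup (Fin M) ℂ, 1 - U.1 * (1 - q) * U.1ᴴ = U.1 * q * U.1ᴴ := by
    intro U
    have : U.1 * U.1ᴴ = 1 := Matrix.mem_unitaryGroup_iff.1 U.2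
    rw [Matrix.mul_sub, Matrix.sub_mul, Matrix.mul_one, this, sub_sub_cancel]
  have hzero : ∀ U : Matrix.unitaryGroup (Fin M) ℂ,
      kerProj E (U.1 * q * U.1ᴴ + T) * (U.1 * q * U.1ᴴ) = 0 := by
    intro U
    -- `U q Uᴴ` and the `p l` form a family of `#s + 1` projections.
    let p' : Option ι → Matrix (Fin M) (Fin M) ℂ := fun o => o.elim (U.1 * q * U.1ᴴ) p
    have hp' : ∀ o ∈ Finset.insertNone s, IsRankProj N (p' o) := by
      intro o ho
      cases o with
      | none => exact hq.unitary_conj U.2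
      | some l => exact hp l (Finset.some_mem_insertNone.1 ho)
    have h := mul_kerProj_eq_zero (E := E) hp' (by
      rw [Finset.card_insertNone, Nat.add_mul, one_mul]
      omega) (Finset.none_mem_insertNone (s := s))
    rw [Finset.sum_insertNone] at h
    have h2 := congrArg Matrix.conjTranspose h
    rw [Matrix.conjTranspose_mul, (hp' none Finset.none_mem_insertNone).conjTranspose_eq,
      Matrix.conjTranspose_zero, (posSemidef_kerProj _ _).1.eq] at h2
    exact h2
  set C := (1 - q) * H with hC
  have hCC : (1 - q) * C = C := by rw [hC, ← Matrix.mul_assoc, hq'.mul_self]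
  have hH : ∀ U : Matrix.unitaryGroup (Fin M) ℂ,
      (kerProj E (U.1 * q * U.1ᴴ + T) * ((U.1 * H) * (U.1 * H)ᴴ)).trace
        = (Φ (U.1 * (1 - q) * U.1ᴴ) * ((U.1 * C) * (U.1 * C)ᴴ)).trace := by
    intro U
    simp only [Φ, hconj]
    refine trace_mul_mul_conjTranspose_congr (posSemidef_kerProj _ _).1.eq ?_
    have h1 : U.1ᴴ * U.1 = 1 := Matrix.mem_unitaryGroup_iff'.1 U.2
    have h2 : U.1 * C = U.1 * H - U.1 * q * U.1ᴴ * (U.1 * H) := by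
      rw [Matrix.mul_assoc (U.1 * q), ← Matrix.mul_assoc U.1ᴴ, h1, Matrix.one_mul, hC,
        Matrix.sub_mul, Matrix.one_mul, Matrix.mul_sub, Matrix.mul_assoc]
    rw [h2, Matrix.mul_sub, ← Matrix.mul_assoc _ (U.1 * q * U.1ᴴ), hzero, Matrix.zero_mul, sub_zero]
  simp_rw [hH]
  rw [lintegral_trace_average hMN hΦm (fun Q _ => posSemidef_kerProj _ _) hq' hCC, mul_comm]
  refine mul_le_mul' ?_ (le_of_eq ?_)
  · refine (lintegral_mono (g := fun _ => (N : ENNReal)) fun U => ?_).trans (by simp)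
    have h1 : (Φ (U.1 * (1 - q) * U.1ᴴ) * (U.1 * (1 - q) * U.1ᴴ)).trace.re ≤ N := by
      have h2 : U.1 * (1 - q) * U.1ᴴ = 1 - U.1 * q * U.1ᴴ := by rw [← hconj, sub_sub_cancel]
      simp only [Φ, hconj]
      rw [h2, Matrix.mul_sub, hzero, sub_zero, Matrix.mul_one]
      exact trace_kerProj_le _ _
    calc _ ≤ ENNReal.ofReal (N : ℝ) := ENNReal.ofReal_le_ofReal h1
      _ = N := ENNReal.ofReal_natCast N
  · congr 2
    rw [hC, Matrix.conjTranspose_mul, hq'.conjTranspose_eq, ← Matrix.mul_assoc,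
      Matrix.trace_mul_comm, ← Matrix.mul_assoc, ← Matrix.mul_assoc, hq'.mul_self, Matrix.mul_assoc]

variable {ρ : Measure (Fin K → Fin n → Matrix (Fin M) (Fin M) ℂ)}

/-- The projection onto the codeword subspace of user `l` that quantizes its channel. -/
def quantizedProj [NeZero n] (l : Fin K) (x : Realization K M N n) :
    Matrix (Fin M) (Fin M) ℂ :=
  quantProj (colProj (x.1 l)) (x.2 l)

lemma measurable_quantizedProj [NeZero n] (l : Fin K) :
    Measurable (quantizedProj (n := n) (M := M) (N := N) l) :=
  measurable_quantProj (measurable_colProj (measurable_channel l))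
    fun k => measurable_codebook l k

lemma quantizedProj_rotate_self [NeZero n] (i : Fin K) (U : Matrix.unitaryGroup (Fin M) ℂ)
    (x : Realization K M N n) :
    quantizedProj i (rotate i U x) = U.1 * quantizedProj i x * U.1ᴴ := by
  rw [quantizedProj, rotate_fst_self, rotate_snd_self, colProj_unitary_mul U.2,
    quantProj_unitary_conj U.2, quantizedProj]

lemma quantizedProj_rotate_of_ne [NeZero n] {i l : Fin K} (h : l ≠ i)
    (U : Matrix.unitaryGroup (Fin M) ℂ) (x : Realization K M N n) :
    quantizedProj l (rotate i U x) = quantizedProj l x := by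
  rw [quantizedProj, rotate_fst_of_ne i U x h, rotate_snd_of_ne i U x h, quantizedProj]

lemma measurable_ofReal_trace_mul {α : Type*} [MeasurableSpace α]
    {f g : α → Matrix (Fin M) (Fin M) ℂ} (hf : Measurable f) (hg : Measurable g) :
    Measurable fun x => ENNReal.ofReal (f x * g x).trace.re :=
  (Complex.measurable_re.comp (measurable_matrix_trace (measurable_matrix_mul hf hg))).ennreal_ofReal

lemma measurable_mul_conjTranspose_self {α : Type*} [MeasurableSpace α]
    {f : α → Matrix (Fin M) (Fin N) ℂ} (hf : Measurable f) : Measurable fun x => f x * (f x)ᴴ :=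
  measurable_matrix_mul hf (measurable_matrix_conjTranspose hf)

/-- The mean interference power that user `i` receives through the precoder of user `j ≠ i`, in terms
of the part of its channel outside the quantized subspace. -/
lemma IsCodebookLaw.lintegral_interference_le [NeZero n] (hρ : IsCodebookLaw N ρ) (hN : 0 < N)
    (hM : M = K * N) {i j : Fin K} (hij : i ≠ j) :
    ((M - N : ℕ) : ENNReal) * ∫⁻ x, ENNReal.ofReal (kerProj (blockColumns hM j)
        (∑ l ∈ Finset.univ.erase j, quantizedProj l x) * (x.1 i * (x.1 i)ᴴ)).trace.re
          ∂(gaussianFamily K M N).prod ρ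
      ≤ N * ∫⁻ x, ENNReal.ofReal ((1 - quantizedProj i x) * (x.1 i * (x.1 i)ᴴ)).trace.re
          ∂(gaussianFamily K M N).prod ρ := by
  have hprob := hρ.isProbabilityMeasure
  have hmem : i ∈ Finset.univ.erase j := Finset.mem_erase.2 ⟨hij, Finset.mem_univ i⟩
  have hHm : Measurable fun x : Realization K M N n => x.1 i * (x.1 i)ᴴ :=
    measurable_mul_conjTranspose_self (measurable_channel i)
  have havg := lintegral_eq_lintegral_average (measurable_rotate i) (hρ.map_rotate i)
    (F := fun x => ENNReal.ofReal (kerProj (blockColumns hM j)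
        (∑ l ∈ Finset.univ.erase j, quantizedProj l x) * (x.1 i * (x.1 i)ᴴ)).trace.re)
    (measurable_ofReal_trace_mul (measurable_kerProj _ (measurable_matrix_sum _ fun l _ =>
      measurable_quantizedProj l)) hHm)
  rw [havg, ← lintegral_const_mul' _ _ (ENNReal.natCast_ne_top _),
    ← lintegral_const_mul' _ _ (ENNReal.natCast_ne_top _)]
  refine lintegral_mono_ae ?_
  filter_upwards [ae_prod_of_ae_snd hρ.isRankProj] with x hx
  have hcard : ((Finset.univ.erase j).erase i).card * N + 2 * N ≤ M := by
    rw [Finset.card_erase_of_mem hmem, Finset.card_erase_of_mem (Finset.mem_univ j),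
      Finset.card_univ, Fintype.card_fin, ← Nat.add_mul, hM]
    refine Nat.mul_le_mul_right N ?_
    have h1 := i.2
    have h2 := j.2
    have h3 : (i : ℕ) ≠ j := fun h => hij (Fin.ext h)
    omega
  have h := lintegral_trace_kerProj_le (s := (Finset.univ.erase j).erase i)
    (p := fun l => quantizedProj l x) (fun l _ => isRankProj_quantProj (hx l) _) hN hcard
    (isRankProj_quantProj (hx i) (colProj (x.1 i))) (blockColumns hM j) (x.1 i)
  refine le_trans (le_of_eq ?_) h
  refine congrArg (fun t => ((M - N : ℕ) : ENNReal) * t) (lintegral_congr fun U => ?_)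
  have hsum : ∑ l ∈ Finset.univ.erase j, quantizedProj l (rotate i U x)
      = U.1 * quantProj (colProj (x.1 i)) (x.2 i) * U.1ᴴ
        + ∑ l ∈ (Finset.univ.erase j).erase i, quantizedProj l x := by
    rw [← Finset.add_sum_erase _ _ hmem, quantizedProj_rotate_self, quantizedProj,
      Finset.sum_congr rfl fun l hl => quantizedProj_rotate_of_ne (Finset.ne_of_mem_erase hl) U x]
  rw [hsum, rotate_fst_self]

lemma lintegral_trace_gaussianFamily (i : Fin K) :
    ∫⁻ H, ENNReal.ofReal (H i * (H i)ᴴ).trace.re ∂gaussianFamily K M N = M * N := by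
  have h : ∀ A : Matrix (Fin M) (Fin N) ℂ, ENNReal.ofReal (A * Aᴴ).trace.re
      = ∑ a, ∑ b, ENNReal.ofReal (‖A a b‖ ^ 2) := by
    intro A
    have h1 : (A * Aᴴ).trace.re = ∑ a, ∑ b, ‖A a b‖ ^ 2 := by
      have : (A * Aᴴ).trace = ((∑ a, ∑ b, ‖A a b‖ ^ 2 : ℝ) : ℂ) := by
        simp [Matrix.trace, Matrix.mul_apply, Complex.mul_conj']
      rw [this, Complex.ofReal_re]
    rw [h1, ENNReal.ofReal_sum_of_nonneg fun a _ => Finset.sum_nonneg fun b _ => sq_nonneg _]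
    exact Finset.sum_congr rfl fun a _ => ENNReal.ofReal_sum_of_nonneg fun b _ => sq_nonneg _
  have hm : ∀ a b, Measurable fun H : Fin K → Matrix (Fin M) (Fin N) ℂ =>
      ENNReal.ofReal (‖H i a b‖ ^ 2) := fun a b =>
    ((((measurable_entry a b).comp (measurable_member i)).norm).pow_const 2).ennreal_ofReal
  simp_rw [h]
  rw [lintegral_finsetSum _ fun a _ => Finset.measurable_fun_sum _ fun b _ => hm a b]
  simp_rw [lintegral_finsetSum _ fun b _ => hm _ b, lintegral_normSq_gaussianFamily]
  simp

/-- The column space of a Gaussian matrix is independent of its Gram matrix, so that in the mean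
`H Hᴴ` can be replaced by `M` times the projection onto the column space of `H`. -/
lemma lintegral_gaussian_eq (hN : 0 < N) (hM : M = K * N) (i : Fin K)
    {Φ : Matrix (Fin M) (Fin M) ℂ → Matrix (Fin M) (Fin M) ℂ} (hΦm : Measurable Φ)
    (hΦ : open scoped ComplexOrder in ∀ Q, IsRankProj N Q → (Φ Q).PosSemidef) :
    ∫⁻ H, ENNReal.ofReal (Φ (colProj (H i)) * (H i * (H i)ᴴ)).trace.re ∂gaussianFamily K M N
      = M * ∫⁻ H, ENNReal.ofReal (Φ (colProj (H i)) * colProj (H i)).trace.re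
          ∂gaussianFamily K M N := by
  have hr : N ≤ M := by
    rw [hM]
    exact Nat.le_mul_of_pos_left N i.pos
  have hcm : Measurable fun H : Fin K → Matrix (Fin M) (Fin N) ℂ => colProj (H i) :=
    measurable_colProj (measurable_member i)
  have hfull := gaussianFamily_ae_fullRank (K := K) (N := N) hM
  have hp₀ : IsRankProj N (blockColumns hM i * (blockColumns hM i)ᴴ) :=
    ⟨_, blockColumns_conjTranspose_mul_self hM i, rfl⟩
  set p₀ := blockColumns hM i * (blockColumns hM i)ᴴ
  let F : Matrix (Fin M) (Fin M) ℂ → ENNReal := fun A => ENNReal.ofReal (Φ A * A).trace.re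
  have hN0 : (N : ENNReal) ≠ 0 := Nat.cast_ne_zero.2 hN.ne'
  have hNtop : (N : ENNReal) ≠ ⊤ := ENNReal.natCast_ne_top N
  have havg1 := lintegral_eq_lintegral_average (measurable_rotateChannel i)
    (gaussianFamily_map_rotateChannel (N := N) i)
    (F := fun H => ENNReal.ofReal (Φ (colProj (H i)) * (H i * (H i)ᴴ)).trace.re)
    (measurable_ofReal_trace_mul (hΦm.comp hcm)
      (measurable_mul_conjTranspose_self (measurable_member i)))
  have havg2 := lintegral_eq_lintegral_average (measurable_rotateChannel i)
    (gaussianFamily_map_rotateChannel (N := N) i)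
    (F := fun H => ENNReal.ofReal (Φ (colProj (H i)) * colProj (H i)).trace.re)
    (measurable_ofReal_trace_mul (hΦm.comp hcm) hcm)
  rw [← ENNReal.mul_right_inj hN0 hNtop, havg1, havg2,
    ← lintegral_const_mul' _ _ hNtop]
  have e1 : ∀ᵐ H ∂gaussianFamily K M N, N * ∫⁻ U, ENNReal.ofReal (Φ (colProj (rotateChannel i U H i))
        * (rotateChannel i U H i * (rotateChannel i U H i)ᴴ)).trace.re ∂unitaryHaar M
      = ENNReal.ofReal (H i * (H i)ᴴ).trace.re *
        ∫⁻ U, F (U.1 * p₀ * U.1ᴴ) ∂unitaryHaar M := by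
    filter_upwards [hfull] with H hH
    have e : ∀ U : Matrix.unitaryGroup (Fin M) ℂ, ENNReal.ofReal
        (Φ (colProj (rotateChannel i U H i))
          * (rotateChannel i U H i * (rotateChannel i U H i)ᴴ)).trace.re
        = ENNReal.ofReal (Φ (U.1 * colProj (H i) * U.1ᴴ)
          * ((U.1 * H i) * (U.1 * H i)ᴴ)).trace.re := by
      intro U
      rw [rotateChannel_self, colProj_unitary_mul U.2]
    rw [lintegral_congr e, lintegral_trace_average hN hΦm hΦ (isRankProj_colProj (hH i)) (colProj_mul_self (hH i))]
    exact congrArg _ <| lintegral_conj_eq hr (isRankProj_colProj (hH i)) hp₀ F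
  have e2 : ∀ᵐ H ∂gaussianFamily K M N, ∫⁻ U, ENNReal.ofReal (Φ (colProj (rotateChannel i U H i))
        * colProj (rotateChannel i U H i)).trace.re ∂unitaryHaar M
      = ∫⁻ U, F (U.1 * p₀ * U.1ᴴ) ∂unitaryHaar M := by
    filter_upwards [hfull] with H hH
    have e : ∀ U : Matrix.unitaryGroup (Fin M) ℂ, ENNReal.ofReal
        (Φ (colProj (rotateChannel i U H i)) * colProj (rotateChannel i U H i)).trace.re
        = F (U.1 * colProj (H i) * U.1ᴴ) := by
      intro U
      rw [rotateChannel_self, colProj_unitary_mul U.2]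
    rw [lintegral_congr e]
    exact lintegral_conj_eq hr (isRankProj_colProj (hH i)) hp₀ F
  have hm : Measurable fun H : Fin K → Matrix (Fin M) (Fin N) ℂ =>
      ENNReal.ofReal (H i * (H i)ᴴ).trace.re :=
    (Complex.measurable_re.comp (measurable_matrix_trace
      (measurable_mul_conjTranspose_self (measurable_member i)))).ennreal_ofReal
  rw [lintegral_congr_ae e1, lintegral_congr_ae e2, lintegral_mul_const _ hm,
    lintegral_trace_gaussianFamily]
  simp only [lintegral_const, measure_univ, mul_one]
  ring

/-- The mean power of the channel outside the quantized subspace is `M` times the distortion. -/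
lemma IsCodebookLaw.lintegral_error_eq [NeZero n] (hρ : IsCodebookLaw N ρ) (hN : 0 < N)
    (hM : M = K * N) (i : Fin K) :
    ∫⁻ x, ENNReal.ofReal ((1 - quantizedProj i x) * (x.1 i * (x.1 i)ᴴ)).trace.re
          ∂(gaussianFamily K M N).prod ρ
      = M * ∫⁻ x, ENNReal.ofReal ((1 - quantizedProj i x) * colProj (x.1 i)).trace.re
          ∂(gaussianFamily K M N).prod ρ := by
  have hprob := hρ.isProbabilityMeasure
  have hr : N ≤ M := by
    rw [hM]
    exact Nat.le_mul_of_pos_left N i.pos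
  have hm : Measurable fun x : Realization K M N n => 1 - quantizedProj i x :=
    measurable_matrix_sub measurable_const (measurable_quantizedProj i)
  have hHm := measurable_channel (K := K) (M := M) (N := N) (n := n) i
  rw [lintegral_prod_symm _ (measurable_ofReal_trace_mul hm
      (measurable_mul_conjTranspose_self hHm)).aemeasurable,
    lintegral_prod_symm _ (measurable_ofReal_trace_mul hm
      (measurable_colProj hHm)).aemeasurable,
    ← lintegral_const_mul' _ _ (ENNReal.natCast_ne_top _)]
  refine lintegral_congr_ae ?_
  filter_upwards [hρ.isRankProj] with P hP
  exact lintegral_gaussian_eq hN hM i (Φ := fun Q => 1 - quantProj Q (P i))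
    (measurable_matrix_sub measurable_const
      (measurable_quantProj measurable_id fun k => measurable_const))
    fun Q _ => ((isRankProj_quantProj (hP i) Q).one_sub hr).posSemidef

/-- A Gaussian channel sees every independent random precoding subspace in the same way: the law of
`Hᴴ Q H` depends on the random projection `Q` only through its rank. -/
lemma IsCodebookLaw.lintegral_conj_channel_eq (hρ : IsCodebookLaw N ρ) (i : Fin K) (hr : N ≤ M)
    {Q Q' : Realization K M N n → Matrix (Fin M) (Fin M) ℂ} (hQm : Measurable Q) (hQm' : Measurable Q')
    (hQ : ∀ᵐ x ∂(gaussianFamily K M N).prod ρ, IsRankProj N (Q x))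
    (hQ' : ∀ᵐ x ∂(gaussianFamily K M N).prod ρ, IsRankProj N (Q' x))
    (hQr : ∀ U x, Q (rotateChannel i U x.1, x.2) = Q x)
    (hQr' : ∀ U x, Q' (rotateChannel i U x.1, x.2) = Q' x)
    {f : Matrix (Fin N) (Fin N) ℂ → ENNReal} (hf : Measurable f) :
    ∫⁻ x, f ((x.1 i)ᴴ * Q x * x.1 i) ∂(gaussianFamily K M N).prod ρ
      = ∫⁻ x, f ((x.1 i)ᴴ * Q' x * x.1 i) ∂(gaussianFamily K M N).prod ρ := by
  have hprob := hρ.isProbabilityMeasure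
  -- The action is by `U⁻¹`, so that in `H_iᴴ Q H_i` the projection `Q` is conjugated by `U`.
  have hact : Measurable fun z : Realization K M N n × Matrix.unitaryGroup (Fin M) ℂ =>
      (rotateChannel i z.2⁻¹ z.1.1, z.1.2) :=
    ((measurable_rotateChannel i).comp ((measurable_fst.comp measurable_fst).prodMk
      measurable_snd.inv)).prodMk (measurable_snd.comp measurable_fst)
  have hinv : ∀ U : Matrix.unitaryGroup (Fin M) ℂ, ((gaussianFamily K M N).prod ρ).map
      (fun x => (rotateChannel i U⁻¹ x.1, x.2)) = (gaussianFamily K M N).prod ρ := by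
    intro U
    have h1 : Measurable fun H : Fin K → Matrix (Fin M) (Fin N) ℂ => rotateChannel i U⁻¹ H :=
      measurable_pi_lambda _ fun l => measurable_matrix_mul measurable_const (measurable_member l)
    have h2 : MeasurePreserving (fun H => rotateChannel i U⁻¹ H)
        (gaussianFamily K M N) (gaussianFamily K M N) :=
      ⟨h1, gaussianFamily_map_rotateChannel i U⁻¹⟩
    exact (h2.prod (MeasurePreserving.id ρ)).map_eq
  have hHm := measurable_channel (K := K) (M := M) (N := N) (n := n) i
  have hF : ∀ {R : Realization K M N n → Matrix (Fin M) (Fin M) ℂ}, Measurable R →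
      Measurable fun x : Realization K M N n => f ((x.1 i)ᴴ * R x * x.1 i) := fun hR =>
    hf.comp (measurable_matrix_mul (measurable_matrix_mul
      (measurable_matrix_conjTranspose hHm) hR) hHm)
  have havg := fun (R : Realization K M N n → Matrix (Fin M) (Fin M) ℂ) (hR : Measurable R) =>
    lintegral_eq_lintegral_average
    (act := fun U (x : Realization K M N n) => (rotateChannel i U⁻¹ x.1, x.2))
    hact hinv (F := fun x => f ((x.1 i)ᴴ * R x * x.1 i)) (hF hR)
  rw [havg Q hQm, havg Q' hQm']
  refine lintegral_congr_ae ?_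
  filter_upwards [hQ, hQ'] with x hx hx'
  have e : ∀ (U : Matrix.unitaryGroup (Fin M) ℂ) (A : Matrix (Fin M) (Fin M) ℂ),
      (rotateChannel i U⁻¹ x.1 i)ᴴ * A * rotateChannel i U⁻¹ x.1 i
        = (x.1 i)ᴴ * (U.1 * A * U.1ᴴ) * x.1 i := by
    intro U A
    have : (U⁻¹).1 = U.1ᴴ := rfl
    rw [rotateChannel_self, this, Matrix.conjTranspose_mul, Matrix.conjTranspose_conjTranspose]
    simp only [Matrix.mul_assoc]
  have eQ : ∀ (R : Realization K M N n → Matrix (Fin M) (Fin M) ℂ)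
      (_ : ∀ U x, R (rotateChannel i U x.1, x.2) = R x) (U : Matrix.unitaryGroup (Fin M) ℂ),
      f ((rotateChannel i U⁻¹ x.1 i)ᴴ * R (rotateChannel i U⁻¹ x.1, x.2)
        * rotateChannel i U⁻¹ x.1 i) = f ((x.1 i)ᴴ * (U.1 * R x * U.1ᴴ) * x.1 i) := by
    intro R hR U
    rw [hR, e]
  rw [lintegral_congr (eQ Q hQr), lintegral_congr (eQ Q' hQr')]
  exact lintegral_conj_eq hr hx hx' fun A => f ((x.1 i)ᴴ * A * x.1 i)

end expectation

/-! ### Rates in terms of projections -/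

section rate
variable {K M N : ℕ}

open scoped ComplexOrder MatrixOrder Matrix.Norms.L2Operator in
lemma det_re_le_det_re_add_of_posSemidef {A X : Matrix (Fin N) (Fin N) ℂ} (hA : A.PosDef)
    (hX : X.PosSemidef) : A.det.re ≤ (A + X).det.re := by
  obtain ⟨B, hB⟩ := CStarAlgebra.nonneg_iff_eq_star_mul_self.mp hX.nonneg
  have h := det_re_le_det_re_add hA Bᴴ
  rwa [Matrix.conjTranspose_conjTranspose, ← Matrix.star_eq_conjTranspose, ← hB] at h

/-- The received covariance `(P/K) ∑_{j ∈ s} Aᴴ Q_j A`, in terms of the projections `Q_j` onto the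
precoding subspaces. -/
def receivedCov (P : ℝ) (A : Matrix (Fin M) (Fin N) ℂ) (Q : Fin K → Matrix (Fin M) (Fin M) ℂ)
    (s : Finset (Fin K)) : Matrix (Fin N) (Fin N) ℂ :=
  (P / (K : ℝ)) • ∑ j ∈ s, Aᴴ * Q j * A

lemma rateTerm_eq (P : ℝ) (A : Matrix (Fin M) (Fin N) ℂ) (V : Fin K → Matrix (Fin M) (Fin N) ℂ)
    (s : Finset (Fin K)) :
    rateTerm P A V s = log2Det (1 + receivedCov P A (fun j => V j * (V j)ᴴ) s) := by
  simp only [rateTerm, receivedCov, Matrix.mul_assoc]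

variable {P : ℝ} {A : Matrix (Fin M) (Fin N) ℂ} {Q : Fin K → Matrix (Fin M) (Fin M) ℂ}

open scoped ComplexOrder in
lemma posSemidef_receivedCov (hP : 0 ≤ P) (hQ : ∀ j, (Q j).PosSemidef) (s : Finset (Fin K)) :
    (receivedCov P A Q s).PosSemidef :=
  (Matrix.posSemidef_sum s fun j _ => (hQ j).conjTranspose_mul_mul_same A).smul
    (div_nonneg hP (Nat.cast_nonneg K))

lemma trace_receivedCov (s : Finset (Fin K)) :
    (receivedCov P A Q s).trace.re = P / K * ∑ j ∈ s, (Q j * (A * Aᴴ)).trace.re := by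
  rw [receivedCov, Matrix.trace_smul, Matrix.trace_sum, Complex.smul_re, Complex.re_sum, smul_eq_mul]
  refine congrArg _ (Finset.sum_congr rfl fun j _ => ?_)
  rw [Matrix.mul_assoc, Matrix.trace_mul_comm, Matrix.mul_assoc]

open scoped ComplexOrder in
lemma log2Det_one_add_nonneg {X : Matrix (Fin N) (Fin N) ℂ} (hX : X.PosSemidef) :
    0 ≤ log2Det (1 + X) :=
  Real.logb_nonneg one_lt_two (Complex.le_def.1 (one_le_det_one_add hX)).1

open scoped ComplexOrder in
/-- The tangent bound for `log₂ det` at the multiple `c • 1` of the identity. -/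
lemma log2Det_one_add_le {X : Matrix (Fin N) (Fin N) ℂ} (hX : X.PosSemidef) {c : ℝ} (hc : 0 < c) :
    log2Det (1 + X) ≤ N * Real.logb 2 c + (X.trace.re - N * (c - 1)) / (c * Real.log 2) := by
  have h := log_det_le (Matrix.PosDef.one.add_posSemidef hX) hc
  have h2 : 0 < Real.log 2 := Real.log_pos one_lt_two
  rw [Fintype.card_fin, Matrix.trace_add, Matrix.trace_one, Complex.add_re, Fintype.card_fin,
    Complex.natCast_re] at h
  rw [log2Det, Real.logb, Real.logb, div_le_iff₀ h2]
  refine h.trans (le_of_eq ?_)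
  field_simp
  ring

open scoped ComplexOrder in
lemma log2Det_one_add_mono {X Y : Matrix (Fin N) (Fin N) ℂ} (hX : X.PosSemidef)
    (hY : Y.PosSemidef) : log2Det (1 + X) ≤ log2Det (1 + (X + Y)) := by
  refine Real.logb_le_logb_of_le one_lt_two
    (one_pos.trans_le (Complex.le_def.1 (one_le_det_one_add hX)).1) ?_
  rw [← add_assoc]
  exact det_re_le_det_re_add_of_posSemidef (Matrix.PosDef.one.add_posSemidef hX) hY

open scoped ComplexOrder in
lemma log2Det_receivedCov_le (hP : 0 ≤ P) (hQ : ∀ j, IsRankProj N (Q j)) (hr : N ≤ M)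
    (s : Finset (Fin K)) :
    log2Det (1 + receivedCov P A Q s)
      ≤ P / K * (s.card * (A * Aᴴ).trace.re) / Real.log 2 := by
  have h := log2Det_one_add_le (posSemidef_receivedCov (A := A) hP (fun j => (hQ j).posSemidef) s)
    one_pos
  rw [Real.logb_one, mul_zero, zero_add, sub_self, mul_zero, sub_zero, one_mul,
    trace_receivedCov] at h
  refine h.trans (div_le_div_of_nonneg_right ?_ (Real.log_pos one_lt_two).le)
  refine mul_le_mul_of_nonneg_left ?_ (div_nonneg hP (Nat.cast_nonneg K))
  rw [← nsmul_eq_mul, ← Finset.sum_const]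
  refine Finset.sum_le_sum fun j _ => ?_
  have h1 := ((hQ j).one_sub hr).posSemidef.conjTranspose_mul_mul_same A
  have h2 := (Complex.le_def.1 h1.trace_nonneg).1
  rw [Matrix.trace_mul_comm, ← Matrix.mul_assoc, Matrix.trace_mul_comm, Matrix.sub_mul,
    Matrix.one_mul, Matrix.trace_sub, Complex.sub_re, Complex.zero_re, sub_nonneg] at h2
  exact h2

lemma measurable_log2Det {α : Type*} [MeasurableSpace α] {f : α → Matrix (Fin N) (Fin N) ℂ}
    (hf : Measurable f) : Measurable fun x => log2Det (f x) :=
  (Real.measurable_log.comp (Complex.measurable_re.comp (measurable_matrix_det hf))).div_const _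

lemma measurable_receivedCov {α : Type*} [MeasurableSpace α] {A : α → Matrix (Fin M) (Fin N) ℂ}
    {Q : Fin K → α → Matrix (Fin M) (Fin M) ℂ} (P : ℝ) (hA : Measurable A)
    (hQ : ∀ j, Measurable (Q j)) (s : Finset (Fin K)) :
    Measurable fun x => receivedCov P (A x) (fun j => Q j x) s :=
  measurable_matrix_smul _ (measurable_matrix_sum _ fun j _ => measurable_matrix_mul
    (measurable_matrix_mul (measurable_matrix_conjTranspose hA) (hQ j)) hA)

end rate

/-! ### General position and the canonical precoding subspaces -/

section generic
variable {K M N n : ℕ} {ρ : Measure (Fin K → Fin n → Matrix (Fin M) (Fin M) ℂ)}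

open scoped ComplexOrder in
lemma isRankProj_kerProj {E : Matrix (Fin M) (Fin N) ℂ} {T : Matrix (Fin M) (Fin M) ℂ}
    (hE : Eᴴ * E = 1) (hT : (T + E * Eᴴ).det ≠ 0) : IsRankProj N (kerProj E T) := by
  refine isRankProj_colProj fun h => ?_
  obtain ⟨v, hv, h0⟩ := Matrix.exists_mulVec_eq_zero_iff.2 h
  rw [Matrix.conjTranspose_mul_self_mulVec_eq_zero] at h0
  have hinv : (T + E * Eᴴ) * ((T + E * Eᴴ)⁻¹ * E) = E := by
    rw [← Matrix.mul_assoc, Matrix.mul_nonsing_inv _ (isUnit_iff_ne_zero.2 hT), Matrix.one_mul]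
  have h1 : (Eᴴ * (T + E * Eᴴ)) *ᵥ (((T + E * Eᴴ)⁻¹ * E) *ᵥ v) = v := by
    rw [Matrix.mulVec_mulVec, Matrix.mul_assoc, hinv, hE, Matrix.one_mulVec]
  rw [h0, Matrix.mulVec_zero] at h1
  exact hv h1.symm

/-- The projection onto the precoding subspace of user `j` under finite rate feedback. -/
def feedbackProj [NeZero n] (hM : M = K * N) (j : Fin K) (x : Realization K M N n) :
    Matrix (Fin M) (Fin M) ℂ :=
  kerProj (blockColumns hM j) (∑ l ∈ Finset.univ.erase j, quantizedProj l x)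

/-- The projection onto the precoding subspace of user `j` under perfect channel knowledge. -/
def perfectProj (hM : M = K * N) (j : Fin K) (x : Realization K M N n) :
    Matrix (Fin M) (Fin M) ℂ :=
  kerProj (blockColumns hM j) (∑ l ∈ Finset.univ.erase j, colProj (x.1 l))

lemma measurable_feedbackProj [NeZero n] (hM : M = K * N) (j : Fin K) :
    Measurable (feedbackProj (n := n) hM j) :=
  measurable_kerProj _ (measurable_matrix_sum _ fun l _ => measurable_quantizedProj l)

lemma measurable_perfectProj (hM : M = K * N) (j : Fin K) :
    Measurable (perfectProj (n := n) hM j) :=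
  measurable_kerProj _ (measurable_matrix_sum _ fun l _ => measurable_colProj (measurable_channel l))

lemma feedbackProj_rotateChannel [NeZero n] (hM : M = K * N) (i : Fin K)
    (U : Matrix.unitaryGroup (Fin M) ℂ) (x : Realization K M N n) :
    feedbackProj hM i (rotateChannel i U x.1, x.2) = feedbackProj hM i x := by
  unfold feedbackProj quantizedProj
  rw [Finset.sum_congr rfl fun l hl => ?_]
  simp only [rotateChannel_of_ne i U x.1 (Finset.ne_of_mem_erase hl)]

lemma perfectProj_rotateChannel (hM : M = K * N) (i : Fin K)
    (U : Matrix.unitaryGroup (Fin M) ℂ) (x : Realization K M N n) :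
    perfectProj hM i (rotateChannel i U x.1, x.2) = perfectProj hM i x := by
  unfold perfectProj
  rw [Finset.sum_congr rfl fun l hl => ?_]
  simp only [rotateChannel_of_ne i U x.1 (Finset.ne_of_mem_erase hl)]

/-- The properties of almost all realizations that make the quantized subspaces and the precoding
subspaces unique. A tie between codewords that span the same subspace is harmless, and it is not
excluded. -/
structure IsGeneric [NeZero n] (hM : M = K * N) (x : Realization K M N n) : Prop where
  det_channel : ∀ l, ((x.1 l)ᴴ * x.1 l).det ≠ 0
  isRankProj : ∀ l k, IsRankProj N (x.2 l k)
  no_tie : ∀ l k k', (colProj (x.1 l) * x.2 l k).trace.re = (colProj (x.1 l) * x.2 l k').trace.re →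
    x.2 l k = x.2 l k'
  det_feedback : ∀ j, (∑ l ∈ Finset.univ.erase j, quantizedProj l x
    + blockColumns hM j * (blockColumns hM j)ᴴ).det ≠ 0
  det_perfect : ∀ j, (∑ l ∈ Finset.univ.erase j, colProj (x.1 l)
    + blockColumns hM j * (blockColumns hM j)ᴴ).det ≠ 0

lemma IsCodebookLaw.ae_no_tie (hρ : IsCodebookLaw N ρ) (hM : M = K * N) (l : Fin K) (k k' : Fin n) :
    ∀ᵐ x ∂(gaussianFamily K M N).prod ρ,
      (colProj (x.1 l) * x.2 l k).trace.re = (colProj (x.1 l) * x.2 l k').trace.re →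
        x.2 l k = x.2 l k' := by
  have hprob := hρ.isProbabilityMeasure
  have htr : ∀ k, Measurable fun x : Realization K M N n =>
      (colProj (x.1 l) * x.2 l k).trace.re := fun k =>
    Complex.measurable_re.comp (measurable_matrix_trace (measurable_matrix_mul
      (measurable_colProj (measurable_channel l)) (measurable_codebook l k)))
  have hset : MeasurableSet {x : Realization K M N n |
      (colProj (x.1 l) * x.2 l k).trace.re = (colProj (x.1 l) * x.2 l k').trace.re →
        x.2 l k = x.2 l k'} := by
    simp only [imp_iff_not_or]
    exact (measurableSet_eq_fun (htr k) (htr k')).compl.union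
      (measurableSet_eq_fun (measurable_codebook l k) (measurable_codebook l k'))
  rw [Measure.ae_prod_iff_ae_ae hset, Measure.ae_ae_comm hset]
  filter_upwards [hρ.isRankProj] with P hP
  by_cases h : P l k = P l k'
  · exact Filter.Eventually.of_forall fun _ _ => h
  · filter_upwards [gaussianFamily_ae_no_tie hM l (hP l k) (hP l k') h] with H hH h2
    exact absurd h2 hH

lemma IsCodebookLaw.ae_isGeneric [NeZero n] (hρ : IsCodebookLaw N ρ) (hM : M = K * N) (hK : 0 < K) :
    ∀ᵐ x ∂(gaussianFamily K M N).prod ρ, IsGeneric hM x := by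
  have hprob := hρ.isProbabilityMeasure
  have htie : ∀ᵐ x ∂(gaussianFamily K M N).prod ρ, ∀ l k k',
      (colProj (x.1 l) * x.2 l k).trace.re = (colProj (x.1 l) * x.2 l k').trace.re →
        x.2 l k = x.2 l k' :=
    ae_all_iff.2 fun l => ae_all_iff.2 fun k => ae_all_iff.2 fun k' => hρ.ae_no_tie hM l k k'
  have hdet : ∀ᵐ Q ∂ρ, ∀ (j : Fin K) (k : Fin K → Fin n), (∑ l ∈ Finset.univ.erase j, Q l (k l)
      + blockColumns hM j * (blockColumns hM j)ᴴ).det ≠ 0 :=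
    ae_all_iff.2 fun j => ae_all_iff.2 fun k => hρ.ae_det_ne_zero hM hK j k
  have hdet' : ∀ᵐ H ∂gaussianFamily K M N, ∀ j : Fin K, (∑ l ∈ Finset.univ.erase j, colProj (H l)
      + blockColumns hM j * (blockColumns hM j)ᴴ).det ≠ 0 :=
    ae_all_iff.2 fun j => gaussianFamily_ae_det_ne_zero hM j
  filter_upwards [ae_prod_of_ae_fst (gaussianFamily_ae_fullRank hM),
    ae_prod_of_ae_snd hρ.isRankProj, htie, ae_prod_of_ae_snd hdet, ae_prod_of_ae_fst hdet']
    with x h1 h2 h3 h4 h5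
  exact ⟨h1, h2, h3, fun j => h4 j fun l => firstArgmax fun k => (colProj (x.1 l) * x.2 l k).trace.re,
    h5⟩

variable [NeZero n] {hM : M = K * N} {x : Realization K M N n}

lemma IsGeneric.isRankProj_feedbackProj (hx : IsGeneric hM x) (j : Fin K) :
    IsRankProj N (feedbackProj hM j x) :=
  isRankProj_kerProj (blockColumns_conjTranspose_mul_self hM j) (hx.det_feedback j)

lemma IsGeneric.isRankProj_perfectProj (hx : IsGeneric hM x) (j : Fin K) :
    IsRankProj N (perfectProj hM j x) :=
  isRankProj_kerProj (blockColumns_conjTranspose_mul_self hM j) (hx.det_perfect j)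

/-- The squared chordal distance from the channel of user `i` to its quantization, which is the
minimum over its codebook. -/
def quantizationError (i : Fin K) (x : Realization K M N n) : ℝ :=
  ((1 - quantizedProj i x) * colProj (x.1 i)).trace.re

lemma measurable_quantizationError (i : Fin K) :
    Measurable (quantizationError (M := M) (N := N) (n := n) i) :=
  Complex.measurable_re.comp (measurable_matrix_trace (measurable_matrix_mul
    (measurable_matrix_sub measurable_const (measurable_quantizedProj i))
    (measurable_colProj (measurable_channel i))))

lemma IsGeneric.quantizationError_eq (hx : IsGeneric hM x) (i : Fin K) :
    quantizationError i x = N - (colProj (x.1 i) * quantizedProj i x).trace.re := by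
  rw [quantizationError, Matrix.sub_mul, Matrix.one_mul, Matrix.trace_sub,
    (isRankProj_colProj (hx.det_channel i)).trace_eq, Matrix.trace_mul_comm, Complex.sub_re,
    Complex.natCast_re]

open scoped ComplexOrder in
lemma IsGeneric.quantizationError_nonneg (hx : IsGeneric hM x) (hr : N ≤ M) (i : Fin K) :
    0 ≤ quantizationError i x := by
  have h1 := isRankProj_colProj (hx.det_channel i)
  have h2 := ((isRankProj_quantProj (hx.isRankProj i) (colProj (x.1 i))).one_sub hr).posSemidef
  have h3 := (Complex.le_def.1 (h2.conjTranspose_mul_mul_same (colProj (x.1 i))).trace_nonneg).1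
  rw [h1.conjTranspose_eq, Matrix.mul_assoc, Matrix.trace_mul_comm, Matrix.mul_assoc,
    h1.mul_self] at h3
  exact h3

open scoped ComplexOrder in
lemma IsGeneric.quantizationError_le (hx : IsGeneric hM x) (i : Fin K) :
    quantizationError i x ≤ N := by
  have h1 := isRankProj_colProj (hx.det_channel i)
  have h2 := (isRankProj_quantProj (hx.isRankProj i) (colProj (x.1 i))).posSemidef
  have h3 := (Complex.le_def.1 (h2.conjTranspose_mul_mul_same (colProj (x.1 i))).trace_nonneg).1
  rw [h1.conjTranspose_eq, Matrix.trace_mul_comm, ← Matrix.mul_assoc, h1.mul_self] at h3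
  rw [hx.quantizationError_eq i]
  exact sub_le_self _ h3

end generic

/-! ### The rate loss on the canonical probability space -/

section loss
variable {K M N n : ℕ} {ρ : Measure (Fin K → Fin n → Matrix (Fin M) (Fin M) ℂ)}

lemma IsCodebookLaw.integrable_trace_channel (hρ : IsCodebookLaw N ρ) (i : Fin K) :
    Integrable (fun x => (x.1 i * (x.1 i)ᴴ).trace.re) ((gaussianFamily K M N).prod ρ) := by
  have hprob := hρ.isProbabilityMeasure
  have h0 : ∀ A : Matrix (Fin M) (Fin N) ℂ, 0 ≤ (A * Aᴴ).trace.re := fun A => by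
    open scoped ComplexOrder in
    exact (Complex.le_def.1 (Matrix.posSemidef_self_mul_conjTranspose A).trace_nonneg).1
  have hm : Measurable fun H : Fin K → Matrix (Fin M) (Fin N) ℂ => (H i * (H i)ᴴ).trace.re :=
    Complex.measurable_re.comp (measurable_matrix_trace
      (measurable_mul_conjTranspose_self (measurable_member i)))
  have hint : Integrable (fun H : Fin K → Matrix (Fin M) (Fin N) ℂ => (H i * (H i)ᴴ).trace.re)
      (gaussianFamily K M N) := by
    rw [← lintegral_ofReal_ne_top_iff_integrable hm.aestronglyMeasurable
      (Filter.Eventually.of_forall fun H => h0 (H i)), lintegral_trace_gaussianFamily]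
    exact ENNReal.mul_ne_top (ENNReal.natCast_ne_top _) (ENNReal.natCast_ne_top _)
  exact hint.comp_fst ρ

/-- Each rate has a finite mean, because `log det (1 + X) ≤ tr X`. -/
lemma IsCodebookLaw.integrable_log2Det (hρ : IsCodebookLaw N ρ) (hr : N ≤ M) {P : ℝ} (hP : 0 ≤ P)
    (i : Fin K) {Q : Fin K → Realization K M N n → Matrix (Fin M) (Fin M) ℂ}
    (hQm : ∀ j, Measurable (Q j))
    (hQ : ∀ᵐ x ∂(gaussianFamily K M N).prod ρ, ∀ j, IsRankProj N (Q j x)) (s : Finset (Fin K)) :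
    Integrable (fun x => log2Det (1 + receivedCov P (x.1 i) (fun j => Q j x) s))
      ((gaussianFamily K M N).prod ρ) := by
  refine Integrable.mono' (((hρ.integrable_trace_channel (n := n) i).const_mul (s.card : ℝ)).const_mul
    (P / K) |>.div_const (Real.log 2)) (measurable_log2Det (measurable_matrix_add measurable_const
      (measurable_receivedCov P (measurable_channel i) hQm s))).aestronglyMeasurable ?_
  filter_upwards [hQ] with x hx
  rw [Real.norm_of_nonneg (log2Det_one_add_nonneg
    (posSemidef_receivedCov hP (fun j => (hx j).posSemidef) s))]
  exact log2Det_receivedCov_le hP hx hr s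

variable [NeZero n]

lemma IsCodebookLaw.integrable_quantizationError (hρ : IsCodebookLaw N ρ) (hM : M = K * N)
    (i : Fin K) :
    Integrable (quantizationError i) ((gaussianFamily K M N).prod ρ) := by
  have hprob := hρ.isProbabilityMeasure
  have hr : N ≤ M := by
    rw [hM]
    exact Nat.le_mul_of_pos_left N i.pos
  refine Integrable.mono' (integrable_const (N : ℝ))
    (measurable_quantizationError i).aestronglyMeasurable ?_
  filter_upwards [hρ.ae_isGeneric hM i.pos] with x hx
  rw [Real.norm_of_nonneg (hx.quantizationError_nonneg hr i)]
  exact hx.quantizationError_le i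

/-- Perfect and finite rate feedback give the desired signal the same mean rate. -/
lemma IsCodebookLaw.integral_signal_eq (hρ : IsCodebookLaw N ρ) (hM : M = K * N) {P : ℝ}
    (hP : 0 ≤ P) (i : Fin K) :
    ∫ x, log2Det (1 + receivedCov P (x.1 i) (fun j => perfectProj hM j x) {i})
        ∂(gaussianFamily K M N).prod ρ
      = ∫ x, log2Det (1 + receivedCov P (x.1 i) (fun j => feedbackProj hM j x) {i})
        ∂(gaussianFamily K M N).prod ρ := by
  have hprob := hρ.isProbabilityMeasure
  have hr : N ≤ M := by
    rw [hM]
    exact Nat.le_mul_of_pos_left N i.pos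
  have hgen := hρ.ae_isGeneric hM i.pos
  have hm : ∀ {Q : Fin K → Realization K M N n → Matrix (Fin M) (Fin M) ℂ},
      (∀ j, Measurable (Q j)) → Measurable fun x : Realization K M N n =>
        log2Det (1 + receivedCov P (x.1 i) (fun j => Q j x) {i}) := fun hQ =>
    measurable_log2Det (measurable_matrix_add measurable_const
      (measurable_receivedCov P (measurable_channel i) hQ {i}))
  have hf : Measurable fun X : Matrix (Fin N) (Fin N) ℂ =>
      ENNReal.ofReal (log2Det (1 + (P / (K : ℝ)) • X)) :=
    (measurable_log2Det (measurable_matrix_add measurable_const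
      (measurable_matrix_smul _ measurable_id))).ennreal_ofReal
  rw [integral_eq_lintegral_of_nonneg_ae _ (hm (measurable_perfectProj hM)).aestronglyMeasurable,
    integral_eq_lintegral_of_nonneg_ae _ (hm (measurable_feedbackProj hM)).aestronglyMeasurable]
  · refine congrArg ENNReal.toReal ?_
    simp only [receivedCov, Finset.sum_singleton]
    exact hρ.lintegral_conj_channel_eq i hr (measurable_perfectProj hM i)
      (measurable_feedbackProj hM i)
      (by filter_upwards [hgen] with x hx using hx.isRankProj_perfectProj i)
      (by filter_upwards [hgen] with x hx using hx.isRankProj_feedbackProj i)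
      (perfectProj_rotateChannel hM i) (feedbackProj_rotateChannel hM i) hf
  · filter_upwards [hgen] with x hx
    exact log2Det_one_add_nonneg
      (posSemidef_receivedCov hP (fun j => (hx.isRankProj_feedbackProj j).posSemidef) {i})
  · filter_upwards [hgen] with x hx
    exact log2Det_one_add_nonneg
      (posSemidef_receivedCov hP (fun j => (hx.isRankProj_perfectProj j).posSemidef) {i})

/-- A user receives from each interfering precoder at most the mean power `M D / (K - 1)`. -/
lemma IsCodebookLaw.integral_interference_le (hρ : IsCodebookLaw N ρ) (hN : 0 < N) (hM : M = K * N)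
    {i j : Fin K} (hij : i ≠ j) :
    Integrable (fun x => (feedbackProj hM j x * (x.1 i * (x.1 i)ᴴ)).trace.re)
      ((gaussianFamily K M N).prod ρ) ∧
    (K - 1 : ℝ) * ∫ x, (feedbackProj hM j x * (x.1 i * (x.1 i)ᴴ)).trace.re
        ∂(gaussianFamily K M N).prod ρ
      ≤ M * ∫ x, quantizationError i x ∂(gaussianFamily K M N).prod ρ := by
  have hprob := hρ.isProbabilityMeasure
  have hr : N ≤ M := by
    rw [hM]
    exact Nat.le_mul_of_pos_left N i.pos
  have hK : 1 < K := by
    have h1 := i.2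
    have h2 := j.2
    have h3 : (i : ℕ) ≠ j := fun h => hij (Fin.ext h)
    omega
  have hgen := hρ.ae_isGeneric hM i.pos
  have hm : Measurable fun x : Realization K M N n =>
      (feedbackProj hM j x * (x.1 i * (x.1 i)ᴴ)).trace.re :=
    Complex.measurable_re.comp (measurable_matrix_trace (measurable_matrix_mul
      (measurable_feedbackProj hM j) (measurable_mul_conjTranspose_self (measurable_channel i))))
  have h0 : 0 ≤ᵐ[(gaussianFamily K M N).prod ρ] fun x =>
      (feedbackProj hM j x * (x.1 i * (x.1 i)ᴴ)).trace.re :=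
    Filter.Eventually.of_forall fun x => by
      open scoped ComplexOrder in
      have h := (Complex.le_def.1 ((posSemidef_kerProj (blockColumns hM j) (∑ l ∈ Finset.univ.erase j,
        quantizedProj l x)).conjTranspose_mul_mul_same (x.1 i)).trace_nonneg).1
      rw [Matrix.trace_mul_comm, ← Matrix.mul_assoc, Matrix.trace_mul_comm] at h
      exact h
  have herr := hρ.integrable_quantizationError hM i
  have herr0 : 0 ≤ᵐ[(gaussianFamily K M N).prod ρ] quantizationError i := by
    filter_upwards [hgen] with x hx using hx.quantizationError_nonneg hr i
  have hle : ((M - N : ℕ) : ENNReal) * ∫⁻ x, ENNReal.ofReal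
        (feedbackProj hM j x * (x.1 i * (x.1 i)ᴴ)).trace.re ∂(gaussianFamily K M N).prod ρ
      ≤ N * (M * ENNReal.ofReal (∫ x, quantizationError i x ∂(gaussianFamily K M N).prod ρ)) := by
    rw [ofReal_integral_eq_lintegral_ofReal herr herr0]
    refine (hρ.lintegral_interference_le hN hM hij).trans (le_of_eq ?_)
    rw [hρ.lintegral_error_eq hN hM i]
    rfl
  have hMN : ((M - N : ℕ) : ENNReal) ≠ 0 := by
    have : N < M := by
      rw [hM]
      exact lt_mul_of_one_lt_left hN hK
    exact Nat.cast_ne_zero.2 (by omega)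
  have htop : N * (M * ENNReal.ofReal (∫ x, quantizationError i x ∂(gaussianFamily K M N).prod ρ))
      ≠ ⊤ :=
    ENNReal.mul_ne_top (ENNReal.natCast_ne_top _)
      (ENNReal.mul_ne_top (ENNReal.natCast_ne_top _) ENNReal.ofReal_ne_top)
  have hint : Integrable (fun x => (feedbackProj hM j x * (x.1 i * (x.1 i)ᴴ)).trace.re)
      ((gaussianFamily K M N).prod ρ) := by
    rw [← lintegral_ofReal_ne_top_iff_integrable hm.aestronglyMeasurable h0]
    intro h
    rw [h, ENNReal.mul_top hMN] at hle
    exact htop (top_le_iff.1 hle)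
  refine ⟨hint, ?_⟩
  rw [← ofReal_integral_eq_lintegral_ofReal hint h0] at hle
  have hreal := ENNReal.toReal_mono htop hle
  rw [ENNReal.toReal_mul, ENNReal.toReal_mul, ENNReal.toReal_mul, ENNReal.toReal_natCast,
    ENNReal.toReal_natCast, ENNReal.toReal_natCast, ENNReal.toReal_ofReal (integral_nonneg_of_ae h0),
    ENNReal.toReal_ofReal (integral_nonneg_of_ae herr0), Nat.cast_sub hr] at hreal
  have hN' : (0 : ℝ) < N := Nat.cast_pos.2 hN
  -- As `M = K N`, the dimension `M - N` is `(K - 1) N`.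
  have hMc : (M : ℝ) = K * N := by rw [hM, Nat.cast_mul]
  refine le_of_mul_le_mul_left (le_trans (le_of_eq ?_) hreal) hN'
  rw [hMc]
  ring

/-- The mean interference rate is at most `N log₂ (1 + P D)`, by concavity of `log det`. -/
lemma IsCodebookLaw.integral_interference_rate_le (hρ : IsCodebookLaw N ρ) (hN : 0 < N)
    (hM : M = K * N) (hK : 1 < K) {P : ℝ} (hP : 0 ≤ P) (i : Fin K) :
    ∫ x, log2Det (1 + receivedCov P (x.1 i) (fun j => feedbackProj hM j x) (Finset.univ.erase i))
        ∂(gaussianFamily K M N).prod ρ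
      ≤ N * Real.logb 2 (1 + P * ∫ x, quantizationError i x ∂(gaussianFamily K M N).prod ρ) := by
  have hprob := hρ.isProbabilityMeasure
  have hr : N ≤ M := by
    rw [hM]
    exact Nat.le_mul_of_pos_left N i.pos
  have hgen := hρ.ae_isGeneric hM i.pos
  set Λ := (gaussianFamily K M N).prod ρ
  set D := ∫ x, quantizationError i x ∂Λ
  have hD : 0 ≤ D := integral_nonneg_of_ae (by
    filter_upwards [hgen] with x hx using hx.quantizationError_nonneg hr i)
  have hc : 0 < 1 + P * D := by positivity
  have hlog : 0 < Real.log 2 := Real.log_pos one_lt_two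
  have hj : ∀ j ∈ Finset.univ.erase i, i ≠ j := fun j h => (Finset.ne_of_mem_erase h).symm
  -- The interference power. The tangent is taken at `1 + P D`, because `N P D` bounds its mean.
  let τ : Realization K M N n → ℝ := fun x => P / K * ∑ j ∈ Finset.univ.erase i,
    (feedbackProj hM j x * (x.1 i * (x.1 i)ᴴ)).trace.re
  have hτ : Integrable τ Λ := (integrable_finsetSum _ fun j h =>
    (hρ.integral_interference_le hN hM (hj j h)).1).const_mul _
  have hτle : ∫ x, τ x ∂Λ ≤ N * (P * D) := by
    have hK' : (0 : ℝ) < K := Nat.cast_pos.2 i.pos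
    have hK1 : (0 : ℝ) < K - 1 := sub_pos.2 (Nat.one_lt_cast.2 hK)
    have hsum : ∫ x, τ x ∂Λ = P / K * ∑ j ∈ Finset.univ.erase i,
        ∫ x, (feedbackProj hM j x * (x.1 i * (x.1 i)ᴴ)).trace.re ∂Λ := by
      rw [← integral_finsetSum _ fun j h => (hρ.integral_interference_le hN hM (hj j h)).1,
        ← integral_const_mul]
    have hbound : ∑ j ∈ Finset.univ.erase i,
        ∫ x, (feedbackProj hM j x * (x.1 i * (x.1 i)ᴴ)).trace.re ∂Λ ≤ M * D := by
      refine (Finset.sum_le_card_nsmul _ _ (M * D / (K - 1)) fun j h => ?_).trans (le_of_eq ?_)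
      · rw [le_div_iff₀ hK1, mul_comm]
        exact (hρ.integral_interference_le hN hM (hj j h)).2
      · rw [Finset.card_erase_of_mem (Finset.mem_univ i), Finset.card_univ, Fintype.card_fin,
          nsmul_eq_mul, Nat.cast_sub i.pos, Nat.cast_one]
        field_simp
    rw [hsum]
    refine (mul_le_mul_of_nonneg_left hbound (div_nonneg hP hK'.le)).trans (le_of_eq ?_)
    rw [hM, Nat.cast_mul]
    field_simp
  have hτsub : Integrable (fun x => τ x - N * (1 + P * D - 1)) Λ := hτ.sub (integrable_const _)
  have hτdiv : Integrable (fun x => (τ x - N * (1 + P * D - 1)) / ((1 + P * D) * Real.log 2)) Λ :=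
    hτsub.div_const _
  have hτint : Integrable (fun x => N * Real.logb 2 (1 + P * D)
      + (τ x - N * (1 + P * D - 1)) / ((1 + P * D) * Real.log 2)) Λ :=
    (integrable_const _).add hτdiv
  refine (integral_mono_ae (hρ.integrable_log2Det hr hP i (measurable_feedbackProj hM)
    (by filter_upwards [hgen] with x hx using hx.isRankProj_feedbackProj) _) hτint ?_).trans ?_
  · filter_upwards [hgen] with x hx
    have h := log2Det_one_add_le (posSemidef_receivedCov (A := x.1 i) hP
      (fun j => (hx.isRankProj_feedbackProj j).posSemidef) (Finset.univ.erase i)) hc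
    rwa [trace_receivedCov] at h
  · rw [integral_add (integrable_const _) hτdiv,
      integral_div, integral_sub hτ (integrable_const _), integral_const, integral_const,
      probReal_univ, one_smul, one_smul, add_sub_cancel_left]
    exact add_le_of_nonpos_right (div_nonpos_of_nonpos_of_nonneg (sub_nonpos.2 hτle)
      (mul_pos hc hlog).le)

/-- The rate loss for the canonical choice of quantizations and precoding subspaces. -/
lemma IsCodebookLaw.rate_loss_le (hρ : IsCodebookLaw N ρ) (hN : 0 < N) (hM : M = K * N) (hK : 1 < K)
    {P : ℝ} (hP : 0 ≤ P) (i : Fin K) :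
    (∫ x, log2Det (1 + receivedCov P (x.1 i) (fun j => perfectProj hM j x) {i})
        ∂(gaussianFamily K M N).prod ρ)
      - ((∫ x, log2Det (1 + receivedCov P (x.1 i) (fun j => feedbackProj hM j x) Finset.univ)
          ∂(gaussianFamily K M N).prod ρ)
        - ∫ x, log2Det (1 + receivedCov P (x.1 i) (fun j => feedbackProj hM j x)
          (Finset.univ.erase i)) ∂(gaussianFamily K M N).prod ρ)
      ≤ N * Real.logb 2 (1 + P * ∫ x, quantizationError i x ∂(gaussianFamily K M N).prod ρ) := by
  have hr : N ≤ M := by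
    rw [hM]
    exact Nat.le_mul_of_pos_left N i.pos
  have hgen := hρ.ae_isGeneric hM i.pos
  have hint := hρ.integrable_log2Det hr hP i (measurable_feedbackProj hM)
    (by filter_upwards [hgen] with x hx using hx.isRankProj_feedbackProj)
  have hmono : ∫ x, log2Det (1 + receivedCov P (x.1 i) (fun j => feedbackProj hM j x) {i})
        ∂(gaussianFamily K M N).prod ρ
      ≤ ∫ x, log2Det (1 + receivedCov P (x.1 i) (fun j => feedbackProj hM j x) Finset.univ)
        ∂(gaussianFamily K M N).prod ρ := by
    refine integral_mono_ae (hint _) (hint _) ?_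
    filter_upwards [hgen] with x hx
    have hpos := fun s => posSemidef_receivedCov (A := x.1 i) hP
      (fun j => (hx.isRankProj_feedbackProj j).posSemidef) s
    have h := log2Det_one_add_mono (hpos {i}) (hpos (Finset.univ.erase i))
    have hsum : receivedCov P (x.1 i) (fun j => feedbackProj hM j x) Finset.univ
        = receivedCov P (x.1 i) (fun j => feedbackProj hM j x) {i}
          + receivedCov P (x.1 i) (fun j => feedbackProj hM j x) (Finset.univ.erase i) := by
      rw [receivedCov, receivedCov, receivedCov, ← smul_add, Finset.sum_singleton,
        Finset.add_sum_erase _ (fun j => (x.1 i)ᴴ * feedbackProj hM j x * x.1 i) (Finset.mem_univ i)]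
    rwa [hsum]
  have h1 := hρ.integral_signal_eq hM hP i
  have h2 := hρ.integral_interference_rate_le hN hM hK hP i
  linarith

end loss

/-! ### Transfer to arbitrary quantizations and precoders -/

section transfer
variable {K M N n : ℕ}

/-- The channels, and the projections onto the codeword subspaces. -/
def realize (H : Fin K → Matrix (Fin M) (Fin N) ℂ) (W : Fin K → Fin n → Matrix (Fin M) (Fin N) ℂ) :
    Realization K M N n :=
  (H, fun l k => W l k * (W l k)ᴴ)

section
variable {Ω : Type*} [MeasurableSpace Ω] {μ : Measure Ω} [IsProbabilityMeasure μ]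
  {H : Fin K → Ω → Matrix (Fin M) (Fin N) ℂ} {W : Fin K → Fin n → Ω → Matrix (Fin M) (Fin N) ℂ}

/-- The channels are independent of the codebooks, so that their joint law is a product. -/
lemma measurePreserving_realize (hH : IsGaussianChannel μ H) (hW : IsRandomCodebook μ W)
    (hHW : IndepFun (fun ω l => H l ω) (fun ω l k => W l k ω) μ) :
    MeasurePreserving (fun ω => realize (fun l => H l ω) fun l k => W l k ω) μ
      ((gaussianFamily K M N).prod (μ.map fun ω l k => W l k ω * (W l k ω)ᴴ)) := by
  have hHm : Measurable fun ω l => H l ω := measurable_pi_lambda _ hH.1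
  have hg : Measurable fun (C : Fin K → Fin n → Matrix (Fin M) (Fin N) ℂ) (l : Fin K) (k : Fin n) =>
      C l k * (C l k)ᴴ :=
    measurable_pi_lambda _ fun l => measurable_pi_lambda _ fun k =>
      measurable_mul_conjTranspose_self ((measurable_pi_apply k).comp (measurable_pi_apply l))
  have hind : IndepFun (fun ω l => H l ω) (fun ω l k => W l k ω * (W l k ω)ᴴ) μ :=
    hHW.comp measurable_id hg
  refine ⟨hHm.prodMk hW.measurable_projs, ?_⟩
  rw [← hH.map_eq]
  exact (indepFun_iff_map_prod_eq_prod_map_map hHm.aemeasurable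
    hW.measurable_projs.aemeasurable).1 hind

end

variable [NeZero n] {hM : M = K * N} {H Hhat V : Fin K → Matrix (Fin M) (Fin N) ℂ}
  {W : Fin K → Fin n → Matrix (Fin M) (Fin N) ℂ}

lemma IsGeneric.chordalDist_sq_codeword (hx : IsGeneric hM (realize H W))
    (hW : ∀ l k, (W l k)ᴴ * W l k = 1) (l : Fin K) (k : Fin n) :
    chordalDist (H l) (W l k) ^ 2 = N - (colProj (H l) * (W l k * (W l k)ᴴ)).trace.re :=
  chordalDist_sq (hx.det_channel l) (hW l k)

/-- The minimizing codeword subspace is unique, even when some codewords span the same subspace. -/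
lemma IsGeneric.quantization_mul_conjTranspose (hx : IsGeneric hM (realize H W))
    (hW : ∀ l k, (W l k)ᴴ * W l k = 1) {l : Fin K} {Q : Matrix (Fin M) (Fin N) ℂ}
    (hQ : IsQuantization (W l) (H l) Q) : Q * Qᴴ = quantizedProj l (realize H W) := by
  obtain ⟨k, rfl, hk⟩ := hQ
  refine hx.no_tie l k _ (le_antisymm (le_firstArgmax
    (fun k => (colProj (H l) * (W l k * (W l k)ᴴ)).trace.re) k) ?_)
  have h := hk (firstArgmax fun k => (colProj (H l) * (W l k * (W l k)ᴴ)).trace.re)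
  rw [hx.chordalDist_sq_codeword hW, hx.chordalDist_sq_codeword hW] at h
  exact (sub_le_sub_iff_left _).1 h

lemma IsGeneric.chordalDist_sq_quantization (hx : IsGeneric hM (realize H W))
    (hW : ∀ l k, (W l k)ᴴ * W l k = 1) {l : Fin K} {Q : Matrix (Fin M) (Fin N) ℂ}
    (hQ : IsQuantization (W l) (H l) Q) :
    chordalDist (H l) Q ^ 2 = quantizationError l (realize H W) := by
  rw [hx.quantizationError_eq, ← hx.quantization_mul_conjTranspose hW hQ]
  obtain ⟨k, rfl, -⟩ := hQ
  exact hx.chordalDist_sq_codeword hW l k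

lemma IsQuantization.iInf_chordalDist_sq {C : Fin n → Matrix (Fin M) (Fin N) ℂ}
    {A Q : Matrix (Fin M) (Fin N) ℂ} (hQ : IsQuantization C A Q) :
    ⨅ k, chordalDist A (C k) ^ 2 = chordalDist A Q ^ 2 := by
  obtain ⟨k, rfl, hk⟩ := hQ
  exact le_antisymm (ciInf_le (Set.finite_range _).bddBelow k) (le_ciInf hk)

lemma sum_mul_conjTranspose_mul_eq_zero {G : Fin K → Matrix (Fin M) (Fin N) ℂ}
    (hV : IsBDPrecoder G V) (j : Fin K) {p : Fin K → Matrix (Fin M) (Fin M) ℂ}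
    (hp : ∀ l, ∃ B : Matrix (Fin M) (Fin N) ℂ, p l = B * (G l)ᴴ) :
    (∑ l ∈ Finset.univ.erase j, p l) * V j = 0 := by
  rw [Matrix.sum_mul]
  refine Finset.sum_eq_zero fun l hl => ?_
  obtain ⟨B, hB⟩ := hp l
  rw [hB, Matrix.mul_assoc, (hV j).2 l (Finset.ne_of_mem_erase hl), Matrix.mul_zero]

lemma IsGeneric.precoder_mul_conjTranspose (hx : IsGeneric hM (realize H W))
    (hW : ∀ l k, (W l k)ᴴ * W l k = 1) (hQ : ∀ l, IsQuantization (W l) (H l) (Hhat l))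
    (hV : IsBDPrecoder Hhat V) (j : Fin K) :
    V j * (V j)ᴴ = feedbackProj hM j (realize H W) :=
  (kerProj_eq (hx.det_feedback j) (sum_mul_conjTranspose_mul_eq_zero hV j fun l =>
    ⟨_, (hx.quantization_mul_conjTranspose hW (hQ l)).symm⟩) (hV j).1).symm

lemma IsGeneric.perfect_precoder_mul_conjTranspose (hx : IsGeneric hM (realize H W))
    (hV : IsBDPrecoder H V) (j : Fin K) :
    V j * (V j)ᴴ = perfectProj hM j (realize H W) :=
  (kerProj_eq (hx.det_perfect j) (sum_mul_conjTranspose_mul_eq_zero hV j fun _ =>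
    ⟨_, rfl⟩) (hV j).1).symm

end transfer

end BlockDiag

end

theorem theorem1 {Ω : Type*} [MeasurableSpace Ω] (μ : Measure Ω) [IsProbabilityMeasure μ]
    (M N K B : ℕ) (hN : 0 < N) (hK : 1 < K) (hM : M = K * N) (P : ℝ) (hP : 0 < P)
    (H : Fin K → Ω → Matrix (Fin M) (Fin N) ℂ)
    (W : Fin K → Fin (2 ^ B) → Ω → Matrix (Fin M) (Fin N) ℂ)
    (Hhat V VBD : Fin K → Ω → Matrix (Fin M) (Fin N) ℂ)
    (hH : IsGaussianChannel μ H)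
    (hW : IsRandomCodebook μ W)
    (hHW : IndepFun (fun ω i => H i ω) (fun ω i k => W i k ω) μ)
    (hHhat : ∀ i, ∀ᵐ ω ∂μ, IsQuantization (fun k => W i k ω) (H i ω) (Hhat i ω))
    (hV : ∀ᵐ ω ∂μ, IsBDPrecoder (fun j => Hhat j ω) (fun j => V j ω))
    (hVBD : ∀ᵐ ω ∂μ, IsBDPrecoder (fun j => H j ω) (fun j => VBD j ω))
    (i : Fin K) :
    Integrable (fun ω => rateTerm P (H i ω) (fun j => VBD j ω) {i}) μ ∧
    Integrable (fun ω => rateTerm P (H i ω) (fun j => V j ω) Finset.univ) μ ∧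
    Integrable (fun ω => rateTerm P (H i ω) (fun j => V j ω) (Finset.univ.erase i)) μ ∧
    Integrable (fun ω => ⨅ k, chordalDist (H i ω) (W i k ω) ^ 2) μ ∧
    distortion μ (H i) (W i) = ∫ ω, chordalDist (H i ω) (Hhat i ω) ^ 2 ∂μ ∧
    rateBD μ P H VBD i - rateFB μ P H V i
      ≤ N * Real.logb 2 (1 + P * distortion μ (H i) (W i)) := by
  have hne : NeZero (2 ^ B) := ⟨by positivity⟩
  have hr : N ≤ M := by
    rw [hM]
    exact Nat.le_mul_of_pos_left N i.pos
  have hρ := hW.isCodebookLaw hr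
  have hZ := measurePreserving_realize hH hW hHW
  set ρ := μ.map fun ω l k => W l k ω * (W l k ω)ᴴ
  let Z : Ω → Realization K M N (2 ^ B) := fun ω => realize (fun l => H l ω) fun l k => W l k ω
  have hgen := hρ.ae_isGeneric hM i.pos
  have hgenZ : ∀ᵐ ω ∂μ, IsGeneric hM (Z ω) := hZ.quasiMeasurePreserving.ae hgen
  have hWorth : ∀ᵐ ω ∂μ, ∀ l k, (W l k ω)ᴴ * W l k ω = 1 :=
    ae_all_iff.2 fun l => ae_all_iff.2 fun k => (hW.1 l k).2.1
  have hQ : ∀ᵐ ω ∂μ, ∀ l, IsQuantization (fun k => W l k ω) (H l ω) (Hhat l ω) :=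
    ae_all_iff.2 hHhat
  -- Almost surely the rates and the distortion are functions of the channels and the codeword
  -- projections alone, whatever choice of quantizations and precoders is made.
  have hperf : (fun ω => rateTerm P (H i ω) (fun j => VBD j ω) {i}) =ᵐ[μ]
      fun ω => log2Det (1 + receivedCov P ((Z ω).1 i) (fun j => perfectProj hM j (Z ω)) {i}) := by
    filter_upwards [hgenZ, hVBD] with ω hω hv
    rw [rateTerm_eq, funext (hω.perfect_precoder_mul_conjTranspose hv)]
    rfl
  have hfeed : ∀ s, (fun ω => rateTerm P (H i ω) (fun j => V j ω) s) =ᵐ[μ]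
      fun ω => log2Det (1 + receivedCov P ((Z ω).1 i) (fun j => feedbackProj hM j (Z ω)) s) := by
    intro s
    filter_upwards [hgenZ, hWorth, hQ, hV] with ω hω hw hq hv
    rw [rateTerm_eq, funext (hω.precoder_mul_conjTranspose hw hq hv)]
    rfl
  have hquant : (fun ω => chordalDist (H i ω) (Hhat i ω) ^ 2) =ᵐ[μ]
      fun ω => quantizationError i (Z ω) := by
    filter_upwards [hgenZ, hWorth, hQ] with ω hω hw hq
    exact hω.chordalDist_sq_quantization hw (hq i)
  have hmin : (fun ω => ⨅ k, chordalDist (H i ω) (W i k ω) ^ 2) =ᵐ[μ]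
      fun ω => chordalDist (H i ω) (Hhat i ω) ^ 2 := by
    filter_upwards [hQ] with ω hq
    exact (hq i).iInf_chordalDist_sq
  have hint : ∀ {f : Realization K M N (2 ^ B) → ℝ}, Integrable f ((gaussianFamily K M N).prod ρ) →
      Integrable (fun ω => f (Z ω)) μ := fun hf => hZ.integrable_comp_of_integrable hf
  have hmap : ∀ {f : Realization K M N (2 ^ B) → ℝ}, Integrable f ((gaussianFamily K M N).prod ρ) →
      ∫ ω, f (Z ω) ∂μ = ∫ x, f x ∂(gaussianFamily K M N).prod ρ := fun {f} hf => by
    rw [← hZ.map_eq] at hf ⊢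
    exact (integral_map hZ.aemeasurable hf.aestronglyMeasurable).symm
  have hiP := hρ.integrable_log2Det hr hP.le i (measurable_perfectProj hM)
    (by filter_upwards [hgen] with x hx using hx.isRankProj_perfectProj) {i}
  have hiF := hρ.integrable_log2Det hr hP.le i (measurable_feedbackProj hM)
    (by filter_upwards [hgen] with x hx using hx.isRankProj_feedbackProj)
  have hiE := hρ.integrable_quantizationError hM i
  have hdist : distortion μ (H i) (W i) = ∫ ω, chordalDist (H i ω) (Hhat i ω) ^ 2 ∂μ :=
    integral_congr_ae hmin
  refine ⟨(integrable_congr hperf).2 (hint hiP), (integrable_congr (hfeed _)).2 (hint (hiF _)),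
    (integrable_congr (hfeed _)).2 (hint (hiF _)),
    (integrable_congr (hmin.trans hquant)).2 (hint hiE), hdist, ?_⟩
  rw [hdist, rateBD, rateFB, integral_congr_ae hperf, integral_congr_ae (hfeed _),
    integral_congr_ae (hfeed _), integral_congr_ae hquant, hmap hiP, hmap (hiF _), hmap (hiF _),
    hmap hiE]
  exact hρ.rate_loss_le hN hM hK hP.le i
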